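/- Let $\mathrm{Diff}^+(S^1)$ be the group of orientation preserving smooth diffeomorphisms of the unit circle $S^1\subset\mathbb C$ with the $C^\infty$-topology, and let $\mathrm{M\ddot ob}\subset \mathrm{Diff}^+(S^1)$ be the subgroup of Möbius transformations $z\mapsto\frac{\alpha z+\beta}{\bar\beta z+\bar\alpha}$, $|\alpha|^2-|\beta|^2=1$. Let $\mathcal I$ be the set of nonempty, nondense, open, connected subsets of $S^1$; for $I\in\mathcal I$ let $I'$ be the interior of $S^1\setminus I$. A *Möbius covariant net* $(\mathcal A,U,\Omega)$ on a complex Hilbert space $\mathcal H$ consists of a von Neumann algebra $\mathcal A(I)$ on $\mathcal H$ for each $I\in\mathcal I$, a strongly continuous unitary representation $U$ of $\mathrm{M\ddot ob}$ on $\mathcal H$ and a unit vector $\Omega\in\mathcal H$ such that: (1) $I_1\subset I_2$ implies $\mathcal A(I_1)\subset\mathcal A(I_2)$; (2) $U(g)\mathcal A(I)U(g)^*=\mathcal A(gI)$ for $g\in\mathrm{M\ddot ob}$; (3) the conformal Hamiltonian $L_0$, i.e. the generator of the one-parameter group of rotations ($U(R_t)=e^{itL_0}$, $R_tz=e^{it}z$),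 has nonnegative spectrum; (4) $\Omega$ is, up to a phase, the unique $U$-invariant unit vector; (5) $\Omega$ is cyclic for the von Neumann algebra $\bigvee_{I\in\mathcal I}\mathcal A(I)$; (6) $I_1\cap I_2=\emptyset$ implies $\mathcal A(I_1)\subset\mathcal A(I_2)'$. The net is *conformal* if $U$ extends to a strongly continuous projective unitary representation, again denoted $U$, of $\mathrm{Diff}^+(S^1)$, i.e. to a continuous homomorphism into $\mathcal U(\mathcal H)/\mathbb T$ (with the quotient of the strong operator topology), such that for all $\gamma\in \mathrm{Diff}^+(S^1)$ and $I\in\mathcal I$: $U(\gamma)\mathcal A(I)U(\gamma)^*=\mathcal A(\gamma I)$, and $U(\gamma)xU(\gamma)^*=x$ for every $x\in\mathcal A(I')$ if $\gamma$ acts identically on $I'$. **Lemma.** Let $(\mathcal A,U,\Omega)$ be a conformal net on a Hilbert space $\mathcal H$ with $\dim\mathcal H\neq 1$, and let $\gamma\in \mathrm{Diff}^+(S^1)$. Then $U(\gamma)\Omega\in\mathbb C\Omega$ (a condition which does not depend on the phase of $U(\gamma)$) if and only if $\gamma\in\mathrm{M\ddot ob}$. -/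

import Mathlib

open scoped Manifold ContDiff ComplexConjugate

namespace CircleNet

/-! ### The diffeomorphism group of the circle and the Möbius group -/

/-- The group of orientation preserving smooth diffeomorphisms of the unit circle. A homeomorphism
of the circle preserves the orientation iff it lifts to an increasing bijection of the real line. -/
noncomputable def DiffPlus : Subgroup (Equiv.Perm Circle) where
  carrier := {γ | ContMDiff (𝓡 1) (𝓡 1) ∞ (γ : Circle → Circle) ∧
    ContMDiff (𝓡 1) (𝓡 1) ∞ (γ.symm : Circle → Circle) ∧
    ∃ φ : ℝ ≃o ℝ, ∀ θ : ℝ, γ (Circle.exp θ) = Circle.exp (φ θ)}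
  mul_mem' := by
    rintro γ δ ⟨h1, h2, φ, hφ⟩ ⟨k1, k2, ψ, hψ⟩
    exact ⟨h1.comp k1, k2.comp h2, ψ.trans φ, fun θ => by simp [hψ, hφ]⟩
  one_mem' := ⟨contMDiff_id, contMDiff_id, OrderIso.refl ℝ, fun θ => rfl⟩
  inv_mem' := by
    rintro γ ⟨h1, h2, φ, hφ⟩
    refine ⟨h2, h1, φ.symm, fun θ => ?_⟩
    rw [Equiv.Perm.inv_def, Equiv.symm_apply_eq, hφ, φ.apply_symm_apply]

/-- The `C^∞` topology: uniform convergence of all derivatives (in the angle). -/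
noncomputable instance : TopologicalSpace DiffPlus :=
  TopologicalSpace.induced
    (fun (γ : DiffPlus) (n : ℕ) =>
      UniformFun.ofFun (iteratedDeriv n fun θ : ℝ => (γ.1 (Circle.exp θ) : ℂ)))
    (inferInstance : TopologicalSpace (ℕ → UniformFun ℝ ℂ))

lemma continuous_diffPlus (γ : DiffPlus) : Continuous (γ.1 : Circle → Circle) :=
  γ.2.1.continuous

lemma mob_denom_ne_zero {α β : ℂ} (h : ‖α‖ ^ 2 - ‖β‖ ^ 2 = 1) (z : Circle) :
    conj β * (z : ℂ) + conj α ≠ 0 := by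
  intro h0
  have h1 : ‖conj β * (z : ℂ)‖ = ‖conj α‖ := by
    rw [eq_neg_of_add_eq_zero_left h0, norm_neg]
  simp only [norm_mul, RCLike.norm_conj, Circle.norm_coe, mul_one] at h1
  rw [h1] at h
  simp at h

/-- The Möbius group: the maps `z ↦ (α z + β) / (conj β z + conj α)` with `|α|² - |β|² = 1`,
as a subgroup of the diffeomorphism group. -/
noncomputable def Mob : Subgroup DiffPlus where
  carrier := {γ | ∃ α β : ℂ, ‖α‖ ^ 2 - ‖β‖ ^ 2 = 1 ∧ ∀ z : Circle,
    (γ.1 z : ℂ) = (α * z + β) / (conj β * z + conj α)}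
  mul_mem' := by
    rintro γ δ ⟨a, b, h, hγ⟩ ⟨c, d, k, hδ⟩
    have hN : ‖a * c + b * conj d‖ ^ 2 - ‖a * d + b * conj c‖ ^ 2 = 1 := by
      have e : ∀ w : ℂ, ((‖w‖ ^ 2 : ℝ) : ℂ) = w * conj w := fun w => by
        rw [Complex.mul_conj, Complex.normSq_eq_norm_sq]
      have h' : a * conj a - b * conj b = 1 := by rw [← e, ← e]; exact_mod_cast h
      have k' : c * conj c - d * conj d = 1 := by rw [← e, ← e]; exact_mod_cast k
      have : ((‖a * c + b * conj d‖ ^ 2 - ‖a * d + b * conj c‖ ^ 2 : ℝ) : ℂ) = 1 := by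
        rw [Complex.ofReal_sub, e, e]
        simp only [map_add, map_mul, Complex.conj_conj]
        linear_combination (c * conj c - d * conj d) * h' + k'
      exact_mod_cast this
    refine ⟨a * c + b * conj d, a * d + b * conj c, hN, fun z => ?_⟩
    · have h1 := mob_denom_ne_zero k z
      have h2 := mob_denom_ne_zero h (δ.1 z)
      have h3 : ((γ * δ).1 z : ℂ)
          = (γ.1 (δ.1 z) : ℂ) := rfl
      have h4 := mob_denom_ne_zero hN z
      rw [h3, hγ, div_eq_div_iff h2 h4]
      have h5 : (δ.1 z : ℂ) * (conj d * z + conj c) = c * z + d := by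
        rw [hδ, div_mul_cancel₀ _ h1]
      simp only [map_add, map_mul, Complex.conj_conj]
      linear_combination (a * conj a - b * conj b) * h5
  one_mem' := ⟨1, 0, by simp, fun z => by simp⟩
  inv_mem' := by
    rintro γ ⟨a, b, h, hγ⟩
    have h' : ‖conj a‖ ^ 2 - ‖-b‖ ^ 2 = 1 := by simpa using h
    refine ⟨conj a, -b, h', fun z => ?_⟩
    have hz : (γ.1 ((γ⁻¹).1 z) : ℂ) = z :=
      congrArg _ (γ.1.apply_symm_apply z)
    rw [hγ, div_eq_iff (mob_denom_ne_zero h _)] at hz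
    rw [eq_div_iff (mob_denom_ne_zero h' z)]
    simp only [map_neg, Complex.conj_conj]
    linear_combination hz

/-- The rotation by the angle `t`, `z ↦ e^{it} z`. -/
noncomputable def rot (t : ℝ) : Mob :=
  ⟨⟨Equiv.mulLeft (Circle.exp t), by
      refine ⟨contMDiff_mul_left, ?_, OrderIso.addLeft t, fun θ => ?_⟩
      · exact contMDiff_mul_left (a := (Circle.exp t)⁻¹)
      · simp [Circle.exp_add]⟩, by
    refine ⟨(Circle.exp (t / 2) : Circle), 0, by rw [Circle.norm_coe]; simp, fun z => ?_⟩
    have h1 : Circle.exp t = Circle.exp (t / 2) * Circle.exp (t / 2) := by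
      rw [← Circle.exp_add, add_halves]
    have h2 : ((Equiv.mulLeft (Circle.exp t) z : Circle) : ℂ)
        = (Circle.exp (t / 2) : ℂ) * (Circle.exp (t / 2) : ℂ) * z := by
      rw [Equiv.coe_mulLeft, Circle.coe_mul, h1, Circle.coe_mul]
    rw [map_zero, zero_mul, zero_add, add_zero, ← Circle.coe_inv_eq_conj, Circle.coe_inv,
      div_inv_eq_mul]
    exact h2.trans (by ring)⟩

/-! ### Intervals of the circle -/

/-- Nonempty, nondense, open, connected subsets of the circle. -/
structure Interval where
  carrier : Set Circle
  isOpen : IsOpen carrier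
  isConnected : IsConnected carrier
  not_dense : ¬ Dense carrier

/-- The image `γ I` of an interval under a diffeomorphism. -/
noncomputable def Interval.map (γ : DiffPlus) (I : Interval) : Interval where
  carrier := γ.1 '' I.carrier
  isOpen := by
    have h : γ.1 '' I.carrier
        = (γ⁻¹).1 ⁻¹' I.carrier :=
      Equiv.image_eq_preimage_symm _ _
    rw [h]
    exact I.isOpen.preimage (continuous_diffPlus γ⁻¹)
  isConnected := I.isConnected.image _ (continuous_diffPlus γ).continuousOn
  not_dense := fun h => I.not_dense <| by
    have h2 := (γ⁻¹).1.surjective.denseRange.dense_image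
      (continuous_diffPlus γ⁻¹) h
    have h3 : (γ⁻¹).1 '' (γ.1 '' I.carrier)
        = I.carrier := Equiv.symm_image_image _ _
    rwa [h3] at h2

/-! ### Unitaries and projective unitaries -/

section Unitaries

variable (H : Type*) [NormedAddCommGroup H] [InnerProductSpace ℂ H] [CompleteSpace H]

/-- The group `𝓤(H)` of unitary operators. -/
abbrev UnitaryOp : Type _ := unitary (H →L[ℂ] H)

/-- The subgroup `𝕋 ⊆ 𝓤(H)` of scalar unitaries. -/
noncomputable def scalars : Subgroup (UnitaryOp H) where
  carrier := {u | ∃ c : Circle, (u : H →L[ℂ] H) = (c : ℂ) • (1 : H →L[ℂ] H)}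
  mul_mem' := by
    rintro u v ⟨c, hc⟩ ⟨d, hd⟩
    exact ⟨c * d, by
      rw [Submonoid.coe_mul, hc, hd, smul_mul_smul_comm, one_mul, Circle.coe_mul]⟩
  one_mem' := ⟨1, by simp⟩
  inv_mem' := by
    rintro u ⟨c, hc⟩
    refine ⟨c⁻¹, ?_⟩
    rw [← Unitary.star_eq_inv, Unitary.coe_star, hc, star_smul, star_one, Circle.coe_inv_eq_conj]
    rfl

instance : (scalars H).Normal where
  conj_mem := by
    rintro u ⟨c, hc⟩ v
    refine ⟨c, ?_⟩
    have h : (v : H →L[ℂ] H) * ((v⁻¹ : UnitaryOp H) : H →L[ℂ] H) = 1 := by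
      rw [← Unitary.star_eq_inv, Unitary.coe_star]
      exact Unitary.mul_star_self_of_mem v.2
    simp only [Submonoid.coe_mul, hc, mul_smul_comm, smul_mul_assoc, mul_one, h]

/-- The projective unitary group `𝓤(H)/𝕋`. -/
def ProjUnitary : Type _ := UnitaryOp H ⧸ scalars H

noncomputable instance : Group (ProjUnitary H) :=
  inferInstanceAs (Group (UnitaryOp H ⧸ scalars H))

/-- The class of a unitary operator modulo phases. -/
noncomputable def toProj : UnitaryOp H →* ProjUnitary H := QuotientGroup.mk' (scalars H)

/-- The strong operator topology on `𝓤(H)`: pointwise convergence on vectors. -/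
abbrev strongTopology : TopologicalSpace (UnitaryOp H) :=
  TopologicalSpace.induced (fun (u : UnitaryOp H) (ξ : H) => (u : H →L[ℂ] H) ξ)
    (inferInstance : TopologicalSpace (H → H))

/-- The quotient of the strong operator topology. -/
noncomputable instance : TopologicalSpace (ProjUnitary H) :=
  TopologicalSpace.coinduced (toProj H) (strongTopology H)

end Unitaries

/-! ### The conformal Hamiltonian -/

section Hamiltonian

variable {H : Type*} [NormedAddCommGroup H] [InnerProductSpace ℂ H] [CompleteSpace H]

/-- The conformal Hamiltonian `L₀` of a unitary representation of the Möbius group: the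
(unbounded) generator of the rotations, `L₀ ξ = -i d/dt U(rot t) ξ` at `t = 0`, on all vectors
for which the derivative exists, so that `U(rot t) = e^{i t L₀}`. -/
noncomputable def conformalHamiltonian (U : Mob →* UnitaryOp H) : H →ₗ.[ℂ] H where
  domain :=
    { carrier := {ξ | DifferentiableAt ℝ (fun t : ℝ => (U (rot t) : H →L[ℂ] H) ξ) 0}
      add_mem' := by
        intro ξ η hξ hη
        have h := DifferentiableAt.add hξ hη
        exact h.congr_of_eventuallyEq (.of_forall fun t => map_add _ ξ η)
      zero_mem' := by simp
      smul_mem' := by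
        intro c ξ hξ
        have h := DifferentiableAt.const_smul hξ c
        exact h.congr_of_eventuallyEq (.of_forall fun t => map_smul _ c ξ) }
  toFun :=
    { toFun := fun ξ => (-Complex.I) • deriv (fun t : ℝ => (U (rot t) : H →L[ℂ] H) ξ) 0
      map_add' := by
        intro ξ η
        simp only [Submodule.coe_add, map_add]
        rw [← smul_add]
        congr 1
        exact deriv_add ξ.2 η.2
      map_smul' := by
        intro c ξ
        simp only [Submodule.coe_smul, map_smul, RingHom.id_apply]
        rw [smul_comm c]
        congr 1
        exact deriv_const_smul c ξ.2 }

/-- The spectrum of a closed unbounded operator: the `z` for which `T - z` is not a bijection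
from the domain onto the space. -/
def unboundedSpectrum (T : H →ₗ.[ℂ] H) : Set ℂ :=
  {z | ¬ Function.Bijective fun ξ : T.domain => T ξ - z • (ξ : H)}

end Hamiltonian

/-! ### Nets of von Neumann algebras -/

/-- A Möbius covariant net `(𝓐, U, Ω)` on the circle. -/
structure MobiusCovariantNet (H : Type*) [NormedAddCommGroup H] [InnerProductSpace ℂ H]
    [CompleteSpace H] where
  /-- the local algebras -/
  algebra : Interval → VonNeumannAlgebra H
  /-- the unitary representation of the Möbius group -/
  U : Mob →* UnitaryOp H
  /-- the vacuum vector -/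
  Ω : H
  isotony : ∀ I₁ I₂ : Interval, I₁.carrier ⊆ I₂.carrier → algebra I₁ ≤ algebra I₂
  strongly_continuous : ∀ ξ : H, Continuous fun g : Mob => (U g : H →L[ℂ] H) ξ
  covariance : ∀ (g : Mob) (I : Interval),
    (fun x : H →L[ℂ] H => (U g : H →L[ℂ] H) * x * star (U g : H →L[ℂ] H)) ''
      (algebra I : Set (H →L[ℂ] H)) = algebra (I.map g)
  positive_energy : ∀ z ∈ unboundedSpectrum (conformalHamiltonian U), 0 ≤ z.re ∧ z.im = 0
  norm_vacuum : ‖Ω‖ = 1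
  vacuum_invariant : ∀ g : Mob, (U g : H →L[ℂ] H) Ω = Ω
  vacuum_unique : ∀ ξ : H, ‖ξ‖ = 1 → (∀ g : Mob, (U g : H →L[ℂ] H) ξ = ξ) →
    ∃ c : Circle, ξ = (c : ℂ) • Ω
  /-- `Ω` is cyclic for the von Neumann algebra generated by all local algebras -/
  cyclic : Dense ((fun x : H →L[ℂ] H => x Ω) ''
    Set.centralizer (Set.centralizer (⋃ I : Interval, (algebra I : Set (H →L[ℂ] H)))))
  locality : ∀ I₁ I₂ : Interval, Disjoint I₁.carrier I₂.carrier →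
    algebra I₁ ≤ (algebra I₂).commutant

/-- A conformal (diffeomorphism covariant) net on the circle: a Möbius covariant net together
with an extension of its Möbius representation to a strongly continuous projective unitary
representation of the diffeomorphism group. Statements about `Ad V(γ)` are made for every unitary
`u` in the class `V γ`; they do not depend on its phase. -/
structure ConformalNet (H : Type*) [NormedAddCommGroup H] [InnerProductSpace ℂ H]
    [CompleteSpace H] extends MobiusCovariantNet H where
  /-- the projective unitary representation of the diffeomorphism group -/
  V : DiffPlus →* ProjUnitary H
  continuous_V : Continuous V
  extends_U : ∀ g : Mob, V g = toProj H (U g)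
  diff_covariance : ∀ (γ : DiffPlus) (I : Interval) (u : UnitaryOp H), toProj H u = V γ →
    (fun x : H →L[ℂ] H => (u : H →L[ℂ] H) * x * star (u : H →L[ℂ] H)) ''
      (algebra I : Set (H →L[ℂ] H)) = algebra (I.map γ)
  /-- if `γ` acts identically on `I' = interior (Iᶜ)`, then `Ad V(γ)` is trivial on `𝓐(I')` -/
  diff_locality : ∀ (γ : DiffPlus) (I I' : Interval), I'.carrier = interior I.carrierᶜ →
    (∀ z ∈ I'.carrier, γ.1 z = z) →
    ∀ u : UnitaryOp H, toProj H u = V γ → ∀ x ∈ algebra I',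
      (u : H →L[ℂ] H) * x * star (u : H →L[ℂ] H) = x

end CircleNet

namespace CircleNet

open Filter Topology

/-! ### Diffeomorphisms given by lifts -/

lemma contMDiff_circle_coe : ContMDiff (𝓡 1) 𝓘(ℝ, ℂ) ∞ (fun z : Circle => (z : ℂ)) := by
  have := finrank_real_complex_fact'
  exact contMDiff_coe_sphere

lemma contMDiff_circle_exp : ContMDiff 𝓘(ℝ, ℝ) (𝓡 1) ∞ Circle.exp := contMDiff_circleExp

lemma contMDiff_of_lift {γ : Circle → Circle} {ψ : ℝ → ℝ} (hψ : ContDiff ℝ ∞ ψ)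
    (h : ∀ θ, γ (Circle.exp θ) = Circle.exp (ψ θ)) : ContMDiff (𝓡 1) (𝓡 1) ∞ γ := by
  intro z₀
  set θ₀ := Complex.arg z₀
  set L : ℂ → ℝ := fun z => θ₀ + (Complex.log (z * ((z₀⁻¹ : Circle) : ℂ))).im with hL
  have h1 : γ = fun z : Circle => Circle.exp (ψ (L z)) := by
    funext z
    rw [← h]
    congr 1
    rw [hL]
    simp only [Complex.log_im]
    rw [Circle.exp_add, Circle.exp_arg, ← Circle.coe_mul, Circle.exp_arg, mul_comm,
      inv_mul_cancel_right]
  have h2 : ContDiffAt ℝ ∞ L (z₀ : ℂ) := by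
    have h3 : ContDiffAt ℝ ∞ Complex.log ((z₀ : ℂ) * ((z₀⁻¹ : Circle) : ℂ)) :=
      (Complex.contDiffAt_log (by
        rw [← Circle.coe_mul, mul_inv_cancel]; simp)).restrict_scalars ℝ
    have h4 : ContDiffAt ℝ ∞ (fun z : ℂ => Complex.log (z * ((z₀⁻¹ : Circle) : ℂ))) z₀ :=
      h3.comp (z₀ : ℂ) (contDiffAt_id.mul contDiffAt_const)
    exact contDiffAt_const.add (Complex.imCLM.contDiff.contDiffAt.comp _ h4)
  rw [h1]
  exact (contMDiff_circle_exp.contMDiffAt).comp z₀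
    ((hψ.contDiffAt.comp _ h2).contMDiffAt.comp z₀ contMDiff_circle_coe.contMDiffAt)

lemma lift_add_int_mul {ψ : ℝ → ℝ} (hper : ∀ θ, ψ (θ + 2 * Real.pi) = ψ θ + 2 * Real.pi)
    (θ : ℝ) (m : ℤ) : ψ (θ + m * (2 * Real.pi)) = ψ θ + m * (2 * Real.pi) := by
  have h : Function.Periodic (fun θ => ψ θ - θ) (2 * Real.pi) := fun θ => by
    simp only [hper]; ring
  have h2 : ψ (θ + m * (2 * Real.pi)) - (θ + m * (2 * Real.pi)) = ψ θ - θ := h.int_mul m θ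
  linarith

/-- The order isomorphism of the line defined by a lift. -/
noncomputable def liftIso (ψ : ℝ → ℝ) (hψ : ContDiff ℝ ∞ ψ) (hpos : ∀ θ, 0 < deriv ψ θ)
    (hper : ∀ θ, ψ (θ + 2 * Real.pi) = ψ θ + 2 * Real.pi) : ℝ ≃o ℝ :=
  (strictMono_of_deriv_pos hpos).orderIsoOfSurjective ψ (by
    have hm := (strictMono_of_deriv_pos hpos).monotone
    have key : ∀ b : ℝ, ∃ m : ℤ, b ≤ ψ 0 + m * (2 * Real.pi) := fun b => by
      obtain ⟨m, hm⟩ := exists_int_gt ((b - ψ 0) / (2 * Real.pi))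
      refine ⟨m, ?_⟩
      rw [div_lt_iff₀ Real.two_pi_pos] at hm
      linarith
    refine hψ.continuous.surjective
      (hm.tendsto_atTop_atTop fun b => ?_) (hm.tendsto_atBot_atBot fun b => ?_)
    · obtain ⟨m, h⟩ := key b
      exact ⟨0 + m * (2 * Real.pi), by rwa [lift_add_int_mul hper]⟩
    · obtain ⟨m, h⟩ := key (2 * ψ 0 - b)
      refine ⟨0 + (-m : ℤ) * (2 * Real.pi), ?_⟩
      rw [lift_add_int_mul hper]
      push_cast
      linarith)

/-- The diffeomorphism of the circle with a given lift. -/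
noncomputable def diffOfLift (ψ : ℝ → ℝ) (hψ : ContDiff ℝ ∞ ψ) (hpos : ∀ θ, 0 < deriv ψ θ)
    (hper : ∀ θ, ψ (θ + 2 * Real.pi) = ψ θ + 2 * Real.pi) : DiffPlus :=
  have hf : ∀ θ, Circle.exp (ψ (Complex.arg (Circle.exp θ))) = Circle.exp (ψ θ) := fun θ => by
    obtain ⟨m, hm⟩ := Circle.exp_eq_exp.1 (Circle.exp_arg (Circle.exp θ))
    rw [hm, lift_add_int_mul hper]
    exact Circle.exp_eq_exp.2 ⟨m, rfl⟩
  have hg : ∀ θ, Circle.exp ((liftIso ψ hψ hpos hper).symm (Complex.arg (Circle.exp θ)))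
      = Circle.exp ((liftIso ψ hψ hpos hper).symm θ) := fun θ => by
    obtain ⟨m, hm⟩ := Circle.exp_eq_exp.1 (Circle.exp_arg (Circle.exp θ))
    rw [hm]
    refine Circle.exp_eq_exp.2 ⟨m, ?_⟩
    rw [OrderIso.symm_apply_eq]
    change _ = ψ _
    rw [lift_add_int_mul hper]
    congr 1
    exact ((liftIso ψ hψ hpos hper).apply_symm_apply θ).symm
  ⟨{ toFun := fun z => Circle.exp (ψ (Complex.arg z))
     invFun := fun z => Circle.exp ((liftIso ψ hψ hpos hper).symm (Complex.arg z))
     left_inv := fun z => (hg _).trans <|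
      (congrArg Circle.exp ((liftIso ψ hψ hpos hper).symm_apply_apply _)).trans
        (Circle.exp_arg z)
     right_inv := fun z => (hf _).trans <|
      (congrArg Circle.exp ((liftIso ψ hψ hpos hper).apply_symm_apply _)).trans
        (Circle.exp_arg z) },
    contMDiff_of_lift hψ hf,
    contMDiff_of_lift ((liftIso ψ hψ hpos hper).toHomeomorph.contDiff_symm_deriv
      (fun x => (hpos x).ne')
      (fun x => (hψ.differentiable (by simp) x).hasDerivAt) hψ) hg,
    liftIso ψ hψ hpos hper, hf⟩

lemma diffOfLift_exp {ψ : ℝ → ℝ} (hψ : ContDiff ℝ ∞ ψ) (hpos : ∀ θ, 0 < deriv ψ θ)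
    (hper : ∀ θ, ψ (θ + 2 * Real.pi) = ψ θ + 2 * Real.pi) (θ : ℝ) :
    (diffOfLift ψ hψ hpos hper).1 (Circle.exp θ) = Circle.exp (ψ θ) := by
  obtain ⟨m, hm⟩ := Circle.exp_eq_exp.1 (Circle.exp_arg (Circle.exp θ))
  change Circle.exp (ψ (Complex.arg (Circle.exp θ))) = _
  rw [hm, lift_add_int_mul hper]
  exact Circle.exp_eq_exp.2 ⟨m, rfl⟩

lemma exists_exp_eq (z : Circle) : ∃ θ : ℝ, Circle.exp θ = z := ⟨_, Circle.exp_arg z⟩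

lemma diffPlus_ext {γ δ : DiffPlus} (h : ∀ z, γ.1 z = δ.1 z) : γ = δ :=
  Subtype.ext (Equiv.ext h)

lemma mob_ext {γ δ : Mob} (h : ∀ z, γ.1.1 z = δ.1.1 z) : γ = δ :=
  Subtype.ext (diffPlus_ext h)

/-! ### A continuity criterion for the `C^∞` topology -/

section Continuity

variable {E : Type*} [NormedAddCommGroup E] [NormedSpace ℝ E]

/-- The iterated partial derivatives of `G` in the real variable. -/
noncomputable def iterPartial (G : E × ℝ → ℂ) : ℕ → E × ℝ → ℂ
  | 0 => G
  | n + 1 => fun p => fderiv ℝ (iterPartial G n) p (0, 1)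

lemma contDiffOn_iterPartial {G : E × ℝ → ℂ} {O : Set E} (hO : IsOpen O)
    (hG : ContDiffOn ℝ ∞ G (O ×ˢ Set.univ)) (n : ℕ) :
    ContDiffOn ℝ ∞ (iterPartial G n) (O ×ˢ Set.univ) := by
  induction n with
  | zero => exact hG
  | succ n ih =>
    exact (ih.fderiv_of_isOpen (hO.prod isOpen_univ) (by simp)).clm_apply contDiffOn_const

lemma iteratedDeriv_eq_iterPartial {G : E × ℝ → ℂ} {O : Set E} (hO : IsOpen O)
    (hG : ContDiffOn ℝ ∞ G (O ×ˢ Set.univ)) {e : E} (he : e ∈ O) (n : ℕ) :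
    iteratedDeriv n (fun θ => G (e, θ)) = fun θ => iterPartial G n (e, θ) := by
  induction n with
  | zero => rw [iteratedDeriv_zero]; rfl
  | succ n ih =>
    rw [iteratedDeriv_succ, ih]
    funext θ
    have h1 : DifferentiableAt ℝ (iterPartial G n) (e, θ) :=
      ((contDiffOn_iterPartial hO hG n).contDiffAt
        ((hO.prod isOpen_univ).mem_nhds ⟨he, trivial⟩)).differentiableAt (by simp)
    have h2 : HasDerivAt (fun θ : ℝ => (e, θ)) ((0 : E), (1 : ℝ)) θ :=
      (hasDerivAt_const θ e).prodMk (hasDerivAt_id θ)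
    exact (h1.hasFDerivAt.comp_hasDerivAt θ h2).deriv

lemma iteratedDeriv_periodic {f : ℝ → ℂ} {c : ℝ} (hf : Function.Periodic f c) (n : ℕ) :
    Function.Periodic (iteratedDeriv n f) c := by
  intro x
  have h := congrFun (iteratedDeriv_comp_add_const n f c) x
  rw [← h]
  congr 2
  exact funext hf

lemma continuousAt_diffPlus {X : Type*} [TopologicalSpace X] {Φ : X → DiffPlus} {x₀ : X}
    {e : X → E} {G : E × ℝ → ℂ} {O : Set E} (hO : IsOpen O)
    (hG : ContDiffOn ℝ ∞ G (O ×ˢ Set.univ)) (he : ContinuousAt e x₀) (he₀ : e x₀ ∈ O)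
    (hΦ : ∀ᶠ x in 𝓝 x₀, ∀ θ : ℝ, ((Φ x).1 (Circle.exp θ) : ℂ) = G (e x, θ)) :
    ContinuousAt Φ x₀ := by
  have hind : IsInducing (fun (γ : DiffPlus) (n : ℕ) =>
      UniformFun.ofFun (iteratedDeriv n fun θ : ℝ => (γ.1 (Circle.exp θ) : ℂ))) := ⟨rfl⟩
  rw [hind.continuousAt_iff]
  refine continuousAt_pi.2 fun n => ?_
  rw [ContinuousAt, UniformFun.tendsto_iff_tendstoUniformly]
  intro u hu
  have hcont : ContinuousOn (Function.uncurry fun a b => iterPartial G n (a, b))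
      (O ×ˢ Set.Icc 0 (2 * Real.pi)) :=
    (contDiffOn_iterPartial hO hG n).continuousOn.mono
      (Set.prod_mono le_rfl (Set.subset_univ _))
  obtain ⟨v, hv, hvu⟩ := isCompact_Icc.mem_uniformity_of_prod hcont he₀ (symm_le_uniformity hu)
  rw [hO.nhdsWithin_eq he₀] at hv
  have h₀ := hΦ.self_of_nhds
  filter_upwards [hΦ, he.preimage_mem_nhds hv, he.preimage_mem_nhds (hO.mem_nhds he₀)]
    with x hx hxv hxO θ
  have hper : ∀ γ : DiffPlus, Function.Periodic
      (iteratedDeriv n fun θ : ℝ => (γ.1 (Circle.exp θ) : ℂ)) (2 * Real.pi) := fun γ =>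
    iteratedDeriv_periodic (fun θ => by simp only [Circle.periodic_exp θ]) n
  obtain ⟨θ', hθ', h⟩ := Function.Periodic.exists_mem_Ico₀
    (f := fun θ => ((iteratedDeriv n fun θ : ℝ => ((Φ x).1 (Circle.exp θ) : ℂ)) θ,
      (iteratedDeriv n fun θ : ℝ => ((Φ x₀).1 (Circle.exp θ) : ℂ)) θ))
    (fun θ => Prod.ext (hper (Φ x) θ) (hper (Φ x₀) θ)) Real.two_pi_pos θ
  have key : ∀ y, y ∈ O → ∀ z : X, e z = y →
      (∀ θ : ℝ, ((Φ z).1 (Circle.exp θ) : ℂ) = G (e z, θ)) →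
      (iteratedDeriv n fun θ : ℝ => ((Φ z).1 (Circle.exp θ) : ℂ)) = 
        fun θ => iterPartial G n (e z, θ) := fun y hy z hz hG' => by
    rw [← iteratedDeriv_eq_iterPartial hO hG (hz ▸ hy)]
    congr 1
    exact funext hG'
  have h2 := hvu _ hxv θ' ⟨hθ'.1, hθ'.2.le⟩
  have k1 := key _ hxO x rfl hx
  have k2 := key _ he₀ x₀ rfl h₀
  have h := Prod.mk.inj h
  change (iteratedDeriv n (fun θ : ℝ => ((Φ x₀).1 (Circle.exp θ) : ℂ)) θ,
    iteratedDeriv n (fun θ : ℝ => ((Φ x).1 (Circle.exp θ) : ℂ)) θ) ∈ u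
  rw [h.1, h.2, k1, k2]
  exact h2

end Continuity

end CircleNet

namespace CircleNet

open Filter Topology

/-! ### Möbius transformations -/

lemma div_conj_eq_exp_arg {w : ℂ} (hw : w ≠ 0) :
    w / conj w = Complex.exp ((2 * Complex.arg w : ℝ) * Complex.I) := by
  have h1 := Complex.norm_mul_exp_arg_mul_I w
  have h2 : (‖w‖ : ℂ) ≠ 0 := by simpa using hw
  have h3 : conj w = ‖w‖ * Complex.exp (-(Complex.arg w * Complex.I)) := by
    conv_lhs => rw [← h1]
    rw [map_mul, Complex.conj_ofReal, ← Complex.exp_conj]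
    simp
  conv_lhs => rw [h3]
  conv_lhs => enter [1]; rw [← h1]
  rw [mul_div_mul_left _ _ h2, ← Complex.exp_sub]
  congr 1
  push_cast
  ring

/-- A lift of the Möbius transformation with coefficients `α, β`. -/
noncomputable def mobLift (α β : ℂ) (θ : ℝ) : ℝ :=
  θ + 2 * Complex.arg α
    + 2 * (Complex.log (1 + β / α * Complex.exp (-(θ * Complex.I)))).im

section Lift

variable {α β : ℂ} (h : ‖α‖ ^ 2 - ‖β‖ ^ 2 = 1)
include h

lemma mob_alpha_ne_zero : α ≠ 0 := by
  rintro rfl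
  simp at h
  nlinarith [sq_nonneg ‖β‖]

lemma norm_ratio_lt (θ : ℝ) : ‖β / α * Complex.exp (-(θ * Complex.I))‖ < 1 := by
  have h1 : ‖Complex.exp (-(θ * Complex.I))‖ = 1 := by
    rw [← neg_mul, ← Complex.ofReal_neg, Complex.norm_exp_ofReal_mul_I]
  have h0 : 0 < ‖α‖ := norm_pos_iff.2 (mob_alpha_ne_zero h)
  rw [norm_mul, h1, mul_one, norm_div, div_lt_one h0]
  nlinarith [norm_nonneg β]

lemma one_add_mem_slitPlane (θ : ℝ) :
    1 + β / α * Complex.exp (-(θ * Complex.I)) ∈ Complex.slitPlane :=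
  Complex.mem_slitPlane_of_norm_lt_one (norm_ratio_lt h θ)

lemma contDiff_mobLift : ContDiff ℝ ∞ (mobLift α β) := by
  unfold mobLift
  refine (contDiff_id.add contDiff_const).add (contDiff_const.mul ?_)
  refine contDiff_iff_contDiffAt.2 fun θ => ?_
  have h1 : ContDiffAt ℝ ∞ Complex.log (1 + β / α * Complex.exp (-(θ * Complex.I))) :=
    (Complex.contDiffAt_log (one_add_mem_slitPlane h θ)).restrict_scalars ℝ
  have h2 : ContDiffAt ℝ ∞ (fun θ : ℝ => 1 + β / α * Complex.exp (-(θ * Complex.I))) θ := by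
    refine contDiffAt_const.add (contDiffAt_const.mul ?_)
    exact ((Complex.ofRealCLM.contDiff.mul contDiff_const).neg).cexp.contDiffAt
  exact Complex.imCLM.contDiff.contDiffAt.comp _ (h1.comp θ h2)

lemma deriv_mobLift_pos (θ : ℝ) : 0 < deriv (mobLift α β) θ := by
  set u := β / α * Complex.exp (-(θ * Complex.I)) with hu
  have h1 : HasDerivAt (fun θ : ℝ => 1 + β / α * Complex.exp (-(θ * Complex.I)))
      (-Complex.I * u) θ := by
    have h2 : HasDerivAt (fun θ : ℝ => -((θ : ℂ) * Complex.I)) (-(1 * Complex.I)) θ :=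
      ((hasDerivAt_id θ).ofReal_comp.mul_const Complex.I).neg
    refine ((h2.cexp.const_mul (β / α)).const_add 1).congr_deriv ?_
    rw [hu]; ring
  have h3 : HasDerivAt (fun θ : ℝ => Complex.log (1 + β / α * Complex.exp (-(θ * Complex.I))))
      (-Complex.I * u / (1 + u)) θ := h1.clog_real (one_add_mem_slitPlane h θ)
  have h4 : HasDerivAt (mobLift α β) (1 + 2 * (-Complex.I * u / (1 + u)).im) θ :=
    ((hasDerivAt_id θ).add_const _).add
      ((Complex.imCLM.hasFDerivAt.comp_hasDerivAt θ h3).const_mul 2)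
  rw [h4.deriv]
  have hlt : ‖u‖ < 1 := norm_ratio_lt h θ
  have hne : 0 < Complex.normSq (1 + u) := by
    rw [Complex.normSq_pos]
    exact Complex.slitPlane_ne_zero (one_add_mem_slitPlane h θ)
  have h5 : Complex.normSq u < 1 := by
    rw [Complex.normSq_eq_norm_sq]; nlinarith [norm_nonneg u]
  have h6 : 1 + 2 * (-Complex.I * u / (1 + u)).im
      = (1 - Complex.normSq u) / Complex.normSq (1 + u) := by
    rw [Complex.div_im, eq_div_iff hne.ne']
    field_simp
    simp only [Complex.normSq_apply, Complex.add_re, Complex.add_im, Complex.one_re,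
      Complex.one_im, Complex.mul_re, Complex.mul_im, Complex.neg_re, Complex.neg_im,
      Complex.I_re, Complex.I_im]
    ring
  rw [h6]
  exact div_pos (by linarith) hne

lemma exp_mobLift (θ : ℝ) : (Circle.exp (mobLift α β θ) : ℂ)
    = (α * Circle.exp θ + β) / (conj β * Circle.exp θ + conj α) := by
  set u := β / α * Complex.exp (-(θ * Complex.I)) with hu
  have hα := mob_alpha_ne_zero h
  have hα' : conj α ≠ 0 := by simpa using hα
  have h1 : 1 + u ≠ 0 := Complex.slitPlane_ne_zero (one_add_mem_slitPlane h θ)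
  have h1' : conj (1 + u) ≠ 0 := by rwa [Ne, map_eq_zero]
  have h2 : Complex.exp (θ * Complex.I) * Complex.exp (-(θ * Complex.I)) = 1 := by
    rw [← Complex.exp_add]; simp
  have h3 : conj u = conj β / conj α * Complex.exp (θ * Complex.I) := by
    rw [hu, map_mul, map_div₀, ← Complex.exp_conj]; simp
  have e1 : α * Complex.exp (θ * Complex.I) + β = Complex.exp (θ * Complex.I) * (α * (1 + u)) := by
    rw [hu]; field_simp; linear_combination -β * h2
  have e2 : conj β * Complex.exp (θ * Complex.I) + conj α = conj α * conj (1 + u) := by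
    rw [map_add, h3, map_one]; field_simp; ring
  rw [Circle.coe_exp, Circle.coe_exp, e1, e2, mul_div_assoc, mul_div_mul_comm,
    div_conj_eq_exp_arg hα, div_conj_eq_exp_arg h1, ← Complex.exp_add, ← Complex.exp_add]
  congr 1
  rw [mobLift, Complex.log_im]
  push_cast
  ring

end Lift

lemma mobLift_add (α β : ℂ) (θ : ℝ) :
    mobLift α β (θ + 2 * Real.pi) = mobLift α β θ + 2 * Real.pi := by
  have : Complex.exp (-(((θ + 2 * Real.pi : ℝ) : ℂ) * Complex.I))
      = Complex.exp (-((θ : ℂ) * Complex.I)) := by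
    rw [Complex.exp_eq_exp_iff_exists_int]
    exact ⟨-1, by push_cast; ring⟩
  rw [mobLift, mobLift, this]
  ring

/-- The Möbius transformation with coefficients `α, β`. -/
noncomputable def mkMob (α β : ℂ) (h : ‖α‖ ^ 2 - ‖β‖ ^ 2 = 1) : Mob :=
  ⟨diffOfLift (mobLift α β) (contDiff_mobLift h) (deriv_mobLift_pos h) (mobLift_add α β),
    α, β, h, fun z => by
      obtain ⟨θ, rfl⟩ := exists_exp_eq z
      rw [diffOfLift_exp, exp_mobLift h]⟩

lemma mkMob_apply {α β : ℂ} (h : ‖α‖ ^ 2 - ‖β‖ ^ 2 = 1) (z : Circle) :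
    ((mkMob α β h).1.1 z : ℂ) = (α * z + β) / (conj β * z + conj α) := by
  obtain ⟨θ, rfl⟩ := exists_exp_eq z
  rw [← exp_mobLift h, mkMob]
  simp only [diffOfLift_exp]

lemma continuousAt_mkMob {X : Type*} [TopologicalSpace X] {a b : X → ℂ}
    (h : ∀ x, ‖a x‖ ^ 2 - ‖b x‖ ^ 2 = 1) {x₀ : X} (ha : ContinuousAt a x₀)
    (hb : ContinuousAt b x₀) : ContinuousAt (fun x => mkMob (a x) (b x) (h x)) x₀ := by
  rw [Topology.IsInducing.subtypeVal.continuousAt_iff]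
  refine continuousAt_diffPlus (E := ℂ × ℂ) (e := fun x => (a x, b x))
    (O := {p | ‖p.2‖ < ‖p.1‖})
    (G := fun p => (p.1.1 * Complex.exp (p.2 * Complex.I) + p.1.2)
      / (conj p.1.2 * Complex.exp (p.2 * Complex.I) + conj p.1.1))
    (isOpen_lt (by fun_prop) (by fun_prop)) ?_ (ha.prodMk hb) ?_ (.of_forall fun x θ => ?_)
  · have hexp : ContDiff ℝ ∞ (fun p : (ℂ × ℂ) × ℝ => Complex.exp (p.2 * Complex.I)) :=
      ((Complex.ofRealCLM.contDiff.comp contDiff_snd).mul contDiff_const).cexp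
    have h1 : ContDiff ℝ ∞ (fun p : (ℂ × ℂ) × ℝ => p.1.1) := contDiff_fst.comp contDiff_fst
    have h2 : ContDiff ℝ ∞ (fun p : (ℂ × ℂ) × ℝ => p.1.2) := contDiff_snd.comp contDiff_fst
    have hc : ContDiff ℝ ∞ (fun z : ℂ => conj z) := Complex.conjCLE.contDiff
    simp_rw [div_eq_mul_inv]
    refine ((h1.mul hexp).add h2).contDiffOn.mul (ContDiffOn.inv
      (((hc.comp h2).mul hexp).add (hc.comp h1)).contDiffOn ?_)
    rintro ⟨⟨p, q⟩, θ⟩ ⟨hp, -⟩ h0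
    have h3 : ‖conj q * Complex.exp (θ * Complex.I)‖ = ‖conj p‖ := by
      rw [← norm_neg (conj p)]
      exact congrArg norm (eq_neg_of_add_eq_zero_left h0)
    rw [norm_mul, Complex.norm_exp_ofReal_mul_I] at h3
    simp only [RCLike.norm_conj, mul_one] at h3
    exact (ne_of_lt hp) h3
  · have := h x₀
    change ‖b x₀‖ < ‖a x₀‖
    by_contra! hlt
    nlinarith [norm_nonneg (a x₀), norm_nonneg (b x₀)]
  · exact (mkMob_apply (h x) _).trans (by rw [Circle.coe_exp])

/-! ### The coordinate `t = tan (θ / 2)` -/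

/-- The point of the circle with coordinate `t`. -/
noncomputable def pt (t : ℝ) : Circle := Circle.exp (2 * Real.arctan t)

/-- The coordinate of a point of the circle. -/
noncomputable def tt (z : Circle) : ℝ := (z : ℂ).im / (1 + (z : ℂ).re)

lemma one_sub_mul_I_ne_zero (t : ℝ) : (1 - t * Complex.I : ℂ) ≠ 0 := fun h => by
  have := congrArg Complex.re h
  simp at this

lemma coe_pt (t : ℝ) : (pt t : ℂ) = (1 + t * Complex.I) / (1 - t * Complex.I) := by
  have hs : 0 < 1 + t ^ 2 := by positivity
  have h1 : Complex.exp ((Real.arctan t : ℝ) * Complex.I)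
      = (1 + t * Complex.I) / (Real.sqrt (1 + t ^ 2) : ℝ) := by
    rw [Complex.exp_mul_I, ← Complex.ofReal_cos, ← Complex.ofReal_sin, Real.cos_arctan,
      Real.sin_arctan]
    push_cast
    ring
  have h2 : ((Real.sqrt (1 + t ^ 2) : ℝ) : ℂ) ^ 2 = (1 + t * Complex.I) * (1 - t * Complex.I) := by
    rw [← Complex.ofReal_pow, Real.sq_sqrt hs.le]
    push_cast
    linear_combination (t : ℂ) ^ 2 * Complex.I_sq
  have h3 : (1 + t * Complex.I : ℂ) ≠ 0 := fun h => by
    have := congrArg Complex.re h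
    simp at this
  have h4 := one_sub_mul_I_ne_zero t
  rw [pt, Circle.coe_exp]
  have h5 : (((2 * Real.arctan t : ℝ) : ℂ) * Complex.I)
      = (Real.arctan t : ℝ) * Complex.I + (Real.arctan t : ℝ) * Complex.I := by
    push_cast; ring
  rw [h5, Complex.exp_add, h1, div_mul_div_comm, ← sq, ← sq, h2, sq]
  field_simp

lemma coe_pt' (t : ℝ) :
    (pt t : ℂ) = (((1 - t ^ 2) / (1 + t ^ 2) : ℝ) : ℂ) + ((2 * t / (1 + t ^ 2) : ℝ) : ℂ) * Complex.I := by
  have hs : ((1 + t ^ 2 : ℝ) : ℂ) ≠ 0 := by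
    rw [Complex.ofReal_ne_zero]; positivity
  push_cast at hs ⊢
  rw [coe_pt, div_eq_iff (one_sub_mul_I_ne_zero t)]
  field_simp
  linear_combination 2 * (t : ℂ) ^ 2 * Complex.I_sq

lemma re_pt (t : ℝ) : (pt t : ℂ).re = (1 - t ^ 2) / (1 + t ^ 2) := by
  rw [coe_pt', Complex.add_re, Complex.re_ofReal_mul, Complex.ofReal_re]; simp

lemma im_pt (t : ℝ) : (pt t : ℂ).im = 2 * t / (1 + t ^ 2) := by
  rw [coe_pt', Complex.add_im, Complex.im_ofReal_mul, Complex.ofReal_im]; simp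

lemma one_add_re_pt (t : ℝ) : 1 + (pt t : ℂ).re = 2 / (1 + t ^ 2) := by
  rw [re_pt]
  have : (1 + t ^ 2) ≠ 0 := by positivity
  field_simp
  ring

lemma tt_pt (t : ℝ) : tt (pt t) = t := by
  rw [tt, one_add_re_pt, im_pt]
  have : (1 + t ^ 2) ≠ 0 := by positivity
  field_simp

lemma circle_re_sq_add_im_sq (z : Circle) : (z : ℂ).re ^ 2 + (z : ℂ).im ^ 2 = 1 := by
  have := Circle.normSq_coe z
  rw [Complex.normSq_apply] at this
  linarith

lemma one_add_re_pos {z : Circle} (hz : z ≠ -1) : 0 < 1 + (z : ℂ).re := by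
  have h := circle_re_sq_add_im_sq z
  by_contra! hle
  have h1 : (z : ℂ).re = -1 := by nlinarith [sq_nonneg (z : ℂ).im]
  have h2 : (z : ℂ).im = 0 := by
    rw [h1] at h; nlinarith
  exact hz (Circle.ext (Complex.ext (by simp [h1]) (by simp [h2])))

lemma pt_tt {z : Circle} (hz : z ≠ -1) : pt (tt z) = z := by
  have h := circle_re_sq_add_im_sq z
  have h1 := one_add_re_pos hz
  have h2 : 1 + tt z ^ 2 = 2 / (1 + (z : ℂ).re) := by
    rw [tt]; field_simp; nlinarith
  refine Circle.ext (Complex.ext ?_ ?_)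
  · have := one_add_re_pt (tt z)
    rw [h2] at this
    field_simp at this
    linarith
  · rw [im_pt, h2, tt]; field_simp

lemma pt_ne_neg_one (t : ℝ) : pt t ≠ -1 := fun h => by
  have h1 := one_add_re_pt t
  rw [h] at h1
  have : 0 < 2 / (1 + t ^ 2) := by positivity
  rw [← h1] at this
  simp at this

lemma pt_zero : pt 0 = 1 := by simp [pt]

lemma continuous_pt : Continuous pt :=
  Circle.exp.continuous.comp (continuous_const.mul Real.continuous_arctan)

/-! ### Real Möbius matrices -/

/-- The Möbius transformation `t ↦ (a t + b) / (c t + d)`. -/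
noncomputable def J (a b c d : ℝ) (h : a * d - b * c = 1) : Mob :=
  mkMob (⟨(a + d) / 2, (b - c) / 2⟩) (⟨(d - a) / 2, (b + c) / 2⟩) (by
    rw [← Complex.normSq_eq_norm_sq, ← Complex.normSq_eq_norm_sq, Complex.normSq_mk,
      Complex.normSq_mk, ← h]
    ring)

lemma J_congr {a b c d a' b' c' d' : ℝ} {h : a * d - b * c = 1} {h' : a' * d' - b' * c' = 1}
    (ha : a = a') (hb : b = b') (hc : c = c') (hd : d = d') : J a b c d h = J a' b' c' d' h' := by
  subst ha hb hc hd; rfl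

lemma J_pt {a b c d : ℝ} (h : a * d - b * c = 1) {t : ℝ} (ht : c * t + d ≠ 0) :
    (J a b c d h).1.1 (pt t) = pt ((a * t + b) / (c * t + d)) := by
  refine Circle.ext ((mkMob_apply _ _).trans ?_)
  have hd := mob_denom_ne_zero (α := ⟨(a + d) / 2, (b - c) / 2⟩)
    (β := ⟨(d - a) / 2, (b + c) / 2⟩) (by
    rw [← Complex.normSq_eq_norm_sq, ← Complex.normSq_eq_norm_sq, Complex.normSq_mk,
      Complex.normSq_mk, ← h]
    ring) (pt t)
  rw [div_eq_iff hd, coe_pt, coe_pt]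
  have h1 := one_sub_mul_I_ne_zero t
  have h2 := one_sub_mul_I_ne_zero ((a * t + b) / (c * t + d))
  have ht' : ((c * t + d : ℝ) : ℂ) ≠ 0 := by exact_mod_cast ht
  have e1 : (⟨(a + d) / 2, (b - c) / 2⟩ : ℂ) = (a + d) / 2 + (b - c) / 2 * Complex.I := by
    apply Complex.ext <;> simp
  have e2 : (⟨(d - a) / 2, (b + c) / 2⟩ : ℂ) = (d - a) / 2 + (b + c) / 2 * Complex.I := by
    apply Complex.ext <;> simp
  have e3 : conj (⟨(a + d) / 2, (b - c) / 2⟩ : ℂ) = (a + d) / 2 - (b - c) / 2 * Complex.I := by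
    apply Complex.ext <;> simp
  have e4 : conj (⟨(d - a) / 2, (b + c) / 2⟩ : ℂ) = (d - a) / 2 - (b + c) / 2 * Complex.I := by
    apply Complex.ext <;> simp
  rw [e3, e4, e1, e2]
  have f1 : ((a + d) / 2 + (b - c) / 2 * Complex.I : ℂ) * ((1 + t * Complex.I) / (1 - t * Complex.I))
      + ((d - a) / 2 + (b + c) / 2 * Complex.I)
      = ((c * t + d : ℝ) + (a * t + b : ℝ) * Complex.I) / (1 - t * Complex.I) := by
    rw [mul_div_assoc', div_add' _ _ _ h1]
    congr 1
    push_cast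
    linear_combination (-(c : ℂ) * t) * Complex.I_sq
  have f2 : ((d - a) / 2 - (b + c) / 2 * Complex.I : ℂ) * ((1 + t * Complex.I) / (1 - t * Complex.I))
      + ((a + d) / 2 - (b - c) / 2 * Complex.I)
      = ((c * t + d : ℝ) - (a * t + b : ℝ) * Complex.I) / (1 - t * Complex.I) := by
    rw [mul_div_assoc', div_add' _ _ _ h1]
    congr 1
    push_cast
    linear_combination (-(c : ℂ) * t) * Complex.I_sq
  rw [f1, f2]
  rw [Complex.ofReal_div] at h2 ⊢
  generalize ((c * t + d : ℝ) : ℂ) = P at *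
  generalize ((a * t + b : ℝ) : ℂ) = N at *
  have h3 : P - N * Complex.I ≠ 0 := fun h0 => h2 (by
    rw [div_mul_eq_mul_div, one_sub_div ht', h0, zero_div])
  rw [div_mul_eq_mul_div N, one_sub_div ht', one_add_div ht', div_div_div_cancel_right₀ ht',
    div_mul_div_comm, mul_comm (P + N * Complex.I), mul_div_mul_left _ _ h3]

lemma mkMob_mul {a b c d : ℂ} (h : ‖a‖ ^ 2 - ‖b‖ ^ 2 = 1) (k : ‖c‖ ^ 2 - ‖d‖ ^ 2 = 1)
    (hN : ‖a * c + b * conj d‖ ^ 2 - ‖a * d + b * conj c‖ ^ 2 = 1) :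
    mkMob a b h * mkMob c d k = mkMob (a * c + b * conj d) (a * d + b * conj c) hN := by
  refine mob_ext fun z => Circle.ext ?_
  have h1 := mob_denom_ne_zero k z
  have h2 := mob_denom_ne_zero h ((mkMob c d k).1.1 z)
  have h4 := mob_denom_ne_zero hN z
  refine (mkMob_apply h ((mkMob c d k).1.1 z)).trans ?_
  rw [mkMob_apply hN, div_eq_div_iff h2 h4]
  have h5 : ((mkMob c d k).1.1 z : ℂ) * (conj d * z + conj c) = c * z + d := by
    rw [mkMob_apply, div_mul_cancel₀ _ h1]
  simp only [map_add, map_mul, Complex.conj_conj]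
  linear_combination (a * conj a - b * conj b) * h5

lemma mkMob_congr {a b c d : ℂ} {h : ‖a‖ ^ 2 - ‖b‖ ^ 2 = 1} {k : ‖c‖ ^ 2 - ‖d‖ ^ 2 = 1}
    (h1 : a = c) (h2 : b = d) : mkMob a b h = mkMob c d k := by subst h1 h2; rfl

lemma J_mul {a b c d a' b' c' d' : ℝ} (h : a * d - b * c = 1) (h' : a' * d' - b' * c' = 1) :
    J a b c d h * J a' b' c' d' h' = J (a * a' + b * c') (a * b' + b * d') (c * a' + d * c')
      (c * b' + d * d') (by linear_combination (a' * d' - b' * c') * h + h') := by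
  unfold J
  have e1 : (⟨(a + d) / 2, (b - c) / 2⟩ : ℂ) * ⟨(a' + d') / 2, (b' - c') / 2⟩
      + ⟨(d - a) / 2, (b + c) / 2⟩ * conj (⟨(d' - a') / 2, (b' + c') / 2⟩ : ℂ)
      = ⟨(a * a' + b * c' + (c * b' + d * d')) / 2, (a * b' + b * d' - (c * a' + d * c')) / 2⟩ := by
    apply Complex.ext <;> simp <;> ring
  have e2 : (⟨(a + d) / 2, (b - c) / 2⟩ : ℂ) * ⟨(d' - a') / 2, (b' + c') / 2⟩
      + ⟨(d - a) / 2, (b + c) / 2⟩ * conj (⟨(a' + d') / 2, (b' - c') / 2⟩ : ℂ)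
      = ⟨(c * b' + d * d' - (a * a' + b * c')) / 2, (a * b' + b * d' + (c * a' + d * c')) / 2⟩ := by
    apply Complex.ext <;> simp <;> ring
  rw [mkMob_mul]
  · exact mkMob_congr e1 e2
  · rw [e1, e2, ← Complex.normSq_eq_norm_sq, ← Complex.normSq_eq_norm_sq, Complex.normSq_mk,
      Complex.normSq_mk]
    linear_combination (a' * d' - b' * c') * h + h'

lemma exists_eq_J (g : Mob) : ∃ a b c d : ℝ, ∃ h : a * d - b * c = 1, g = J a b c d h := by
  obtain ⟨γ, α, β, h, hγ⟩ := g
  have h' := h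
  rw [← Complex.normSq_eq_norm_sq, ← Complex.normSq_eq_norm_sq, Complex.normSq_apply,
    Complex.normSq_apply] at h'
  refine ⟨α.re - β.re, α.im + β.im, β.im - α.im, α.re + β.re, by linear_combination h', ?_⟩
  refine mob_ext fun z => Circle.ext ?_
  refine (hγ z).trans ?_
  rw [J, mkMob_apply]
  have e1 : (⟨(α.re - β.re + (α.re + β.re)) / 2, (α.im + β.im - (β.im - α.im)) / 2⟩ : ℂ) = α := by
    apply Complex.ext <;> simp; ring
  have e2 : (⟨(α.re + β.re - (α.re - β.re)) / 2, (α.im + β.im + (β.im - α.im)) / 2⟩ : ℂ) = β := by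
    apply Complex.ext <;> simp; ring
  rw [e1, e2]

lemma continuousAt_J {X : Type*} [TopologicalSpace X] {a b c d : X → ℝ}
    (h : ∀ x, a x * d x - b x * c x = 1) {x₀ : X} (ha : ContinuousAt a x₀)
    (hb : ContinuousAt b x₀) (hc : ContinuousAt c x₀) (hd : ContinuousAt d x₀) :
    ContinuousAt (fun x => J (a x) (b x) (c x) (d x) (h x)) x₀ := by
  have hmk : ∀ {p q : X → ℝ}, ContinuousAt p x₀ → ContinuousAt q x₀ →
      ContinuousAt (fun x => (⟨p x, q x⟩ : ℂ)) x₀ := fun hp hq =>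
    Complex.equivRealProdCLM.symm.continuous.continuousAt.comp (hp.prodMk hq)
  exact continuousAt_mkMob _ (hmk ((ha.add hd).div_const 2) ((hb.sub hc).div_const 2))
    (hmk ((hd.sub ha).div_const 2) ((hb.add hc).div_const 2))

lemma rot_eq_J (θ : ℝ) : rot θ = J (Real.cos (θ / 2)) (Real.sin (θ / 2)) (-Real.sin (θ / 2))
    (Real.cos (θ / 2)) (by nlinarith [Real.sin_sq_add_cos_sq (θ / 2)]) := by
  refine mob_ext fun z => Circle.ext ?_
  rw [J, mkMob_apply]
  have e1 : (⟨(Real.cos (θ / 2) + Real.cos (θ / 2)) / 2,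
      (Real.sin (θ / 2) - -Real.sin (θ / 2)) / 2⟩ : ℂ) = Circle.exp (θ / 2) := by
    apply Complex.ext
    · rw [Circle.coe_exp, Complex.exp_ofReal_mul_I_re]; ring
    · rw [Circle.coe_exp, Complex.exp_ofReal_mul_I_im]; ring
  have e2 : (⟨(Real.cos (θ / 2) - Real.cos (θ / 2)) / 2,
      (Real.sin (θ / 2) + -Real.sin (θ / 2)) / 2⟩ : ℂ) = 0 := by
    apply Complex.ext <;> simp
  have e3 : Circle.exp θ = Circle.exp (θ / 2) * Circle.exp (θ / 2) := by
    rw [← Circle.exp_add, add_halves]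
  rw [e1, e2, map_zero, zero_mul, zero_add, add_zero, ← Circle.coe_inv_eq_conj, Circle.coe_inv,
    div_inv_eq_mul]
  change ((Circle.exp θ * z : Circle) : ℂ) = _
  rw [e3, Circle.coe_mul, Circle.coe_mul]
  ring

/-- The translation `t ↦ t + w`. -/
noncomputable def T (w : ℝ) : Mob := J 1 w 0 1 (by ring)

/-- The special conformal transformation `t ↦ t / (c t + 1)`. -/
noncomputable def S (c : ℝ) : Mob := J 1 0 c 1 (by ring)

/-- The dilation `t ↦ s² t`. -/
noncomputable def D (s : ℝ) (hs : s ≠ 0) : Mob := J s 0 0 s⁻¹ (by field_simp; simp)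

lemma J_one : J 1 0 0 1 (by ring) = 1 := by
  refine mob_ext fun z => Circle.ext ?_
  rw [J, mkMob_apply]
  have e1 : (⟨(1 + 1) / 2, (0 - 0) / 2⟩ : ℂ) = 1 := by apply Complex.ext <;> simp
  have e2 : (⟨(1 - 1) / 2, (0 + 0) / 2⟩ : ℂ) = 0 := by apply Complex.ext <;> simp
  rw [e1, e2]
  simp

lemma T_add (v w : ℝ) : T (v + w) = T v * T w := by
  rw [T, T, T, J_mul]; apply J_congr <;> ring

lemma T_zero : T 0 = 1 := J_one

lemma T_neg (w : ℝ) : T (-w) = (T w)⁻¹ :=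
  eq_inv_of_mul_eq_one_left (by rw [← T_add, neg_add_cancel, T_zero])

lemma S_add (v w : ℝ) : S (v + w) = S v * S w := by
  rw [S, S, S, J_mul]; apply J_congr <;> ring

lemma S_zero : S 0 = 1 := J_one

lemma D_inv {s : ℝ} (hs : s ≠ 0) : (D s hs)⁻¹ = D s⁻¹ (inv_ne_zero hs) := by
  refine (eq_inv_of_mul_eq_one_left ?_).symm
  rw [D, D, J_mul, ← J_one]
  apply J_congr <;> field_simp <;> simp

lemma D_mul_T {s : ℝ} (hs : s ≠ 0) (w : ℝ) : D s hs * T w = T (s ^ 2 * w) * D s hs := by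
  rw [D, T, T, J_mul, J_mul]
  apply J_congr <;> field_simp <;> ring

lemma D_mul_S {s : ℝ} (hs : s ≠ 0) (c : ℝ) : D s hs * S c = S (c / s ^ 2) * D s hs := by
  rw [D, S, S, J_mul, J_mul]
  apply J_congr <;> field_simp <;> ring

lemma T_pt (w t : ℝ) : (T w).1.1 (pt t) = pt (t + w) := by
  rw [T, J_pt _ (by simp)]; simp

lemma D_pt {s : ℝ} (hs : s ≠ 0) (t : ℝ) : (D s hs).1.1 (pt t) = pt (s ^ 2 * t) := by
  rw [D, J_pt _ (by simpa using hs)]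
  congr 1
  field_simp
  ring

lemma continuous_T : Continuous T :=
  continuous_iff_continuousAt.2 fun _ => continuousAt_J _ continuousAt_const continuousAt_id
    continuousAt_const continuousAt_const

lemma continuous_S : Continuous S :=
  continuous_iff_continuousAt.2 fun _ => continuousAt_J _ continuousAt_const continuousAt_const
    continuousAt_id continuousAt_const

lemma continuous_rot : Continuous rot := by
  rw [funext rot_eq_J]
  exact continuous_iff_continuousAt.2 fun _ => continuousAt_J _ (by fun_prop) (by fun_prop)
    (by fun_prop) (by fun_prop)

lemma rot_add (s t : ℝ) : rot (s + t) = rot s * rot t :=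
  mob_ext fun z => by
    change Circle.exp (s + t) * z = Circle.exp s * (Circle.exp t * z)
    rw [Circle.exp_add, mul_assoc]

/-- The Möbius group is generated by translations and special conformal transformations. -/
lemma closure_T_S {G : Submonoid Mob} (hT : ∀ w, T w ∈ G) (hS : ∀ c, S c ∈ G) (g : Mob) :
    g ∈ G := by
  have key : ∀ a b c d : ℝ, ∀ h : a * d - b * c = 1, c ≠ 0 → J a b c d h ∈ G := by
    intro a b c d h hc
    have : J a b c d h = T ((a - 1) / c) * S c * T ((d - 1) / c) := by
      rw [T, T, S, J_mul, J_mul]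
      apply J_congr <;> field_simp
      · ring
      · linear_combination -h
      · ring
      · ring
    rw [this]
    exact G.mul_mem (G.mul_mem (hT _) (hS _)) (hT _)
  obtain ⟨a, b, c, d, h, rfl⟩ := exists_eq_J g
  by_cases hc : c = 0
  · subst hc
    have ha : a ≠ 0 := by rintro rfl; simp at h
    have : J a b 0 d h = S (-1) * (S 1 * J a b 0 d h) := by
      rw [← mul_assoc, ← S_add, neg_add_cancel, S_zero, one_mul]
    rw [this]
    refine G.mul_mem (hS _) ?_
    rw [S, J_mul]
    exact key _ _ _ _ _ (by simpa using ha)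
  · exact key _ _ _ _ _ hc

end CircleNet

namespace CircleNet

open Filter Topology MeasureTheory

/-! ### Boundary values of bounded analytic functions -/

/-- The integrable difference of two Cauchy kernels on the real line. -/
noncomputable def cauchyDiff (ζ ζ' : ℂ) (t : ℝ) : ℂ := ((t : ℂ) - ζ)⁻¹ - ((t : ℂ) - ζ')⁻¹

/-- The bounded function `f` on the line is the boundary value of an analytic function on the
upper half-plane. -/
def IsHardy (f : ℝ → ℂ) : Prop :=
  ∀ ζ ζ' : ℂ, ζ.im < 0 → ζ'.im < 0 → ∫ t : ℝ, f t * cauchyDiff ζ ζ' t = 0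

lemma ofReal_sub_ne_zero {ζ : ℂ} (hζ : ζ.im ≠ 0) (t : ℝ) : (t : ℂ) - ζ ≠ 0 := fun h => by
  have := congrArg Complex.im h
  simp at this
  exact hζ this

lemma integrable_inv_norm_sq {ζ : ℂ} (hζ : ζ.im ≠ 0) :
    Integrable fun t : ℝ => (‖(t : ℂ) - ζ‖ ^ 2)⁻¹ := by
  have h := ((integrable_inv_one_add_sq.comp_div hζ).comp_sub_right ζ.re).const_mul (ζ.im ^ 2)⁻¹
  refine h.congr (.of_forall fun t => ?_)
  simp only
  rw [← Complex.normSq_eq_norm_sq, Complex.normSq_apply, ← mul_inv]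
  congr 1
  simp only [Complex.sub_re, Complex.ofReal_re, Complex.sub_im, Complex.ofReal_im, zero_sub]
  field_simp
  ring

lemma continuous_cauchyDiff {ζ ζ' : ℂ} (hζ : ζ.im ≠ 0) (hζ' : ζ'.im ≠ 0) :
    Continuous (cauchyDiff ζ ζ') := by
  unfold cauchyDiff
  exact ((Complex.continuous_ofReal.sub continuous_const).inv₀ (ofReal_sub_ne_zero hζ)).sub
    ((Complex.continuous_ofReal.sub continuous_const).inv₀ (ofReal_sub_ne_zero hζ'))

lemma norm_inv_sub_inv_le {z w : ℂ} (hz : z ≠ 0) (hw : w ≠ 0) :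
    ‖z⁻¹ - w⁻¹‖ ≤ ‖w - z‖ * ((‖z‖ ^ 2)⁻¹ + (‖w‖ ^ 2)⁻¹) := by
  rw [inv_sub_inv hz hw, norm_div, norm_mul, div_eq_mul_inv, mul_inv, ← inv_pow, ← inv_pow]
  refine mul_le_mul_of_nonneg_left ?_ (norm_nonneg _)
  nlinarith [sq_nonneg (‖z‖⁻¹ - ‖w‖⁻¹), sq_nonneg ‖z‖⁻¹, sq_nonneg ‖w‖⁻¹]

lemma integrable_cauchyDiff {ζ ζ' : ℂ} (hζ : ζ.im ≠ 0) (hζ' : ζ'.im ≠ 0) :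
    Integrable (cauchyDiff ζ ζ') := by
  refine (((integrable_inv_norm_sq hζ).add (integrable_inv_norm_sq hζ')).const_mul
    ‖ζ - ζ'‖).mono' (continuous_cauchyDiff hζ hζ').aestronglyMeasurable (.of_forall fun t => ?_)
  have := norm_inv_sub_inv_le (ofReal_sub_ne_zero hζ t) (ofReal_sub_ne_zero hζ' t)
  rwa [sub_sub_sub_cancel_left] at this

lemma integrable_mul_cauchyDiff {f : ℝ → ℂ} (hf : Continuous f) {C : ℝ} (hC : ∀ t, ‖f t‖ ≤ C)
    {ζ ζ' : ℂ} (hζ : ζ.im ≠ 0) (hζ' : ζ'.im ≠ 0) :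
    Integrable fun t => f t * cauchyDiff ζ ζ' t :=
  (integrable_cauchyDiff hζ hζ').bdd_mul hf.aestronglyMeasurable (.of_forall hC)

lemma IsHardy.of_tendsto {F : ℕ → ℝ → ℂ} {f : ℝ → ℂ} {C : ℝ} (hF : ∀ n, Continuous (F n))
    (hC : ∀ n t, ‖F n t‖ ≤ C) (hH : ∀ n, IsHardy (F n))
    (hlim : ∀ t, Tendsto (fun n => F n t) atTop (𝓝 (f t))) : IsHardy f := by
  intro ζ ζ' hζ hζ'
  refine tendsto_nhds_unique (tendsto_integral_of_dominated_convergence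
    (F := fun n t => F n t * cauchyDiff ζ ζ' t) (fun t => C * ‖cauchyDiff ζ ζ' t‖)
    (fun n => ((hF n).mul (continuous_cauchyDiff hζ.ne hζ'.ne)).aestronglyMeasurable)
    ((integrable_cauchyDiff hζ.ne hζ'.ne).norm.const_mul C)
    (fun n => .of_forall fun t => ?_) (.of_forall fun t => (hlim t).mul_const _)) ?_
  · rw [norm_mul]
    exact mul_le_mul_of_nonneg_right (hC n t) (norm_nonneg _)
  · simp only [hH _ ζ ζ' hζ hζ']
    exact tendsto_const_nhds

lemma isHardy_exp {s : ℝ} (hs : 0 ≤ s) : IsHardy fun t => Complex.exp (Complex.I * s * t) := by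
  intro ζ ζ' hζ hζ'
  set F : ℂ → ℂ := fun z => Complex.exp (Complex.I * s * z) * ((z - ζ)⁻¹ - (z - ζ')⁻¹) with hF
  set M := ‖ζ‖ + ‖ζ'‖ with hM
  have hexp : ∀ z : ℂ, 0 ≤ z.im → ‖Complex.exp (Complex.I * s * z)‖ ≤ 1 := fun z hz => by
    rw [Complex.norm_exp, Real.exp_le_one_iff]
    simp
    positivity
  have hne : ∀ w : ℂ, w.im < 0 → ∀ z : ℂ, 0 ≤ z.im → z - w ≠ 0 := fun w hw z hz h => by
    have := congrArg Complex.im h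
    simp at this
    linarith
  have hbd : ∀ N : ℝ, 2 * M < N → ∀ z : ℂ, 0 ≤ z.im → N ≤ ‖z‖ → ‖F z‖ ≤ 8 * M * (N ^ 2)⁻¹ := by
    intro N hN z hz hzN
    have hNpos : 0 < N := lt_of_le_of_lt (by positivity) hN
    have hfar : ∀ w : ℂ, ‖w‖ ≤ M → (‖z - w‖ ^ 2)⁻¹ ≤ 4 * (N ^ 2)⁻¹ := fun w hw => by
      have h1 : N / 2 ≤ ‖z - w‖ := by have := norm_sub_norm_le z w; linarith
      have h2 : (N / 2) ^ 2 ≤ ‖z - w‖ ^ 2 := by gcongr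
      calc (‖z - w‖ ^ 2)⁻¹ ≤ ((N / 2) ^ 2)⁻¹ := by gcongr
        _ = 4 * (N ^ 2)⁻¹ := by field_simp; norm_num
    have h3 := norm_inv_sub_inv_le (hne ζ hζ z hz) (hne ζ' hζ' z hz)
    have h4 := hfar ζ (by simp [hM])
    have h5 := hfar ζ' (by simp [hM])
    rw [sub_sub_sub_cancel_left] at h3
    calc ‖F z‖ ≤ 1 * ‖(z - ζ)⁻¹ - (z - ζ')⁻¹‖ := by
          rw [hF, norm_mul]; exact mul_le_mul_of_nonneg_right (hexp z hz) (norm_nonneg _)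
      _ ≤ M * (4 * (N ^ 2)⁻¹ + 4 * (N ^ 2)⁻¹) := by
          rw [one_mul]
          refine h3.trans (mul_le_mul (norm_sub_le _ _) (add_le_add h4 h5) (by positivity)
            (by positivity))
      _ = 8 * M * (N ^ 2)⁻¹ := by ring
  have hdiff : DifferentiableOn ℂ F {z | 0 ≤ z.im} := by
    intro z hz
    refine DifferentiableAt.differentiableWithinAt ?_
    refine DifferentiableAt.mul (by fun_prop) (DifferentiableAt.sub ?_ ?_)
    · exact (differentiableAt_id.sub_const ζ).inv (hne ζ hζ z hz)
    · exact (differentiableAt_id.sub_const ζ').inv (hne ζ' hζ' z hz)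
  have hrect : ∀ N : ℝ, 2 * M < N → 
      ‖∫ t in (-N)..N, F t‖ ≤ 8 * M * (N ^ 2)⁻¹ * (4 * N) := by
    intro N hN
    have hNpos : 0 < N := lt_of_le_of_lt (by positivity) hN
    have h := Complex.integral_boundary_rect_eq_zero_of_differentiableOn F (-N : ℝ) (⟨N, N⟩ : ℂ)
      (hdiff.mono fun z hz => by
        have h2 := hz.2
        simp only [Complex.ofReal_im, Set.mem_preimage, Set.uIcc_of_le hNpos.le] at h2
        exact h2.1)
    simp only [Complex.ofReal_re, Complex.ofReal_im, Complex.ofReal_zero, zero_mul, add_zero] at h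
    have hmem : ∀ y : ℝ, y ∈ Set.uIoc 0 N → 0 ≤ y := fun y hy => by
      rw [Set.uIoc_of_le hNpos.le] at hy; exact hy.1.le
    have b1 : ‖∫ x : ℝ in (-N)..N, F (x + N * Complex.I)‖ ≤ 8 * M * (N ^ 2)⁻¹ * |N - -N| := by
      refine intervalIntegral.norm_integral_le_of_norm_le_const fun x _ => hbd N hN _ ?_ ?_
      · simp [hNpos.le]
      · refine le_trans ?_ (Complex.abs_im_le_norm _)
        simp [le_abs_self]
    have b2 : ‖∫ y : ℝ in (0)..N, F (N + y * Complex.I)‖ ≤ 8 * M * (N ^ 2)⁻¹ * |N - 0| := by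
      refine intervalIntegral.norm_integral_le_of_norm_le_const fun x hx => hbd N hN _ ?_ ?_
      · simp [hmem x hx]
      · refine le_trans ?_ (Complex.abs_re_le_norm _)
        simp [le_abs_self]
    have b3 : ‖∫ y : ℝ in (0)..N, F ((-N : ℝ) + y * Complex.I)‖ ≤ 8 * M * (N ^ 2)⁻¹ * |N - 0| := by
      refine intervalIntegral.norm_integral_le_of_norm_le_const fun x hx => hbd N hN _ ?_ ?_
      · simp [hmem x hx]
      · refine le_trans ?_ (Complex.abs_re_le_norm _)
        simp [le_abs_self]
    rw [abs_of_nonneg (by linarith)] at b1 b2 b3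
    have h' : (∫ x : ℝ in (-N)..N, F x) = (∫ x : ℝ in (-N)..N, F (x + N * Complex.I))
        - Complex.I • (∫ y : ℝ in (0)..N, F (N + y * Complex.I))
        + Complex.I • (∫ y : ℝ in (0)..N, F ((-N : ℝ) + y * Complex.I)) := by
      linear_combination h
    rw [h']
    refine (norm_add_le _ _).trans ((add_le_add (norm_sub_le _ _) le_rfl).trans ?_)
    rw [norm_smul, norm_smul, Complex.norm_I, one_mul, one_mul]
    calc _ ≤ 8 * M * (N ^ 2)⁻¹ * (N - -N) + 8 * M * (N ^ 2)⁻¹ * (N - 0)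
          + 8 * M * (N ^ 2)⁻¹ * (N - 0) := add_le_add (add_le_add b1 b2) b3
      _ = _ := by ring
  have hint : Integrable fun t : ℝ => F t := by
    refine integrable_mul_cauchyDiff (f := fun t => Complex.exp (Complex.I * s * t)) (by fun_prop)
      (C := 1) (fun t => hexp t (by simp)) hζ.ne hζ'.ne
  have hlim := intervalIntegral_tendsto_integral hint tendsto_neg_atTop_atBot tendsto_id
  refine tendsto_nhds_unique hlim ?_
  have hz : Tendsto (fun N : ℝ => 32 * M * N⁻¹) atTop (𝓝 0) := by
    simpa using tendsto_inv_atTop_zero.const_mul (32 * M)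
  refine squeeze_zero_norm' ?_ hz
  filter_upwards [eventually_gt_atTop (2 * M)] with N hN
  have hNpos : 0 < N := lt_of_le_of_lt (by positivity) hN
  refine (hrect N hN).trans (le_of_eq ?_)
  field_simp
  ring

lemma cauchyDiff_sub_conj (a₁ a₂ : ℝ) {b : ℝ} (hb : b ≠ 0) (t : ℝ) :
    cauchyDiff (a₂ + b * Complex.I) (a₁ + b * Complex.I) t
      - cauchyDiff (a₂ - b * Complex.I) (a₁ - b * Complex.I) t
      = 2 * Complex.I * ((b / ((t - a₂) ^ 2 + b ^ 2) : ℝ) - (b / ((t - a₁) ^ 2 + b ^ 2) : ℝ)) := by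
  have key : ∀ a : ℝ, ((t : ℂ) - (a + b * Complex.I))⁻¹ - ((t : ℂ) - (a - b * Complex.I))⁻¹
      = 2 * Complex.I * (b / ((t - a) ^ 2 + b ^ 2) : ℝ) := fun a => by
    have h1 : (t : ℂ) - (a + b * Complex.I) ≠ 0 := ofReal_sub_ne_zero (by simpa using hb) t
    have h2 : (t : ℂ) - (a - b * Complex.I) ≠ 0 := ofReal_sub_ne_zero (by simpa using hb) t
    have h3 : ((t : ℂ) - (a + b * Complex.I)) * ((t : ℂ) - (a - b * Complex.I))
        = ((t : ℂ) - a) ^ 2 + (b : ℂ) ^ 2 := by linear_combination (-(b : ℂ) ^ 2) * Complex.I_sq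
    rw [inv_sub_inv h1 h2, h3]
    push_cast
    rw [mul_div_assoc']
    congr 1
    ring
  unfold cauchyDiff
  linear_combination key a₂ - key a₁

lemma tendsto_poisson {f : ℝ → ℂ} (hf : Continuous f) {C : ℝ} (hC : ∀ t, ‖f t‖ ≤ C) (a : ℝ) :
    Tendsto (fun b : ℝ => ∫ t : ℝ, f t * (b / ((t - a) ^ 2 + b ^ 2) : ℝ)) (𝓝[>] 0)
      (𝓝 (Real.pi * f a)) := by
  have h1 : ∀ b : ℝ, 0 < b → ∫ t : ℝ, f t * (b / ((t - a) ^ 2 + b ^ 2) : ℝ)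
      = ∫ u : ℝ, f (a + b * u) * ((1 + u ^ 2)⁻¹ : ℝ) := fun b hb => by
    rw [← integral_add_right_eq_self (fun t : ℝ => f t * (b / ((t - a) ^ 2 + b ^ 2) : ℝ)) a]
    have := Measure.integral_comp_mul_left
      (fun t : ℝ => f (t + a) * (b / ((t + a - a) ^ 2 + b ^ 2) : ℝ)) b
    rw [abs_of_pos (inv_pos.2 hb), eq_inv_smul_iff₀ hb.ne', ← integral_smul] at this
    rw [← this]
    refine integral_congr_ae (.of_forall fun u => ?_)
    simp only [Complex.real_smul]
    rw [add_comm (b * u) a, mul_left_comm]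
    congr 1
    rw [← Complex.ofReal_mul]
    congr 1
    have : 1 + u ^ 2 ≠ 0 := by positivity
    rw [add_sub_cancel_left]
    field_simp
    ring
  have h2 : Tendsto (fun b : ℝ => ∫ u : ℝ, f (a + b * u) * ((1 + u ^ 2)⁻¹ : ℝ)) (𝓝[>] 0)
      (𝓝 (∫ u : ℝ, f (a + 0 * u) * ((1 + u ^ 2)⁻¹ : ℝ))) := by
    refine tendsto_integral_filter_of_dominated_convergence (fun u => C * (1 + u ^ 2)⁻¹)
      (.of_forall fun b => ?_) (.of_forall fun b => .of_forall fun u => ?_)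
      (integrable_inv_one_add_sq.const_mul C) (.of_forall fun u => ?_)
    · refine Continuous.aestronglyMeasurable ((by fun_prop : Continuous _).mul ?_)
      exact Complex.continuous_ofReal.comp (Continuous.inv₀ (by fun_prop) fun u => by positivity)
    · rw [norm_mul, Complex.norm_real, Real.norm_of_nonneg (by positivity)]
      exact mul_le_mul_of_nonneg_right (hC _) (by positivity)
    · exact ((hf.comp (by fun_prop : Continuous fun b : ℝ => a + b * u)).continuousAt.tendsto.mono_left
        nhdsWithin_le_nhds).mul_const _
  have h3 : ∫ u : ℝ, f (a + 0 * u) * ((1 + u ^ 2)⁻¹ : ℝ) = Real.pi * f a := by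
    simp only [zero_mul, add_zero]
    rw [integral_const_mul, integral_complex_ofReal, integral_univ_inv_one_add_sq, mul_comm]
  rw [h3] at h2
  refine h2.congr' ?_
  filter_upwards [self_mem_nhdsWithin] with b hb
  exact (h1 b hb).symm

lemma integrable_poisson {f : ℝ → ℂ} (hf : Continuous f) {C : ℝ} (hC : ∀ t, ‖f t‖ ≤ C) (a : ℝ)
    {b : ℝ} (hb : 0 < b) : Integrable fun t : ℝ => f t * (b / ((t - a) ^ 2 + b ^ 2) : ℝ) := by
  refine Integrable.bdd_mul (c := C) ?_ hf.aestronglyMeasurable (.of_forall hC)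
  have := (integrable_inv_norm_sq (ζ := a + b * Complex.I) (by simpa using hb.ne')).const_mul b
  refine this.ofReal.congr (.of_forall fun t => ?_)
  simp only
  rw [← Complex.normSq_eq_norm_sq, Complex.normSq_apply, div_eq_mul_inv]
  congr 3
  simp
  ring

lemma IsHardy.tendsto_cauchy {f : ℝ → ℂ} (hf : Continuous f) {C : ℝ} (hC : ∀ t, ‖f t‖ ≤ C)
    (hH : IsHardy f) (a₁ a₂ : ℝ) :
    Tendsto (fun b : ℝ => ∫ t : ℝ, f t * cauchyDiff (a₂ + b * Complex.I) (a₁ + b * Complex.I) t)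
      (𝓝[>] 0) (𝓝 (2 * Complex.I * Real.pi * (f a₂ - f a₁))) := by
  have h := ((tendsto_poisson hf hC a₂).sub (tendsto_poisson hf hC a₁)).const_mul (2 * Complex.I)
  rw [← mul_sub, ← mul_assoc] at h
  refine h.congr' ?_
  filter_upwards [self_mem_nhdsWithin] with b (hb : 0 < b)
  rw [← integral_sub (integrable_poisson hf hC _ hb) (integrable_poisson hf hC _ hb),
    ← integral_const_mul, ← sub_zero (∫ t : ℝ, f t * cauchyDiff _ _ t),
    ← hH (a₂ - b * Complex.I) (a₁ - b * Complex.I) (by simpa using hb) (by simpa using hb),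
    ← integral_sub]
  · refine integral_congr_ae (.of_forall fun t => ?_)
    simp only
    linear_combination -f t * cauchyDiff_sub_conj a₁ a₂ hb.ne' t
  · exact integrable_mul_cauchyDiff hf hC (by simpa using hb.ne') (by simpa using hb.ne')
  · exact integrable_mul_cauchyDiff hf hC (by simpa using hb.ne') (by simpa using hb.ne')

/-- Cauchy's formula for a function which is analytic off a real interval: `f` and `g` are the
boundary values from the upper and the lower half-plane. -/
lemma IsHardy.cauchy_formula {f g : ℝ → ℂ} (hf : Continuous f) (hg : Continuous g) {C : ℝ}
    (hfC : ∀ t, ‖f t‖ ≤ C) (hgC : ∀ t, ‖g t‖ ≤ C) (hfH : IsHardy f)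
    (hgH : IsHardy fun t => conj (g t)) {R : ℝ} (hR : 0 ≤ R) (hfg : ∀ t, R ≤ |t| → f t = g t)
    {a₁ a₂ : ℝ} (h₁ : R < |a₁|) (h₂ : R < |a₂|) :
    2 * Complex.I * Real.pi * (f a₂ - f a₁)
      = ∫ t in (-R)..R, (f t - g t) * ((t - a₂ : ℂ)⁻¹ - (t - a₁ : ℂ)⁻¹) := by
  refine tendsto_nhds_unique (hfH.tendsto_cauchy hf hfC a₁ a₂) ?_
  have hfar : ∀ a : ℝ, R < |a| → ∀ t b : ℝ, t ∈ Set.uIcc (-R) R →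
      |a| - R ≤ ‖(t : ℂ) - (a + b * Complex.I)‖ := fun a ha t b ht => by
    rw [Set.uIcc_of_le (by linarith)] at ht
    refine le_trans ?_ (Complex.abs_re_le_norm _)
    have h1 : |t| ≤ R := abs_le.2 ht
    have h2 := abs_sub_abs_le_abs_sub a t
    rw [abs_sub_comm] at h2
    simp
    linarith
  have hne : ∀ a : ℝ, R < |a| → ∀ t b : ℝ, t ∈ Set.uIcc (-R) R →
      (t : ℂ) - (a + b * Complex.I) ≠ 0 := fun a ha t b ht =>
    norm_pos_iff.1 (lt_of_lt_of_le (by linarith) (hfar a ha t b ht))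
  have hlim : Tendsto (fun b : ℝ => ∫ t in (-R)..R,
      (f t - g t) * cauchyDiff (a₂ + b * Complex.I) (a₁ + b * Complex.I) t) (𝓝[>] 0)
      (𝓝 (∫ t in (-R)..R, (f t - g t) * ((t - a₂ : ℂ)⁻¹ - (t - a₁ : ℂ)⁻¹))) := by
    refine intervalIntegral.tendsto_integral_filter_of_dominated_convergence
      (fun _ => (C + C) * ((|a₂| - R)⁻¹ + (|a₁| - R)⁻¹)) ?_ ?_ intervalIntegrable_const ?_
    · filter_upwards [self_mem_nhdsWithin] with b (hb : 0 < b)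
      exact ((hf.sub hg).mul (continuous_cauchyDiff (by simpa using hb.ne')
        (by simpa using hb.ne'))).aestronglyMeasurable
    · refine .of_forall fun b => .of_forall fun t ht => ?_
      have hinv : ∀ a : ℝ, R < |a| → ‖((t : ℂ) - (a + b * Complex.I))⁻¹‖ ≤ (|a| - R)⁻¹ :=
        fun a ha => by
          rw [norm_inv]
          exact inv_anti₀ (by linarith) (hfar a ha t b (Set.uIoc_subset_uIcc ht))
      rw [norm_mul]
      exact mul_le_mul ((norm_sub_le _ _).trans (add_le_add (hfC t) (hgC t)))
        ((norm_sub_le _ _).trans (add_le_add (hinv a₂ h₂) (hinv a₁ h₁))) (norm_nonneg _)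
        (add_nonneg ((norm_nonneg _).trans (hfC 0)) ((norm_nonneg _).trans (hfC 0)))
    · refine .of_forall fun t ht => ?_
      have hinv : ∀ a : ℝ, R < |a| → Tendsto (fun b : ℝ => ((t : ℂ) - (a + b * Complex.I))⁻¹)
          (𝓝[>] 0) (𝓝 ((t - a : ℂ)⁻¹)) := fun a ha => by
        have h0 := hne a ha t 0 (Set.uIoc_subset_uIcc ht)
        have hc : ContinuousAt (fun b : ℝ => ((t : ℂ) - (a + b * Complex.I))⁻¹) 0 :=
          ContinuousAt.inv₀ (by fun_prop) h0
        have := hc.tendsto.mono_left (nhdsWithin_le_nhds (s := Set.Ioi 0))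
        simpa using this
      exact ((hinv a₂ h₂).sub (hinv a₁ h₁)).const_mul _
  refine hlim.congr' ?_
  filter_upwards [self_mem_nhdsWithin] with b (hb : 0 < b)
  have hg0 : ∫ t : ℝ, g t * cauchyDiff (a₂ + b * Complex.I) (a₁ + b * Complex.I) t = 0 := by
    have := hgH (a₂ - b * Complex.I) (a₁ - b * Complex.I) (by simpa using hb) (by simpa using hb)
    rw [← map_eq_zero (starRingEnd ℂ), ← integral_conj] at this
    rw [← this]
    refine integral_congr_ae (.of_forall fun t => ?_)
    simp [cauchyDiff]
  rw [← sub_zero (∫ t : ℝ, f t * _), ← hg0, ← integral_sub, 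
    intervalIntegral.integral_of_le (by linarith), ← integral_indicator measurableSet_Ioc]
  · refine integral_congr_ae ?_
    have : ∀ᵐ t : ℝ, t ≠ -R := by simp [ae_iff]
    filter_upwards [this] with t ht
    by_cases hm : t ∈ Set.Ioc (-R) R
    · rw [Set.indicator_of_mem hm, sub_mul]
    · rw [Set.indicator_of_notMem hm, hfg t ?_, sub_self]
      by_contra! hlt
      exact hm ⟨(abs_lt.1 hlt).1, (abs_lt.1 hlt).2.le⟩
  · exact integrable_mul_cauchyDiff hf hfC (by simpa using hb.ne') (by simpa using hb.ne')
  · exact integrable_mul_cauchyDiff hg hgC (by simpa using hb.ne') (by simpa using hb.ne')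

/-- A bounded continuous boundary value of an analytic function that vanishes on a half-line
vanishes. -/
lemma IsHardy.eq_zero {f : ℝ → ℂ} (hf : Continuous f) {C : ℝ} (hC : ∀ t, ‖f t‖ ≤ C)
    (hH : IsHardy f) (h0 : ∀ t, 0 ≤ t → f t = 0) (t : ℝ) : f t = 0 := by
  have hI : (-Complex.I).im ≠ 0 := by simp
  set Φ : ℂ → ℂ := fun ζ => ∫ t in Set.Iic (0 : ℝ), f t * cauchyDiff ζ (-Complex.I) t with hΦ
  have hΦ' : ∀ ζ : ℂ, Φ ζ = ∫ t : ℝ, f t * cauchyDiff ζ (-Complex.I) t := fun ζ => by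
    refine (integral_indicator measurableSet_Iic).symm.trans ?_
    refine integral_congr_ae (.of_forall fun t => ?_)
    by_cases ht : t ∈ Set.Iic (0 : ℝ)
    · rw [Set.indicator_of_mem ht]
    · rw [Set.indicator_of_notMem ht]
      change 0 = f t * cauchyDiff ζ (-Complex.I) t
      rw [h0 t (not_le.1 ht).le, zero_mul]
  have hdiff : DifferentiableOn ℂ Φ Complex.slitPlane := by
    intro ζ₀ hζ₀
    refine DifferentiableAt.differentiableWithinAt ?_
    obtain ⟨r, hr, hball⟩ := Metric.isOpen_iff.1 Complex.isOpen_slitPlane ζ₀ hζ₀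
    have hfar : ∀ t : ℝ, t ≤ 0 → r ≤ ‖(t : ℂ) - ζ₀‖ := fun t ht => by
      by_contra! hlt
      have : (t : ℂ) ∈ Complex.slitPlane := hball (by rwa [Metric.mem_ball, dist_eq_norm])
      rw [Complex.ofReal_mem_slitPlane] at this
      linarith
    have hhalf : ∀ t : ℝ, t ≤ 0 → ∀ ζ ∈ Metric.ball ζ₀ (r / 2), ‖(t : ℂ) - ζ₀‖ / 2 ≤ ‖(t : ℂ) - ζ‖ :=
      fun t ht ζ hζ => by
        rw [Metric.mem_ball, dist_eq_norm] at hζ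
        have h1 := norm_sub_norm_le ((t : ℂ) - ζ₀) (ζ - ζ₀)
        rw [sub_sub_sub_cancel_right] at h1
        linarith [hfar t ht]
    have hne : ∀ t : ℝ, t ≤ 0 → ∀ ζ ∈ Metric.ball ζ₀ (r / 2), (t : ℂ) - ζ ≠ 0 := fun t ht ζ hζ =>
      norm_pos_iff.1 (lt_of_lt_of_le (by linarith [hfar t ht]) (hhalf t ht ζ hζ))
    set K := 1 + ‖ζ₀ + Complex.I‖ / r with hK
    have hKpos : 0 < K := by positivity
    have hI2 := integrable_inv_norm_sq hI
    have hsq : ∀ t : ℝ, t ≤ 0 → (‖(t : ℂ) - ζ₀‖ ^ 2)⁻¹ ≤ K ^ 2 * (‖(t : ℂ) - -Complex.I‖ ^ 2)⁻¹ :=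
      fun t ht => by
        have h1 : ‖(t : ℂ) - -Complex.I‖ ≤ K * ‖(t : ℂ) - ζ₀‖ := by
          have h2 : (t : ℂ) - -Complex.I = (t - ζ₀) + (ζ₀ + Complex.I) := by ring
          rw [h2]
          refine (norm_add_le _ _).trans ?_
          rw [hK, add_mul, one_mul, div_mul_eq_mul_div]
          gcongr
          rw [le_div_iff₀ hr]
          exact mul_le_mul_of_nonneg_left (hfar t ht) (norm_nonneg _)
        have h3 : 0 < ‖(t : ℂ) - -Complex.I‖ := norm_pos_iff.2 (ofReal_sub_ne_zero hI t)
        have h4 : 0 < ‖(t : ℂ) - ζ₀‖ := lt_of_lt_of_le hr (hfar t ht)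
        rw [← div_eq_mul_inv, le_div_iff₀ (by positivity), inv_mul_le_iff₀ (by positivity),
          ← mul_pow, mul_comm _ K]
        gcongr
    have hcontOn : ∀ ζ ∈ Metric.ball ζ₀ (r / 2),
        ContinuousOn (fun t : ℝ => ((t : ℂ) - ζ)⁻¹) (Set.Iic 0) := fun ζ hζ =>
      ContinuousOn.inv₀ (by fun_prop) fun t ht => hne t ht ζ hζ
    have hmeas : ∀ ζ ∈ Metric.ball ζ₀ (r / 2), AEStronglyMeasurable
        (fun t : ℝ => f t * cauchyDiff ζ (-Complex.I) t) (volume.restrict (Set.Iic 0)) :=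
      fun ζ hζ => (hf.continuousOn.mul ((hcontOn ζ hζ).sub (ContinuousOn.inv₀ (by fun_prop)
        fun t _ => ofReal_sub_ne_zero hI t))).aestronglyMeasurable measurableSet_Iic
    have hmem := Metric.mem_ball_self (x := ζ₀) (half_pos hr)
    refine (hasDerivAt_integral_of_dominated_loc_of_deriv_le (𝕜 := ℂ)
      (F' := fun ζ (t : ℝ) => f t * (((t : ℂ) - ζ)⁻¹ * ((t : ℂ) - ζ)⁻¹))
      (bound := fun t : ℝ => C * (4 * (K ^ 2 * (‖(t : ℂ) - -Complex.I‖ ^ 2)⁻¹)))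
      (Metric.ball_mem_nhds ζ₀ (half_pos hr)) ?_ ?_ ?_ ?_ ?_ ?_).2.differentiableAt
    · filter_upwards [Metric.ball_mem_nhds ζ₀ (half_pos hr)] with ζ hζ using hmeas ζ hζ
    · refine (((hI2.const_mul (K ^ 2)).add hI2).const_mul (C * ‖-Complex.I - ζ₀‖)).integrableOn.mono'
        (hmeas ζ₀ hmem) ((ae_restrict_iff' measurableSet_Iic).2 (.of_forall fun t ht => ?_))
      have h1 := norm_inv_sub_inv_le (hne t ht ζ₀ hmem) (ofReal_sub_ne_zero hI t)
      rw [norm_mul, mul_assoc]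
      refine mul_le_mul (hC t) ?_ (norm_nonneg _) ((norm_nonneg _).trans (hC 0))
      refine h1.trans ?_
      rw [sub_sub_sub_cancel_left, norm_sub_rev]
      exact mul_le_mul_of_nonneg_left (add_le_add (hsq t ht) le_rfl) (norm_nonneg _)
    · exact (hf.continuousOn.mul ((hcontOn ζ₀ hmem).mul
        (hcontOn ζ₀ hmem))).aestronglyMeasurable measurableSet_Iic
    · refine (ae_restrict_iff' measurableSet_Iic).2 (.of_forall fun t ht ζ hζ => ?_)
      rw [norm_mul, norm_mul, norm_inv, ← sq, inv_pow]
      refine mul_le_mul (hC t) ?_ (by positivity) ((norm_nonneg _).trans (hC 0))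
      have h4 : 0 < ‖(t : ℂ) - ζ₀‖ := lt_of_lt_of_le hr (hfar t ht)
      calc (‖(t : ℂ) - ζ‖ ^ 2)⁻¹ ≤ ((‖(t : ℂ) - ζ₀‖ / 2) ^ 2)⁻¹ := by
            gcongr; exact hhalf t ht ζ hζ
        _ = 4 * (‖(t : ℂ) - ζ₀‖ ^ 2)⁻¹ := by field_simp; norm_num
        _ ≤ _ := by gcongr; exact hsq t ht
    · exact ((hI2.const_mul (K ^ 2)).const_mul 4).const_mul C |>.integrableOn
    · refine (ae_restrict_iff' measurableSet_Iic).2 (.of_forall fun t ht ζ hζ => ?_)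
      have h1 := ((hasDerivAt_id ζ).const_sub (t : ℂ)).inv (hne t ht ζ hζ)
      refine ((h1.sub_const _).const_mul (f t)).congr_deriv ?_
      have := hne t ht ζ hζ
      simp only [id]
      field_simp
  have hlow : ∀ ζ : ℂ, ζ.im < 0 → Φ ζ = 0 := fun ζ hζ => by
    rw [hΦ']; exact hH ζ _ hζ (by simp)
  have hzero : ∀ ζ ∈ Complex.slitPlane, Φ ζ = 0 := by
    have hopen : IsOpen {ζ : ℂ | ζ.im < 0} := isOpen_lt Complex.continuous_im continuous_const
    refine (hdiff.analyticOnNhd Complex.isOpen_slitPlane).eqOn_zero_of_preconnected_of_eventuallyEq_zero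
      (Complex.starConvex_one_slitPlane.isPathConnected Complex.one_mem_slitPlane).isConnected.isPreconnected
      (z₀ := -Complex.I) (by simp [Complex.slitPlane]) ?_
    filter_upwards [hopen.mem_nhds (show (-Complex.I).im < 0 by simp)] with ζ hζ
    exact hlow ζ hζ
  have hup : ∀ ζ ζ' : ℂ, 0 < ζ.im → 0 < ζ'.im → ∫ t : ℝ, f t * cauchyDiff ζ ζ' t = 0 := by
    intro ζ ζ' hζ hζ'
    have h1 := hzero ζ (Or.inr hζ.ne')
    have h2 := hzero ζ' (Or.inr hζ'.ne')
    rw [hΦ'] at h1 h2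
    refine Eq.trans ?_ ((congrArg₂ (· - ·) h1 h2).trans (sub_zero 0))
    rw [← integral_sub (integrable_mul_cauchyDiff hf hC hζ.ne' hI)
      (integrable_mul_cauchyDiff hf hC hζ'.ne' hI)]
    refine integral_congr_ae (.of_forall fun t => ?_)
    simp only [cauchyDiff]
    ring
  have h := hH.tendsto_cauchy hf hC 0 t
  have h' : 2 * Complex.I * Real.pi * (f t - f 0) = 0 := by
    refine tendsto_nhds_unique h (tendsto_const_nhds.congr' ?_)
    filter_upwards [self_mem_nhdsWithin] with b (hb : 0 < b)
    exact (hup _ _ (by simpa using hb) (by simpa using hb)).symm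
  rw [h0 0 le_rfl, sub_zero] at h'
  have hpi : (Real.pi : ℂ) ≠ 0 := by exact_mod_cast Real.pi_ne_zero
  simpa [Complex.I_ne_zero, hpi] using h'

end CircleNet

namespace CircleNet

open Filter Topology MeasureTheory

variable {H : Type*} [NormedAddCommGroup H] [InnerProductSpace ℂ H] [CompleteSpace H]

/-! ### Unitary operators -/

lemma unitary_mul_apply (u v : UnitaryOp H) (ξ : H) :
    ((u * v : UnitaryOp H) : H →L[ℂ] H) ξ = (u : H →L[ℂ] H) ((v : H →L[ℂ] H) ξ) := rfl

lemma unitary_norm_apply (u : UnitaryOp H) (ξ : H) : ‖(u : H →L[ℂ] H) ξ‖ = ‖ξ‖ :=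
  ContinuousLinearMap.norm_map_of_mem_unitary u.2 ξ

lemma unitary_star_eq (u : UnitaryOp H) :
    star (u : H →L[ℂ] H) = ((u⁻¹ : UnitaryOp H) : H →L[ℂ] H) := by
  rw [← Unitary.star_eq_inv, Unitary.coe_star]

lemma unitary_inv_apply_apply (u : UnitaryOp H) (ξ : H) :
    ((u⁻¹ : UnitaryOp H) : H →L[ℂ] H) ((u : H →L[ℂ] H) ξ) = ξ := by
  rw [← unitary_mul_apply, inv_mul_cancel]; rfl

lemma unitary_apply_inv_apply (u : UnitaryOp H) (ξ : H) :
    (u : H →L[ℂ] H) (((u⁻¹ : UnitaryOp H) : H →L[ℂ] H) ξ) = ξ := by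
  rw [← unitary_mul_apply, mul_inv_cancel]; rfl

lemma inner_star_apply (x : H →L[ℂ] H) (ξ η : H) :
    inner ℂ (star x ξ) η = inner ℂ ξ (x η) := by
  rw [ContinuousLinearMap.star_eq_adjoint, ContinuousLinearMap.adjoint_inner_left]

lemma inner_unitary_inv (u : UnitaryOp H) (ξ η : H) :
    inner ℂ (((u⁻¹ : UnitaryOp H) : H →L[ℂ] H) ξ) η = inner ℂ ξ ((u : H →L[ℂ] H) η) := by
  rw [← unitary_star_eq, inner_star_apply]

/-! ### Positivity of the energy -/

namespace MobiusCovariantNet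

variable (N : MobiusCovariantNet H)

lemma U_mul_apply (g h : Mob) (ξ : H) :
    (N.U (g * h) : H →L[ℂ] H) ξ = (N.U g : H →L[ℂ] H) ((N.U h : H →L[ℂ] H) ξ) := by
  rw [map_mul]; rfl

lemma U_one_apply (ξ : H) : (N.U 1 : H →L[ℂ] H) ξ = ξ := by
  rw [map_one]; rfl

lemma norm_U_apply (g : Mob) (ξ : H) : ‖(N.U g : H →L[ℂ] H) ξ‖ = ‖ξ‖ :=
  unitary_norm_apply _ _

lemma inner_U_inv (g : Mob) (ξ η : H) :
    inner ℂ ((N.U g⁻¹ : H →L[ℂ] H) ξ) η = inner ℂ ξ ((N.U g : H →L[ℂ] H) η) := by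
  rw [map_inv, inner_unitary_inv]

lemma norm_inner_U_le (g : Mob) (ξ η : H) :
    ‖inner ℂ ξ ((N.U g : H →L[ℂ] H) η)‖ ≤ ‖ξ‖ * ‖η‖ :=
  (norm_inner_le_norm _ _).trans (by rw [norm_U_apply])

lemma continuous_inner_U {X : Type*} [TopologicalSpace X] {g : X → Mob} (hg : Continuous g)
    (ξ η : H) : Continuous fun x => inner ℂ ξ ((N.U (g x) : H →L[ℂ] H) η) :=
  continuous_const.inner ((N.strongly_continuous η).comp hg)

/-- The eigenspace of the rotations for the weight `n`. -/
def weightSpace (n : ℤ) : Submodule ℂ H where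
  carrier := {ξ | ∀ t : ℝ, (N.U (rot t) : H →L[ℂ] H) ξ = Complex.exp (Complex.I * n * t) • ξ}
  add_mem' := fun {ξ η} hξ hη t => by rw [map_add, hξ t, hη t, smul_add]
  zero_mem' := fun t => by simp
  smul_mem' := fun c ξ hξ t => by rw [map_smul, hξ t, smul_comm]

lemma weight_nonneg {n : ℤ} {ξ : H} (hξ : ξ ∈ N.weightSpace n) (h0 : ξ ≠ 0) : 0 ≤ n := by
  have hd : HasDerivAt (fun t : ℝ => (N.U (rot t) : H →L[ℂ] H) ξ) ((Complex.I * n) • ξ) 0 := by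
    have h1 : HasDerivAt (fun t : ℝ => Complex.exp (Complex.I * n * t)) (Complex.I * n) 0 := by
      have h2 : HasDerivAt (fun t : ℝ => Complex.I * n * (t : ℂ)) (Complex.I * n * 1) 0 :=
        (hasDerivAt_id (0 : ℝ)).ofReal_comp.const_mul _
      simpa using h2.cexp
    rw [funext hξ]
    exact h1.smul_const ξ
  have hmem : ξ ∈ (conformalHamiltonian N.U).domain := hd.differentiableAt
  have hval : conformalHamiltonian N.U ⟨ξ, hmem⟩ = (n : ℂ) • ξ := by
    change (-Complex.I) • deriv (fun t : ℝ => (N.U (rot t) : H →L[ℂ] H) ξ) 0 = _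
    rw [hd.deriv, smul_smul, ← mul_assoc, neg_mul, Complex.I_mul_I, neg_neg, one_mul]
  have hspec : (n : ℂ) ∈ unboundedSpectrum (conformalHamiltonian N.U) := by
    intro hbij
    have h1 := @hbij.1 ⟨ξ, hmem⟩ 0 (by
      simp only [hval, sub_self, LinearPMap.map_zero, ZeroMemClass.coe_zero, smul_zero])
    exact h0 (congrArg Subtype.val h1)
  have := (N.positive_energy _ hspec).1
  simpa using this

/-- The (unnormalized) projection onto the weight space. -/
noncomputable def weightProj (n : ℤ) (ξ : H) : H :=
  ∫ t in (0 : ℝ)..2 * Real.pi, Complex.exp (-(Complex.I * n * t)) • (N.U (rot t) : H →L[ℂ] H) ξ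

lemma rot_two_pi_add (t : ℝ) : rot (t + 2 * Real.pi) = rot t :=
  mob_ext fun z => congrArg (· * z) (Circle.periodic_exp t)

lemma exp_int_periodic (n : ℤ) (t : ℝ) :
    Complex.exp (-(Complex.I * n * ((t + 2 * Real.pi : ℝ) : ℂ)))
      = Complex.exp (-(Complex.I * n * t)) := by
  rw [Complex.exp_eq_exp_iff_exists_int]
  exact ⟨-n, by push_cast; ring⟩

lemma continuous_weight (n : ℤ) (ξ : H) : Continuous fun t : ℝ =>
    Complex.exp (-(Complex.I * n * t)) • (N.U (rot t) : H →L[ℂ] H) ξ :=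
  (by fun_prop : Continuous fun t : ℝ => Complex.exp (-(Complex.I * n * t))).smul
    ((N.strongly_continuous ξ).comp continuous_rot)

lemma weightProj_mem (n : ℤ) (ξ : H) : N.weightProj n ξ ∈ N.weightSpace n := by
  intro s
  set F : ℝ → H := fun t =>
    Complex.exp (-(Complex.I * n * t)) • (N.U (rot t) : H →L[ℂ] H) ξ with hF
  have hper : Function.Periodic F (2 * Real.pi) := fun t => by
    rw [hF]
    simp only
    rw [exp_int_periodic, rot_two_pi_add]
  have h1 : ∀ t : ℝ, (N.U (rot s) : H →L[ℂ] H) (F t) = Complex.exp (Complex.I * n * s) • F (t + s) :=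
    fun t => by
      rw [hF]
      simp only
      rw [map_smul, smul_smul, ← U_mul_apply, ← rot_add, ← Complex.exp_add, add_comm s t]
      congr 2
      push_cast
      ring
  rw [weightProj, ← ContinuousLinearMap.intervalIntegral_comp_comm _
    ((N.continuous_weight n ξ).intervalIntegrable _ _)]
  refine (intervalIntegral.integral_congr fun t _ => h1 t).trans ?_
  rw [intervalIntegral.integral_smul, intervalIntegral.integral_comp_add_right F s, zero_add,
    add_comm (2 * Real.pi) s, hper.intervalIntegral_add_eq s 0, zero_add]

lemma eq_zero_of_forall_weightProj {ψ : H} (h : ∀ n, inner ℂ ψ (N.weightProj n ψ) = 0) :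
    ψ = 0 := by
  have : Fact (0 < 2 * Real.pi) := ⟨Real.two_pi_pos⟩
  set g : ℝ → ℂ := fun t => inner ℂ ψ ((N.U (rot t) : H →L[ℂ] H) ψ) with hg
  have hper : Function.Periodic g (2 * Real.pi) := fun t => by
    simp only [hg, rot_two_pi_add]
  have hcont : Continuous g := N.continuous_inner_U continuous_rot ψ ψ
  let f : C(AddCircle (2 * Real.pi), ℂ) := ⟨hper.lift,
    (QuotientAddGroup.isQuotientMap_mk _).continuous_iff.2 hcont⟩
  have hcoeff : fourierCoeff (f : AddCircle (2 * Real.pi) → ℂ) = 0 := by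
    funext n
    rw [fourierCoeff_eq_intervalIntegral _ n 0, zero_add]
    have h2 := h n
    rw [weightProj, ← innerSL_apply_apply ℂ, ← ContinuousLinearMap.intervalIntegral_comp_comm _
      ((N.continuous_weight n ψ).intervalIntegrable _ _)] at h2
    rw [Pi.zero_apply, smul_eq_zero]
    right
    rw [← h2]
    refine intervalIntegral.integral_congr fun t _ => ?_
    change fourier (-n) (t : AddCircle (2 * Real.pi)) • g t = _
    rw [fourier_coe_apply, innerSL_apply_apply, inner_smul_right, smul_eq_mul]
    congr 2
    push_cast
    have : (Real.pi : ℂ) ≠ 0 := by exact_mod_cast Real.pi_ne_zero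
    field_simp
  have hs := hasSum_fourier_series_of_summable (f := f) (by rw [hcoeff]; exact summable_zero)
  simp only [hcoeff, Pi.zero_apply, zero_smul] at hs
  have hf : f = 0 := hs.unique hasSum_zero
  have h0 : f ((0 : ℝ) : AddCircle (2 * Real.pi)) = 0 := by rw [hf]; rfl
  change inner ℂ ψ ((N.U (rot 0) : H →L[ℂ] H) ψ) = 0 at h0
  have hr : rot 0 = 1 := mob_ext fun z => by
    change Circle.exp 0 * z = z
    simp
  rwa [hr, U_one_apply, inner_self_eq_zero] at h0

lemma dense_weightSpace :
    (⨆ n : ℕ, N.weightSpace n).topologicalClosure = ⊤ := by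
  rw [Submodule.topologicalClosure_eq_top_iff, Submodule.eq_bot_iff]
  intro ψ hψ
  refine N.eq_zero_of_forall_weightProj fun n => ?_
  by_cases h0 : N.weightProj n ψ = 0
  · rw [h0, inner_zero_right]
  · have hn := N.weight_nonneg (N.weightProj_mem n ψ) h0
    lift n to ℕ using hn
    exact Submodule.inner_left_of_mem_orthogonal
      (le_iSup (fun n : ℕ => N.weightSpace n) n (N.weightProj_mem n ψ)) hψ

lemma isHardy_rot {a : ℝ} (ha : 0 ≤ a) (ξ η : H) :
    IsHardy fun t => inner ℂ ξ ((N.U (rot (a * t)) : H →L[ℂ] H) η) := by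
  have hcont : ∀ ζ : H, Continuous fun t : ℝ => inner ℂ ξ ((N.U (rot (a * t)) : H →L[ℂ] H) ζ) :=
    fun ζ => N.continuous_inner_U (continuous_rot.comp (by fun_prop)) ξ ζ
  have hspan : ∀ ζ ∈ ⨆ n : ℕ, N.weightSpace n,
      IsHardy fun t => inner ℂ ξ ((N.U (rot (a * t)) : H →L[ℂ] H) ζ) := by
    intro ζ hζ
    induction hζ using Submodule.iSup_induction' with
    | mem n ζ hζ =>
      intro z z' hz hz'
      have h1 := isHardy_exp (s := n * a) (by positivity) z z' hz hz'
      rw [← mul_zero (inner ℂ ξ ζ), ← h1, ← integral_const_mul]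
      refine integral_congr_ae (.of_forall fun t => ?_)
      simp only
      rw [hζ, inner_smul_right, ← mul_assoc, mul_comm (inner ℂ ξ ζ)]
      congr 3
      push_cast
      ring
    | zero => intro z z' _ _; simp
    | add ζ ζ' _ _ h h' =>
      intro z z' hz hz'
      refine Eq.trans ?_ ((congrArg₂ (· + ·) (h z z' hz hz') (h' z z' hz hz')).trans (add_zero 0))
      rw [← integral_add
        (integrable_mul_cauchyDiff (hcont ζ) (fun t => N.norm_inner_U_le _ _ _) hz.ne hz'.ne)
        (integrable_mul_cauchyDiff (hcont ζ') (fun t => N.norm_inner_U_le _ _ _) hz.ne hz'.ne)]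
      refine integral_congr_ae (.of_forall fun t => ?_)
      simp only [map_add, inner_add_right, add_mul]
  have hη : η ∈ closure ((⨆ n : ℕ, N.weightSpace n : Submodule ℂ H) : Set H) := by
    rw [← Submodule.topologicalClosure_coe, N.dense_weightSpace]; trivial
  obtain ⟨s, hs, hlim⟩ := mem_closure_iff_seq_limit.1 hη
  obtain ⟨B, hB⟩ := hlim.norm.bddAbove_range
  refine IsHardy.of_tendsto (C := ‖ξ‖ * B) (fun n => hcont (s n)) (fun n t => ?_)
    (fun n => hspan _ (hs n)) fun t => ?_
  · exact (N.norm_inner_U_le _ _ _).trans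
      (mul_le_mul_of_nonneg_left (hB ⟨n, rfl⟩) (norm_nonneg _))
  · exact tendsto_const_nhds.inner (((N.U (rot (a * t)) : H →L[ℂ] H).continuous.tendsto η).comp hlim)

lemma sinc_mul (x : ℝ) : Real.sinc x * x = Real.sin x := by
  by_cases hx : x = 0
  · simp [hx]
  · rw [Real.sinc_of_ne_zero hx, div_mul_cancel₀ _ hx]

/-- Conjugates of rotations that converge to a translation. -/
noncomputable def dilatedRot (t s : ℝ) : Mob :=
  J (Real.cos (s ^ 2 * t)) (t * Real.sinc (s ^ 2 * t)) (-(s ^ 4 * (t * Real.sinc (s ^ 2 * t))))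
    (Real.cos (s ^ 2 * t)) (by
      have h1 := sinc_mul (s ^ 2 * t)
      have h2 := Real.sin_sq_add_cos_sq (s ^ 2 * t)
      rw [← h1] at h2
      linear_combination h2)

lemma dilatedRot_eq (t : ℝ) {s : ℝ} (hs : s ≠ 0) :
    dilatedRot t s = (D s hs)⁻¹ * rot (2 * s ^ 2 * t) * D s hs := by
  have h1 := sinc_mul (s ^ 2 * t)
  rw [rot_eq_J, D_inv, D, D, J_mul, J_mul]
  apply J_congr
  · rw [show 2 * s ^ 2 * t / 2 = s ^ 2 * t by ring]; field_simp; ring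
  · rw [show 2 * s ^ 2 * t / 2 = s ^ 2 * t by ring, ← h1]; field_simp; ring
  · rw [show 2 * s ^ 2 * t / 2 = s ^ 2 * t by ring, ← h1]; field_simp; ring
  · rw [show 2 * s ^ 2 * t / 2 = s ^ 2 * t by ring]; field_simp; ring

lemma continuousAt_dilatedRot (t : ℝ) : ContinuousAt (dilatedRot t) 0 := by
  have := Real.continuous_sinc
  exact continuousAt_J _ (by fun_prop) (by fun_prop) (by fun_prop) (by fun_prop)

lemma dilatedRot_zero (t : ℝ) : dilatedRot t 0 = T t := by
  rw [dilatedRot, T]; apply J_congr <;> simp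

/-- Positivity of the generator of the translations. -/
lemma isHardy_T (ξ η : H) : IsHardy fun t => inner ℂ ξ ((N.U (T t) : H →L[ℂ] H) η) := by
  have hs : ∀ n : ℕ, (1 / ((n : ℝ) + 1)) ≠ 0 := fun n => by positivity
  have heq : ∀ (n : ℕ) (t : ℝ), inner ℂ ξ ((N.U (dilatedRot t (1 / ((n : ℝ) + 1))) : H →L[ℂ] H) η)
      = inner ℂ ((N.U (D _ (hs n)) : H →L[ℂ] H) ξ)
        ((N.U (rot (2 * (1 / ((n : ℝ) + 1)) ^ 2 * t)) : H →L[ℂ] H)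
          ((N.U (D _ (hs n)) : H →L[ℂ] H) η)) := fun n t => by
    rw [dilatedRot_eq t (hs n), U_mul_apply, U_mul_apply, ← inner_U_inv, inv_inv]
  refine IsHardy.of_tendsto (F := fun n t =>
    inner ℂ ξ ((N.U (dilatedRot t (1 / ((n : ℝ) + 1))) : H →L[ℂ] H) η)) (C := ‖ξ‖ * ‖η‖)
    (fun n => ?_) (fun n t => N.norm_inner_U_le _ _ _) (fun n => ?_) fun t => ?_
  · simp only [heq]
    exact N.continuous_inner_U (continuous_rot.comp (by fun_prop)) _ _
  · simp only [heq]
    exact N.isHardy_rot (by positivity) _ _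
  · have h1 := (continuousAt_dilatedRot t).tendsto.comp tendsto_one_div_add_atTop_nhds_zero_nat
    rw [dilatedRot_zero] at h1
    exact tendsto_const_nhds.inner (((N.strongly_continuous η).tendsto _).comp h1)

end MobiusCovariantNet

end CircleNet

namespace CircleNet

open Filter Topology MeasureTheory

/-! ### Arcs -/

lemma re_mul_inv (z p : Circle) : ((z * p⁻¹ : Circle) : ℂ).re
    = (z : ℂ).re * (p : ℂ).re + (z : ℂ).im * (p : ℂ).im := by
  rw [Circle.coe_mul, Circle.coe_inv_eq_conj, Complex.mul_re, Complex.conj_re, Complex.conj_im]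
  ring

lemma continuous_re_mul_inv (p : Circle) :
    Continuous fun z : Circle => ((z * p⁻¹ : Circle) : ℂ).re :=
  Complex.continuous_re.comp (contMDiff_circle_coe.continuous.comp (continuous_id.mul continuous_const))

/-- The arc with midpoint `p` cut out by `Re (z p⁻¹) > c`. -/
noncomputable def cap (p : Circle) (c : ℝ) (hc : -1 < c) (hc' : c < 1) : Interval where
  carrier := {z | c < ((z * p⁻¹ : Circle) : ℂ).re}
  isOpen := isOpen_lt continuous_const (continuous_re_mul_inv p)
  isConnected := by
    have h0 : 0 < Real.arccos c := Real.arccos_pos.2 hc'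
    have h : {z : Circle | c < ((z * p⁻¹ : Circle) : ℂ).re}
        = (fun θ : ℝ => Circle.exp θ * p) '' Set.Ioo (-Real.arccos c) (Real.arccos c) := by
      ext z
      constructor
      · intro (hz : c < ((z * p⁻¹ : Circle) : ℂ).re)
        refine ⟨Complex.arg (z * p⁻¹ : Circle), ?_, by
          simp only [Circle.exp_arg, inv_mul_cancel_right]⟩
        rw [← Circle.exp_arg (z * p⁻¹), Circle.coe_exp, Complex.exp_ofReal_mul_I_re] at hz
        rw [Set.mem_Ioo, ← abs_lt]
        set x := Complex.arg (z * p⁻¹ : Circle)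
        rw [← Real.cos_abs] at hz
        have hx : |x| ≤ Real.pi := Complex.abs_arg_le_pi _
        rw [← Real.arccos_cos (abs_nonneg x) hx]
        exact Real.strictAntiOn_arccos ⟨hc.le, hc'.le⟩ (Real.cos_mem_Icc _) hz
      · rintro ⟨θ, hθ, rfl⟩
        change c < ((Circle.exp θ * p * p⁻¹ : Circle) : ℂ).re
        rw [mul_inv_cancel_right, Circle.coe_exp, Complex.exp_ofReal_mul_I_re, ← Real.cos_abs]
        have h1 : |θ| < Real.arccos c := abs_lt.2 hθ
        have h2 := Real.strictAntiOn_cos ⟨abs_nonneg θ, h1.le.trans (Real.arccos_le_pi c)⟩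
          ⟨h0.le, Real.arccos_le_pi c⟩ h1
        rwa [Real.cos_arccos hc.le hc'.le] at h2
    rw [h]
    refine (isConnected_Ioo (by linarith)).image _ (Continuous.continuousOn ?_)
    exact Circle.exp.continuous.mul continuous_const
  not_dense := fun hd => by
    have ho : IsOpen {z : Circle | ((z * p⁻¹ : Circle) : ℂ).re < c} :=
      isOpen_lt (continuous_re_mul_inv p) continuous_const
    obtain ⟨z, hz, hz'⟩ := hd.inter_open_nonempty _ ho ⟨-p, by
      change ((-p * p⁻¹ : Circle) : ℂ).re < c
      rw [neg_mul, mul_inv_cancel]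
      simpa using hc⟩
    exact lt_asymm (show ((z * p⁻¹ : Circle) : ℂ).re < c from hz) hz'

lemma mem_cap {p : Circle} {c : ℝ} {hc : -1 < c} {hc' : c < 1} {z : Circle} :
    z ∈ (cap p c hc hc').carrier ↔ c < (z : ℂ).re * (p : ℂ).re + (z : ℂ).im * (p : ℂ).im := by
  rw [← re_mul_inv]; rfl

/-- The point `i` of the circle. -/
noncomputable def ptI : Circle := ⟨Complex.I, by simp [Submonoid.unitSphere]⟩

/-- The upper half-circle. -/
noncomputable def upper : Interval := cap ptI 0 (by norm_num) (by norm_num)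

lemma mem_upper {z : Circle} : z ∈ upper.carrier ↔ 0 < (z : ℂ).im := by
  rw [upper, mem_cap]
  simp [ptI]

lemma ne_neg_one_of_mem_upper {z : Circle} (hz : z ∈ upper.carrier) : z ≠ -1 := by
  rintro rfl
  rw [mem_upper] at hz
  simp at hz

lemma pt_mem_upper {t : ℝ} : pt t ∈ upper.carrier ↔ 0 < t := by
  rw [mem_upper, im_pt, lt_div_iff₀ (by positivity)]
  simp

lemma forall_mem_upper {P : Circle → Prop} (h : ∀ t : ℝ, 0 < t → P (pt t)) :
    ∀ z ∈ upper.carrier, P z := fun z hz => by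
  have h1 := pt_tt (ne_neg_one_of_mem_upper hz)
  have h2 := h (tt z) (pt_mem_upper.1 (h1.symm ▸ hz))
  rwa [h1] at h2

lemma map_upper_subset_T {a : ℝ} (ha : 0 ≤ a) : (upper.map (T a).1).carrier ⊆ upper.carrier := by
  rintro _ ⟨z, hz, rfl⟩
  refine forall_mem_upper (P := fun z => (T a).1.1 z ∈ upper.carrier) (fun t ht => ?_) z hz
  rw [T_pt, pt_mem_upper]
  linarith

lemma map_upper_subset_S {a : ℝ} (ha : 0 ≤ a) : (upper.map (S a).1).carrier ⊆ upper.carrier := by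
  rintro _ ⟨z, hz, rfl⟩
  refine forall_mem_upper (P := fun z => (S a).1.1 z ∈ upper.carrier) (fun t ht => ?_) z hz
  have : 0 < a * t + 1 := by positivity
  rw [S, J_pt _ this.ne', pt_mem_upper]
  simp only [one_mul, add_zero]
  positivity

lemma interval_ext {I K : Interval} (h : I.carrier = K.carrier) : I = K := by
  cases I; cases K; simp only at h; subst h; rfl

lemma map_mul (γ δ : DiffPlus) (I : Interval) : I.map (γ * δ) = (I.map δ).map γ := by
  apply interval_ext
  change (γ * δ).1 '' I.carrier = γ.1 '' (δ.1 '' I.carrier)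
  rw [Set.image_image]
  rfl

lemma map_one (I : Interval) : I.map 1 = I := by
  apply interval_ext
  change (1 : DiffPlus).1 '' I.carrier = I.carrier
  exact Set.image_id' _

/-- The dilation with fixed points `±i`. -/
noncomputable def boost (x : ℝ) : Mob :=
  J (Real.cosh x) (Real.sinh x) (Real.sinh x) (Real.cosh x) (by
    nlinarith [Real.cosh_sq x])

lemma im_boost (x : ℝ) (z : Circle) : ((boost x).1.1 z : ℂ).im
    = (Real.cosh (2 * x) * (z : ℂ).im + Real.sinh (2 * x))
      / (Real.cosh (2 * x) + Real.sinh (2 * x) * (z : ℂ).im) := by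
  have h := circle_re_sq_add_im_sq z
  rw [boost, J, mkMob_apply]
  rw [Complex.div_im, Real.cosh_two_mul, Real.sinh_two_mul, ← sub_div]
  have hn : Complex.normSq ((starRingEnd ℂ)
      (⟨(Real.cosh x - Real.cosh x) / 2, (Real.sinh x + Real.sinh x) / 2⟩ : ℂ) * (z : ℂ)
      + (starRingEnd ℂ) ⟨(Real.cosh x + Real.cosh x) / 2, (Real.sinh x - Real.sinh x) / 2⟩)
      = Real.cosh x ^ 2 + Real.sinh x ^ 2 + 2 * Real.sinh x * Real.cosh x * (z : ℂ).im := by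
    rw [Complex.normSq_apply]
    simp
    linear_combination Real.sinh x ^ 2 * h
  rw [hn]
  congr 1
  simp
  linear_combination Real.sinh x * Real.cosh x * h

lemma exists_map_upper_eq_cap (p : Circle) (c : ℝ) (hc : -1 < c) (hc' : c < 1) :
    ∃ g : Mob, upper.map g.1 = cap p c hc hc' := by
  set x := Real.artanh c / 2 with hx
  have htanh : Real.sinh (2 * x) = c * Real.cosh (2 * x) := by
    have h1 : Real.tanh (2 * x) = c := by
      rw [hx, mul_div_cancel₀ _ two_ne_zero, Real.tanh_artanh ⟨hc, hc'⟩]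
    rw [← h1, Real.tanh_eq_sinh_div_cosh, div_mul_cancel₀ _ (Real.cosh_pos _).ne']
  have hC := Real.cosh_pos (2 * x)
  set θ := Complex.arg (p * ptI⁻¹ : Circle)
  refine ⟨rot θ * boost x, interval_ext ?_⟩
  ext w
  obtain ⟨z, rfl⟩ := (rot θ * boost x).1.1.surjective w
  have h1 : (rot θ * boost x).1.1 z ∈ (upper.map (rot θ * boost x).1).carrier
      ↔ z ∈ upper.carrier := (rot θ * boost x).1.1.injective.mem_set_image
  rw [h1, mem_upper]
  have h2 : ((rot θ * boost x).1.1 z * p⁻¹ : Circle) = (boost x).1.1 z * ptI⁻¹ := by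
    change Circle.exp θ * (boost x).1.1 z * p⁻¹ = _
    rw [Circle.exp_arg]
    rw [mul_comm p, mul_assoc, mul_comm _ p⁻¹, ← mul_assoc, mul_assoc ptI⁻¹, mul_comm p, 
      mul_assoc, mul_comm]
    group
  change _ ↔ c < (((rot θ * boost x).1.1 z * p⁻¹ : Circle) : ℂ).re
  rw [h2, re_mul_inv]
  have h3 : ((boost x).1.1 z : ℂ).re * (ptI : ℂ).re + ((boost x).1.1 z : ℂ).im * (ptI : ℂ).im
      = ((boost x).1.1 z : ℂ).im := by simp [ptI]
  have hy : (z : ℂ).im ^ 2 ≤ 1 := by nlinarith [circle_re_sq_add_im_sq z, sq_nonneg (z : ℂ).re]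
  have hy1 : -1 ≤ (z : ℂ).im := by nlinarith
  have hy2 : (z : ℂ).im ≤ 1 := by nlinarith
  have hden : 0 < 1 + c * (z : ℂ).im := by
    have h1 : |c * (z : ℂ).im| < 1 := by
      rw [abs_mul]
      exact (mul_le_of_le_one_right (abs_nonneg c) (abs_le.2 ⟨hy1, hy2⟩)).trans_lt
        (abs_lt.2 ⟨hc, hc'⟩)
    linarith [(abs_lt.1 h1).1]
  rw [h3, im_boost, htanh, lt_div_iff₀ (by nlinarith)]
  have h4 : Real.cosh (2 * x) * (z : ℂ).im + c * Real.cosh (2 * x)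
      - c * (Real.cosh (2 * x) + c * Real.cosh (2 * x) * (z : ℂ).im)
      = Real.cosh (2 * x) * (1 - c ^ 2) * (z : ℂ).im := by ring
  have hpos : 0 < Real.cosh (2 * x) * (1 - c ^ 2) := mul_pos hC (by nlinarith)
  rw [← sub_pos (b := c * _), h4]
  exact (mul_pos_iff_of_pos_left hpos).symm

lemma dist_sq_eq (z p : Circle) : dist z p ^ 2 = 2 - 2 * ((z * p⁻¹ : Circle) : ℂ).re := by
  rw [re_mul_inv]
  change dist (z : ℂ) (p : ℂ) ^ 2 = _
  rw [dist_eq_norm, ← Complex.normSq_eq_norm_sq, Complex.normSq_apply]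
  have h1 := circle_re_sq_add_im_sq z
  have h2 := circle_re_sq_add_im_sq p
  simp only [Complex.sub_re, Complex.sub_im]
  nlinarith

lemma exists_ball_iff (p : Circle) {r : ℝ} (hr : 0 < r) : ∃ c : ℝ, -1 < c ∧ c < 1 ∧
    ∀ z : Circle, c < ((z * p⁻¹ : Circle) : ℂ).re → z ∈ Metric.ball p r := by
  refine ⟨1 - min r 1 ^ 2 / 2, ?_, ?_, fun z hz => ?_⟩
  · have : min r 1 ≤ 1 := min_le_right _ _
    have : 0 < min r 1 := lt_min hr one_pos
    nlinarith
  · have : 0 < min r 1 := lt_min hr one_pos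
    nlinarith
  · have h := dist_sq_eq z p
    rw [Metric.mem_ball]
    refine lt_of_lt_of_le ?_ (min_le_left r 1)
    exact lt_of_pow_lt_pow_left₀ 2 (lt_min hr one_pos).le (by linarith)

lemma exists_map_upper_subset (I : Interval) :
    ∃ g : Mob, (upper.map g.1).carrier ⊆ I.carrier := by
  obtain ⟨p, hp⟩ := I.isConnected.nonempty
  obtain ⟨r, hr, hball⟩ := Metric.isOpen_iff.1 I.isOpen p hp
  obtain ⟨c, hc, hc', h⟩ := exists_ball_iff p hr
  obtain ⟨g, hg⟩ := exists_map_upper_eq_cap p c hc hc'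
  exact ⟨g, by rw [hg]; exact fun z hz => hball (h z hz)⟩

lemma exists_subset_map_upper (I : Interval) :
    ∃ g : Mob, I.carrier ⊆ (upper.map g.1).carrier := by
  obtain ⟨p, hp⟩ : ∃ p, p ∉ closure I.carrier := by
    by_contra! h
    exact I.not_dense h
  obtain ⟨r, hr, hball⟩ := Metric.isOpen_iff.1 isClosed_closure.isOpen_compl p hp
  obtain ⟨c, hc, hc', h⟩ := exists_ball_iff p hr
  obtain ⟨g, hg⟩ := exists_map_upper_eq_cap (-p) (-(c + 1) / 2) (by linarith) (by linarith)
  refine ⟨g, ?_⟩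
  rw [hg]
  intro z hz
  by_contra hlt
  refine hball (h z ?_) (subset_closure hz)
  have h1 : ¬ (-(c + 1) / 2 < ((z * (-p)⁻¹ : Circle) : ℂ).re) := hlt
  have h2 : ((z * (-p)⁻¹ : Circle) : ℂ).re = -((z * p⁻¹ : Circle) : ℂ).re := by
    rw [re_mul_inv, re_mul_inv]; simp; ring
  rw [h2] at h1
  linarith

/-! ### The Reeh–Schlieder property -/

variable {H : Type*} [NormedAddCommGroup H] [InnerProductSpace ℂ H] [CompleteSpace H]

namespace MobiusCovariantNet

variable (N : MobiusCovariantNet H)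

/-- The space of vectors `x Ω`, where `x` is an element of the local algebra. -/
noncomputable def vac (I : Interval) : Submodule ℂ H :=
  (Subalgebra.toSubmodule (N.algebra I).toStarSubalgebra.toSubalgebra).map
    (ContinuousLinearMap.apply ℂ H N.Ω : (H →L[ℂ] H) →ₗ[ℂ] H)

lemma mem_vac {I : Interval} {ξ : H} : ξ ∈ N.vac I ↔ ∃ x ∈ N.algebra I, x N.Ω = ξ := Iff.rfl

lemma U_vacuum_inv (g : Mob) : star (N.U g : H →L[ℂ] H) N.Ω = N.Ω := by
  rw [unitary_star_eq, ← MonoidHom.map_inv, N.vacuum_invariant]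

lemma conj_mem {g : Mob} {I : Interval} {x : H →L[ℂ] H} (hx : x ∈ N.algebra I) :
    (N.U g : H →L[ℂ] H) * x * star (N.U g : H →L[ℂ] H) ∈ N.algebra (I.map g.1) := by
  have : _ ∈ (N.algebra (I.map g.1) : Set (H →L[ℂ] H)) :=
    (N.covariance g I).subset (Set.mem_image_of_mem _ hx)
  exact this

lemma U_mem_vac {g : Mob} {I : Interval} {ξ : H} (hξ : ξ ∈ N.vac I) :
    (N.U g : H →L[ℂ] H) ξ ∈ N.vac (I.map g.1) := by
  obtain ⟨x, hx, rfl⟩ := N.mem_vac.1 hξ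
  refine N.mem_vac.2 ⟨_, N.conj_mem (g := g) hx, ?_⟩
  change (N.U g : H →L[ℂ] H) (x (star (N.U g : H →L[ℂ] H) N.Ω)) = _
  rw [U_vacuum_inv]

lemma vac_mono {I K : Interval} (h : I.carrier ⊆ K.carrier) : N.vac I ≤ N.vac K :=
  Submodule.map_mono fun _ hx => N.isotony I K h hx

lemma vacuum_mem_vac (I : Interval) : N.Ω ∈ N.vac I :=
  N.mem_vac.2 ⟨1, one_mem _, rfl⟩

lemma mem_topologicalClosure_of_forall {K : Submodule ℂ H} {ξ : H}
    (h : ∀ ψ ∈ Kᗮ, inner ℂ ψ ξ = 0) : ξ ∈ K.topologicalClosure := by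
  rw [← Submodule.orthogonal_orthogonal_eq_closure]
  exact (Submodule.mem_orthogonal _ _).2 h

lemma maps_closure {K : Submodule ℂ H} {L : Submodule ℂ H} {x : H →L[ℂ] H}
    (h : ∀ ξ ∈ K, x ξ ∈ L.topologicalClosure) {ξ : H} (hξ : ξ ∈ K.topologicalClosure) :
    x ξ ∈ L.topologicalClosure := by
  have h1 : K ≤ L.topologicalClosure.comap (x : H →ₗ[ℂ] H) := h
  exact Submodule.topologicalClosure_minimal K h1
    (L.isClosed_topologicalClosure.preimage x.continuous) hξ

lemma eq_zero_of_half_line {ψ ξ : H}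
    (h : ∀ a : ℝ, 0 ≤ a → inner ℂ ψ ((N.U (T a) : H →L[ℂ] H) ξ) = 0) (a : ℝ) :
    inner ℂ ψ ((N.U (T a) : H →L[ℂ] H) ξ) = 0 :=
  (N.isHardy_T ψ ξ).eq_zero (N.continuous_inner_U continuous_T ψ ξ)
    (fun _ => N.norm_inner_U_le _ _ _) h a

lemma U_T_vac_upper (a : ℝ) {ξ : H} (hξ : ξ ∈ N.vac upper) :
    (N.U (T a) : H →L[ℂ] H) ξ ∈ (N.vac upper).topologicalClosure :=
  mem_topologicalClosure_of_forall fun _ hψ => N.eq_zero_of_half_line (fun _ hb =>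
    Submodule.inner_left_of_mem_orthogonal (N.vac_mono (map_upper_subset_T hb) (N.U_mem_vac hξ))
      hψ) a

lemma S_eq_conj (a : ℝ) : S a = rot Real.pi * T (-a) * (rot Real.pi)⁻¹ := by
  have h : rot Real.pi = J 0 1 (-1) 0 (by norm_num) := by
    rw [rot_eq_J]; apply J_congr <;> simp
  rw [eq_mul_inv_iff_mul_eq, h, S, T, J_mul, J_mul]
  apply J_congr <;> simp

lemma U_S_vac_upper (a : ℝ) {ξ : H} (hξ : ξ ∈ N.vac upper) :
    (N.U (S a) : H →L[ℂ] H) ξ ∈ (N.vac upper).topologicalClosure := by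
  refine mem_topologicalClosure_of_forall fun ψ hψ => ?_
  have key : ∀ b : ℝ, inner ℂ ψ ((N.U (S b) : H →L[ℂ] H) ξ)
      = conj (inner ℂ ((N.U (rot Real.pi)⁻¹ : H →L[ℂ] H) ξ)
        ((N.U (T b) : H →L[ℂ] H) ((N.U (rot Real.pi)⁻¹ : H →L[ℂ] H) ψ))) := fun b => by
    rw [inner_conj_symm, S_eq_conj, U_mul_apply, U_mul_apply, T_neg, ← inner_U_inv, ← inner_U_inv, inv_inv]
  rw [key, N.eq_zero_of_half_line (fun b hb => ?_) a, _root_.map_zero]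
  rw [← map_eq_zero (starRingEnd ℂ), ← key]
  exact Submodule.inner_left_of_mem_orthogonal
    (N.vac_mono (map_upper_subset_S hb) (N.U_mem_vac hξ)) hψ

lemma U_vac_upper (g : Mob) {ξ : H} (hξ : ξ ∈ (N.vac upper).topologicalClosure) :
    (N.U g : H →L[ℂ] H) ξ ∈ (N.vac upper).topologicalClosure := by
  let G : Submonoid Mob :=
    { carrier := {g | ∀ ξ ∈ (N.vac upper).topologicalClosure,
        (N.U g : H →L[ℂ] H) ξ ∈ (N.vac upper).topologicalClosure}
      mul_mem' := fun {g h} hg hh ξ hξ => by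
        rw [U_mul_apply]; exact hg _ (hh _ hξ)
      one_mem' := fun ξ hξ => by rwa [U_one_apply] }
  exact closure_T_S (G := G) (fun w ξ hξ => maps_closure (fun _ => N.U_T_vac_upper w) hξ)
    (fun w ξ hξ => maps_closure (fun _ => N.U_S_vac_upper w) hξ) g ξ hξ

lemma closure_vac_map_upper (g : Mob) :
    (N.vac (upper.map g.1)).topologicalClosure = (N.vac upper).topologicalClosure := by
  apply le_antisymm
  · refine Submodule.topologicalClosure_minimal _ (fun ξ hξ => ?_)
      (Submodule.isClosed_topologicalClosure _)
    have h1 := N.U_mem_vac (g := g⁻¹) hξ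
    rw [← map_mul, show (g⁻¹).1 * g.1 = 1 from inv_mul_cancel g.1, map_one] at h1
    have h2 := N.U_vac_upper g (Submodule.le_topologicalClosure _ h1)
    rwa [← U_mul_apply, mul_inv_cancel, U_one_apply] at h2
  · refine Submodule.topologicalClosure_minimal _ (fun ξ hξ => ?_)
      (Submodule.isClosed_topologicalClosure _)
    have h1 := N.U_vac_upper g⁻¹ (Submodule.le_topologicalClosure _ hξ)
    have h2 := maps_closure (x := (N.U g : H →L[ℂ] H)) (L := N.vac (upper.map g.1))
      (fun η hη => Submodule.le_topologicalClosure _ (N.U_mem_vac hη)) h1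
    rwa [← U_mul_apply, mul_inv_cancel, U_one_apply] at h2

lemma algebra_maps_vac {I : Interval} {x : H →L[ℂ] H} (hx : x ∈ N.algebra I) {ξ : H}
    (hξ : ξ ∈ (N.vac I).topologicalClosure) : x ξ ∈ (N.vac I).topologicalClosure := by
  refine maps_closure (fun η hη => ?_) hξ
  obtain ⟨y, hy, rfl⟩ := N.mem_vac.1 hη
  exact Submodule.le_topologicalClosure _ (N.mem_vac.2 ⟨x * y, mul_mem hx hy, rfl⟩)

lemma closure_vac_upper : (N.vac upper).topologicalClosure = ⊤ := by
  set E := (N.vac upper).topologicalClosure with hE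
  have hEc : IsClosed (E : Set H) := Submodule.isClosed_topologicalClosure _
  have : CompleteSpace E := hEc.completeSpace_coe
  have hinv : ∀ (I : Interval), ∀ x ∈ N.algebra I, ∀ ξ ∈ E, x ξ ∈ E := fun I x hx ξ hξ => by
    obtain ⟨g, hg⟩ := exists_subset_map_upper I
    rw [hE, ← N.closure_vac_map_upper g] at hξ ⊢
    exact N.algebra_maps_vac (N.isotony _ _ hg hx) hξ
  have hP : (E.starProjection : H →L[ℂ] H) ∈ Set.centralizer
      (⋃ I : Interval, (N.algebra I : Set (H →L[ℂ] H))) := by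
    intro x hx
    obtain ⟨I, hx⟩ := Set.mem_iUnion.1 hx
    ext ξ
    change x (E.starProjection ξ) = E.starProjection (x ξ)
    have h1 : x (E.starProjection ξ) ∈ E := hinv I x hx _ (Submodule.starProjection_apply_mem _ _)
    have h2 : x (ξ - E.starProjection ξ) ∈ Eᗮ := by
      rw [Submodule.mem_orthogonal]
      intro e he
      rw [← inner_star_apply]
      exact Submodule.inner_right_of_mem_orthogonal (hinv I _ (star_mem hx) _ he)
        (Submodule.sub_starProjection_mem_orthogonal _)
    refine (Submodule.eq_starProjection_of_mem_of_inner_eq_zero h1 fun w hw => ?_).symm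
    rw [← map_sub]
    exact Submodule.inner_left_of_mem_orthogonal hw h2
  rw [Submodule.eq_top_iff']
  intro ξ
  have hd := N.cyclic ξ
  refine closure_minimal ?_ hEc hd
  rintro _ ⟨x, hx, rfl⟩
  have h1 := congrArg (fun y : H →L[ℂ] H => y N.Ω) (hx _ hP)
  have h2 : E.starProjection N.Ω = N.Ω := Submodule.starProjection_eq_self_iff.2
    (Submodule.le_topologicalClosure _ (N.vacuum_mem_vac _))
  change E.starProjection (x N.Ω) = x (E.starProjection N.Ω) at h1
  rw [h2] at h1
  exact Submodule.starProjection_eq_self_iff.1 h1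

/-- The Reeh–Schlieder property: the vacuum is cyclic for all local algebras. -/
theorem reeh_schlieder (I : Interval) : (N.vac I).topologicalClosure = ⊤ := by
  obtain ⟨g, hg⟩ := exists_map_upper_subset I
  rw [eq_top_iff, ← N.closure_vac_upper, ← N.closure_vac_map_upper g]
  exact Submodule.topologicalClosure_mono (N.vac_mono hg)

end MobiusCovariantNet

end CircleNet

namespace CircleNet

open Filter Topology MeasureTheory

/-! ### Moments of Cauchy integrals -/

lemma integral_mul_inv_sub {d : ℝ → ℂ} (hd : Continuous d) {m : ℕ}
    (hm : ∀ j < m, ∫ t in (-4 : ℝ)..4, d t * (t : ℂ) ^ j = 0) {a : ℝ} (ha : 4 < a) :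
    (a : ℂ) ^ m * ∫ t in (-4 : ℝ)..4, d t * ((t : ℂ) - a)⁻¹
      = ∫ t in (-4 : ℝ)..4, d t * (t : ℂ) ^ m * ((t : ℂ) - a)⁻¹ := by
  have hne : ∀ t ∈ Set.uIcc (-4 : ℝ) 4, (t : ℂ) - a ≠ 0 := fun t ht h0 => by
    rw [Set.uIcc_of_le (by norm_num)] at ht
    rw [sub_eq_zero, Complex.ofReal_inj] at h0
    linarith [ht.2]
  have hcont : ContinuousOn (fun t : ℝ => d t * (t : ℂ) ^ m * ((t : ℂ) - a)⁻¹)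
      (Set.uIcc (-4 : ℝ) 4) :=
    ContinuousOn.mul (by fun_prop) (ContinuousOn.inv₀ (by fun_prop) hne)
  have hsum : ∫ t in (-4 : ℝ)..4, ∑ j ∈ Finset.range m, (a : ℂ) ^ (m - 1 - j) * (d t * (t : ℂ) ^ j)
      = 0 := by
    rw [intervalIntegral.integral_finsetSum fun j _ =>
      (Continuous.intervalIntegrable (by fun_prop) _ _)]
    refine Finset.sum_eq_zero fun j hj => ?_
    rw [intervalIntegral.integral_const_mul, hm j (Finset.mem_range.1 hj), mul_zero]
  rw [← intervalIntegral.integral_const_mul, ← sub_zero (∫ t in (-4 : ℝ)..4, d t * (t : ℂ) ^ m * _),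
    ← hsum, ← intervalIntegral.integral_sub hcont.intervalIntegrable
      (Continuous.intervalIntegrable (by fun_prop) _ _)]
  refine intervalIntegral.integral_congr fun t ht => ?_
  have h1 := geom_sum₂_mul (t : ℂ) a m
  have h2 : ∑ j ∈ Finset.range m, (a : ℂ) ^ (m - 1 - j) * (d t * (t : ℂ) ^ j)
      = d t * ∑ j ∈ Finset.range m, (t : ℂ) ^ j * (a : ℂ) ^ (m - 1 - j) := by
    rw [Finset.mul_sum]
    exact Finset.sum_congr rfl fun j _ => by ring
  have h3 := hne t ht
  rw [h2]
  generalize ∑ j ∈ Finset.range m, (t : ℂ) ^ j * (a : ℂ) ^ (m - 1 - j) = Q at *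
  field_simp
  linear_combination d t * h1

lemma tendsto_moment {d : ℕ → ℝ → ℂ} {d₀ : ℝ → ℂ} (hd : ∀ n, Continuous (d n)) {C : ℝ}
    (hC : ∀ n t, ‖d n t‖ ≤ C) (hlim : ∀ t, Tendsto (fun n => d n t) atTop (𝓝 (d₀ t))) {m : ℕ}
    (hm : ∀ n, ∀ j < m, ∫ t in (-4 : ℝ)..4, d n t * (t : ℂ) ^ j = 0) {a : ℕ → ℝ}
    (ha : Tendsto a atTop atTop) :
    Tendsto (fun n => (a n : ℂ) ^ (m + 1) * ∫ t in (-4 : ℝ)..4, d n t * ((t : ℂ) - a n)⁻¹) atTop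
      (𝓝 (-∫ t in (-4 : ℝ)..4, d₀ t * (t : ℂ) ^ m)) := by
  have hlim' : Tendsto (fun n => ∫ t in (-4 : ℝ)..4,
      d n t * (t : ℂ) ^ m * ((a n : ℂ) * ((t : ℂ) - a n)⁻¹)) atTop
      (𝓝 (∫ t in (-4 : ℝ)..4, d₀ t * (t : ℂ) ^ m * (-1))) := by
    refine intervalIntegral.tendsto_integral_filter_of_dominated_convergence
      (fun _ => C * 4 ^ m * 2) ?_ ?_ intervalIntegrable_const ?_
    · refine .of_forall fun n => ?_
      refine (((hd n).mul (by fun_prop)).aestronglyMeasurable).mul ?_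
      exact (Measurable.const_mul (Measurable.inv (by fun_prop)) _).aestronglyMeasurable
    · filter_upwards [ha.eventually_ge_atTop 8] with n hn
      refine .of_forall fun t ht => ?_
      rw [Set.uIoc_of_le (by norm_num)] at ht
      have ht' : |t| ≤ 4 := abs_le.2 ⟨ht.1.le, ht.2⟩
      rw [norm_mul, norm_mul, norm_mul, norm_pow, norm_inv, Complex.norm_real, Complex.norm_real,
        ← Complex.ofReal_sub, Complex.norm_real, Real.norm_eq_abs, Real.norm_eq_abs,
        Real.norm_eq_abs, abs_of_pos (by linarith : 0 < a n), abs_sub_comm,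
        abs_of_pos (by linarith [ht.2] : 0 < a n - t)]
      have h1 : a n * (a n - t)⁻¹ ≤ 2 := by
        rw [← div_eq_mul_inv, div_le_iff₀ (by linarith [ht.2])]
        linarith [ht.2]
      have h2 : |t| ^ m ≤ 4 ^ m := pow_le_pow_left₀ (abs_nonneg t) ht' m
      have h3 : 0 ≤ C := (norm_nonneg _).trans (hC 0 0)
      have h4 : 0 ≤ a n * (a n - t)⁻¹ :=
        mul_nonneg (by linarith) (inv_nonneg.2 (by linarith [ht.2]))
      exact mul_le_mul (mul_le_mul (hC n t) h2 (by positivity) h3) h1 h4 (by positivity)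
    · refine .of_forall fun t _ => ((hlim t).mul_const _).mul ?_
      have h1 : Tendsto (fun n => ((a n)⁻¹ : ℝ)) atTop (𝓝 0) := tendsto_inv_atTop_zero.comp ha
      have h2 : Tendsto (fun n => (((a n)⁻¹ : ℝ) * (t : ℂ) - 1)⁻¹) atTop (𝓝 ((0 * (t : ℂ) - 1)⁻¹)) := by
        refine Tendsto.inv₀ ?_ (by simp)
        refine (Tendsto.mul_const _ ?_).sub_const 1
        exact_mod_cast (Complex.continuous_ofReal.tendsto 0).comp h1
      rw [zero_mul, zero_sub, inv_neg, inv_one] at h2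
      refine h2.congr' ?_
      filter_upwards [ha.eventually_gt_atTop 0] with n hn
      have hn' : (a n : ℂ) ≠ 0 := by exact_mod_cast hn.ne'
      have h4 : (t : ℂ) - a n = a n * ((a n : ℂ)⁻¹ * t - 1) := by
        rw [mul_sub, mul_inv_cancel_left₀ hn', mul_one]
      rw [h4, mul_inv, mul_inv_cancel_left₀ hn', Complex.ofReal_inv]
  have hneg : ∫ t in (-4 : ℝ)..4, d₀ t * (t : ℂ) ^ m * (-1)
      = -∫ t in (-4 : ℝ)..4, d₀ t * (t : ℂ) ^ m := by
    rw [intervalIntegral.integral_mul_const]; ring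
  rw [hneg] at hlim'
  refine hlim'.congr' ?_
  filter_upwards [ha.eventually_gt_atTop 4] with n hn
  rw [pow_succ', mul_assoc, integral_mul_inv_sub (hd n) (hm n) hn,
    ← intervalIntegral.integral_const_mul]
  refine intervalIntegral.integral_congr fun t _ => ?_
  ring

lemma integral_inv_sub_eq_zero {d : ℝ → ℂ} (hd : Continuous d) {C : ℝ} (hC : ∀ t, ‖d t‖ ≤ C)
    (hm : ∀ j : ℕ, ∫ t in (-4 : ℝ)..4, d t * (t : ℂ) ^ j = 0) {a : ℝ} (ha : 4 < a) :
    ∫ t in (-4 : ℝ)..4, d t * ((t : ℂ) - a)⁻¹ = 0 := by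
  set X := ∫ t in (-4 : ℝ)..4, d t * ((t : ℂ) - a)⁻¹ with hX
  have h3 : 0 ≤ C := (norm_nonneg _).trans (hC 0)
  have hbound : ∀ m : ℕ, ‖X‖ ≤ (4 / a) ^ m * (C * (a - 4)⁻¹ * |4 - (-4)|) := fun m => by
    have h1 := integral_mul_inv_sub hd (m := m) (fun j _ => hm j) ha
    have h2 : ‖∫ t in (-4 : ℝ)..4, d t * (t : ℂ) ^ m * ((t : ℂ) - a)⁻¹‖
        ≤ C * 4 ^ m * (a - 4)⁻¹ * |4 - (-4)| := by
      refine intervalIntegral.norm_integral_le_of_norm_le_const fun t ht => ?_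
      rw [Set.uIoc_of_le (by norm_num)] at ht
      have ht' : |t| ≤ 4 := abs_le.2 ⟨ht.1.le, ht.2⟩
      rw [norm_mul, norm_mul, norm_pow, norm_inv, Complex.norm_real, ← Complex.ofReal_sub,
        Complex.norm_real, Real.norm_eq_abs, Real.norm_eq_abs, abs_sub_comm,
        abs_of_pos (by linarith [ht.2] : 0 < a - t)]
      have h4 : (a - t)⁻¹ ≤ (a - 4)⁻¹ := inv_anti₀ (by linarith) (by linarith [ht.2])
      have h5 : 0 ≤ (a - t)⁻¹ := inv_nonneg.2 (by linarith [ht.2])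
      exact mul_le_mul (mul_le_mul (hC t) (pow_le_pow_left₀ (abs_nonneg t) ht' m) (by positivity) h3)
        h4 h5 (by positivity)
    rw [← h1, norm_mul, norm_pow, Complex.norm_real, Real.norm_of_nonneg (by linarith)] at h2
    have ha0 : 0 < a ^ m := pow_pos (by linarith) m
    rw [div_pow, div_mul_eq_mul_div, le_div_iff₀ ha0]
    linarith
  have hlim : Tendsto (fun m : ℕ => (4 / a) ^ m * (C * (a - 4)⁻¹ * |4 - (-4)|)) atTop
      (𝓝 (0 * (C * (a - 4)⁻¹ * |4 - (-4)|))) :=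
    (tendsto_pow_atTop_nhds_zero_of_lt_one (by positivity)
      ((div_lt_one (by linarith)).2 ha)).mul_const _
  rw [zero_mul] at hlim
  exact norm_le_zero_iff.1 (ge_of_tendsto' hlim hbound)

variable {H : Type*} [NormedAddCommGroup H] [InnerProductSpace ℂ H] [CompleteSpace H]

namespace MobiusCovariantNet

variable (N : MobiusCovariantNet H)

/-! ### Uniqueness of translation invariant vectors -/

lemma fixed_of_inner {g : Mob} {ξ : H}
    (h : inner ℂ ξ ((N.U g : H →L[ℂ] H) ξ) = inner ℂ ξ ξ) : (N.U g : H →L[ℂ] H) ξ = ξ := by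
  have h1 := N.norm_U_apply g ξ
  rw [← sub_eq_zero, ← inner_self_eq_zero (𝕜 := ℂ), inner_sub_sub_self, h,
    ← inner_conj_symm _ ξ, h, inner_conj_symm, inner_self_eq_norm_sq_to_K, inner_self_eq_norm_sq_to_K,
    h1]
  ring

lemma fixed_of_tendsto {g : Mob} {h : ℕ → Mob} {ξ : H} (hh : Tendsto h atTop (𝓝 1))
    (heq : ∀ n, inner ℂ ξ ((N.U (h n) : H →L[ℂ] H) ξ) = inner ℂ ξ ((N.U g : H →L[ℂ] H) ξ)) :
    (N.U g : H →L[ℂ] H) ξ = ξ := by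
  refine N.fixed_of_inner ?_
  have h1 : Tendsto (fun n => inner ℂ ξ ((N.U (h n) : H →L[ℂ] H) ξ)) atTop
      (𝓝 (inner ℂ ξ ((N.U 1 : H →L[ℂ] H) ξ))) :=
    tendsto_const_nhds.inner (((N.strongly_continuous ξ).tendsto _).comp hh)
  simp only [heq, U_one_apply] at h1
  exact tendsto_nhds_unique tendsto_const_nhds h1

lemma inner_U_conj {k g : Mob} {ξ : H} (hk : (N.U k : H →L[ℂ] H) ξ = ξ) :
    inner ℂ ξ ((N.U (k * g * k⁻¹) : H →L[ℂ] H) ξ) = inner ℂ ξ ((N.U g : H →L[ℂ] H) ξ) := by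
  have hk' : (N.U k⁻¹ : H →L[ℂ] H) ξ = ξ := by
    conv_lhs => rw [← hk]
    rw [← U_mul_apply, inv_mul_cancel, U_one_apply]
  rw [U_mul_apply, U_mul_apply, hk', ← inner_U_inv, hk']

/-- A vector which is invariant under a translation is invariant under the Möbius group. -/
lemma fixed_of_translation {ξ : H} (hξ : (N.U (T 1) : H →L[ℂ] H) ξ = ξ) (g : Mob) :
    (N.U g : H →L[ℂ] H) ξ = ξ := by
  have hn : ∀ n : ℕ, (N.U (T n) : H →L[ℂ] H) ξ = ξ := fun n => by
    induction n with
    | zero => rw [Nat.cast_zero, T_zero, U_one_apply]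
    | succ n ih => rw [Nat.cast_succ, T_add, U_mul_apply, hξ, ih]
  have hn' : ∀ n : ℕ, (N.U (T n)⁻¹ : H →L[ℂ] H) ξ = ξ := fun n => by
    conv_lhs => rw [← hn n]
    rw [← U_mul_apply, inv_mul_cancel, U_one_apply]
  have h2 : (2 : ℝ) ≠ 0 := two_ne_zero
  have hD : (N.U (D 2 h2) : H →L[ℂ] H) ξ = ξ := by
    refine N.fixed_of_inner ?_
    have hJ : ∀ c : ℝ, (2 : ℝ) * 2⁻¹ - 0 * c = 1 := fun c => by norm_num
    have hc0 : Tendsto (fun n : ℕ => 1 / ((n : ℝ) + 1) / 2) atTop (𝓝 0) := by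
      simpa using (tendsto_one_div_add_atTop_nhds_zero_nat (𝕜 := ℝ)).div_const 2
    have hc1 : ContinuousAt (fun c : ℝ => J 2 0 c 2⁻¹ (hJ c)) 0 :=
      continuousAt_J _ continuousAt_const continuousAt_const continuousAt_id continuousAt_const
    have l1 := ((N.strongly_continuous ξ).tendsto _).comp (hc1.tendsto.comp hc0)
    have l2 := ((N.strongly_continuous ξ).tendsto _).comp ((continuous_S.tendsto 0).comp hc0)
    rw [S_zero, U_one_apply] at l2
    refine tendsto_nhds_unique ((tendsto_const_nhds (x := ξ)).inner l1)
      (((tendsto_const_nhds (x := ξ)).inner l2).congr fun n => ?_)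
    have h3 : J 2 0 (1 / ((n : ℝ) + 1) / 2) 2⁻¹ (hJ _)
        = T ((2 * (n + 1) : ℕ) : ℝ) * S (1 / ((n : ℝ) + 1) / 2) * (T ((n + 1 : ℕ) : ℝ))⁻¹ := by
      rw [← T_neg, T, T, S, J_mul, J_mul]
      apply J_congr <;> push_cast <;> field_simp <;> ring
    simp only [Function.comp_apply]
    rw [h3, U_mul_apply, U_mul_apply, hn', ← N.inner_U_inv (T ((2 * (n + 1) : ℕ) : ℝ)), hn']
  have hDn : ∀ n : ℕ, (N.U (D 2 h2 ^ n) : H →L[ℂ] H) ξ = ξ := fun n => by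
    induction n with
    | zero => rw [pow_zero, U_one_apply]
    | succ n ih => rw [pow_succ, U_mul_apply, hD, ih]
  have hDn' : ∀ n : ℕ, (N.U (D 2 h2 ^ n)⁻¹ : H →L[ℂ] H) ξ = ξ := fun n => by
    conv_lhs => rw [← hDn n]
    rw [← U_mul_apply, inv_mul_cancel, U_one_apply]
  have hpow : ∀ w : ℝ, Tendsto (fun n : ℕ => w * (4⁻¹ : ℝ) ^ n) atTop (𝓝 0) := fun w => by
    simpa using (tendsto_pow_atTop_nhds_zero_of_lt_one (r := (4⁻¹ : ℝ)) (by norm_num)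
      (by norm_num)).const_mul w
  have hTD : ∀ (w : ℝ) (n : ℕ), (D 2 h2 ^ n)⁻¹ * T w * D 2 h2 ^ n = T (w * 4⁻¹ ^ n) := by
    intro w n
    induction n generalizing w with
    | zero => simp
    | succ n ih =>
      have h4 : (D 2 h2)⁻¹ * T w * D 2 h2 = T (w * 4⁻¹) := by
        rw [mul_assoc, inv_mul_eq_iff_eq_mul, D_mul_T]
        congr 2
        norm_num
        ring
      have : (D 2 h2 ^ (n + 1))⁻¹ * T w * D 2 h2 ^ (n + 1)
          = (D 2 h2 ^ n)⁻¹ * ((D 2 h2)⁻¹ * T w * D 2 h2) * D 2 h2 ^ n := by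
        rw [pow_succ']; group
      rw [this, h4, ih, pow_succ', mul_assoc]
  have hSD : ∀ (w : ℝ) (n : ℕ), D 2 h2 ^ n * S w * (D 2 h2 ^ n)⁻¹ = S (w * 4⁻¹ ^ n) := by
    intro w n
    induction n generalizing w with
    | zero => simp
    | succ n ih =>
      have h4 : D 2 h2 * S w * (D 2 h2)⁻¹ = S (w * 4⁻¹) := by
        rw [mul_inv_eq_iff_eq_mul, D_mul_S]
        congr 2
        norm_num
        ring
      have : D 2 h2 ^ (n + 1) * S w * (D 2 h2 ^ (n + 1))⁻¹
          = D 2 h2 ^ n * (D 2 h2 * S w * (D 2 h2)⁻¹) * (D 2 h2 ^ n)⁻¹ := by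
        rw [pow_succ]; group
      rw [this, h4, ih, pow_succ', mul_assoc]
  have hT : ∀ w, (N.U (T w) : H →L[ℂ] H) ξ = ξ := fun w => by
    refine N.fixed_of_tendsto (h := fun n => T (w * 4⁻¹ ^ n)) ?_ fun n => ?_
    · rw [← T_zero]; exact (continuous_T.tendsto 0).comp (hpow w)
    · have := N.inner_U_conj (g := T w) (hDn' n)
      rwa [inv_inv, hTD] at this
  have hS : ∀ w, (N.U (S w) : H →L[ℂ] H) ξ = ξ := fun w => by
    refine N.fixed_of_tendsto (h := fun n => S (w * 4⁻¹ ^ n)) ?_ fun n => ?_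
    · rw [← S_zero]; exact (continuous_S.tendsto 0).comp (hpow w)
    · have := N.inner_U_conj (g := S w) (hDn n)
      rwa [hSD] at this
  let G : Submonoid Mob :=
    { carrier := {g | (N.U g : H →L[ℂ] H) ξ = ξ}
      mul_mem' := fun {g h} (hg : _ = _) (hh : _ = _) => by
        change _ = _
        rw [U_mul_apply, hh, hg]
      one_mem' := N.U_one_apply ξ }
  exact closure_T_S (G := G) hT hS g

lemma exists_smul_vacuum {ξ : H} (hξ : ∀ g, (N.U g : H →L[ℂ] H) ξ = ξ) :
    ξ = inner ℂ N.Ω ξ • N.Ω := by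
  have h1 : inner ℂ N.Ω N.Ω = (1 : ℂ) := by
    rw [inner_self_eq_norm_sq_to_K, N.norm_vacuum]; simp
  by_cases h0 : ξ = 0
  · simp [h0]
  · have hn : (‖ξ‖ : ℂ) ≠ 0 := by simpa using h0
    obtain ⟨c, hc⟩ := N.vacuum_unique ((‖ξ‖⁻¹ : ℂ) • ξ) (by
      rw [norm_smul, norm_inv, Complex.norm_real, norm_norm, inv_mul_cancel₀ (norm_ne_zero_iff.2 h0)])
      (fun g => by rw [map_smul, hξ])
    rw [inv_smul_eq_iff₀ hn, smul_smul] at hc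
    rw [hc, inner_smul_right, h1, mul_one]

/-- The cluster property of the translations. -/
lemma cluster {ξ η : H} {c : ℂ}
    (h : Tendsto (fun n : ℕ => inner ℂ ξ ((N.U (T n) : H →L[ℂ] H) η)) atTop (𝓝 c)) :
    c = inner ℂ ξ N.Ω * inner ℂ N.Ω η := by
  set u : H →L[ℂ] H := (N.U (T 1) : H →L[ℂ] H) with hu
  have hiter : ∀ (n : ℕ) (ζ : H), u^[n] ζ = (N.U (T n) : H →L[ℂ] H) ζ := fun n ζ => by
    induction n with
    | zero => simp [T_zero]
    | succ n ih => rw [Function.iterate_succ_apply', ih, hu, ← U_mul_apply, ← T_add, Nat.cast_succ,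
        add_comm]
  have hnorm : ‖u‖ ≤ 1 := ContinuousLinearMap.opNorm_le_bound _ zero_le_one fun ζ => by
    rw [one_mul]; exact (N.norm_U_apply _ _).le
  have herg := ContinuousLinearMap.tendsto_birkhoffAverage_orthogonalProjection u hnorm η
  set p : H := (((u : H →ₗ[ℂ] H).eqLocus ((1 : H →L[ℂ] H) : H →ₗ[ℂ] H)).orthogonalProjectionOnto η : H) with hp
  have hpfix : u p = p := (((u : H →ₗ[ℂ] H).eqLocus ((1 : H →L[ℂ] H) : H →ₗ[ℂ] H)).orthogonalProjectionOnto η).2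
  have hbirk : ∀ (ζ : H) (n : ℕ), inner ℂ ζ (birkhoffAverage ℂ u _root_.id n η)
      = (n : ℝ)⁻¹ • ∑ i ∈ Finset.range n, inner ℂ ζ ((N.U (T i) : H →L[ℂ] H) η) := fun ζ n => by
    rw [birkhoffAverage, inner_smul_right, birkhoffSum, inner_sum, Complex.real_smul]
    push_cast
    congr 1
    exact Finset.sum_congr rfl fun i _ => by rw [id, hiter]
  have h1 := (tendsto_const_nhds (x := ξ)).inner (𝕜 := ℂ) herg
  simp only [hbirk] at h1
  have h2 := tendsto_nhds_unique h1 h.cesaro_smul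
  have h3 := (tendsto_const_nhds (x := N.Ω)).inner (𝕜 := ℂ) herg
  simp only [hbirk] at h3
  have h4 : inner ℂ N.Ω p = inner ℂ N.Ω η := by
    refine tendsto_nhds_unique h3 (Tendsto.cesaro_smul (tendsto_const_nhds.congr fun n => ?_))
    rw [← inner_U_inv, N.vacuum_invariant]
  rw [← h2, N.exists_smul_vacuum (N.fixed_of_translation hpfix), inner_smul_right, h4, mul_comm]

end MobiusCovariantNet

end CircleNet

namespace CircleNet

open Filter Topology MeasureTheory

/-! ### Two-point functions -/

/-- The arc `{pt t | t ^ 2 < 3}`. -/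
noncomputable def bigArc : Interval := cap 1 (-1 / 2) (by norm_num) (by norm_num)

/-- The right half-circle `{pt t | t ^ 2 < 1}`. -/
noncomputable def rightArc : Interval := cap 1 0 (by norm_num) (by norm_num)

lemma mem_bigArc {z : Circle} : z ∈ bigArc.carrier ↔ -1 / 2 < (z : ℂ).re := by
  rw [bigArc, mem_cap]; simp

lemma mem_rightArc {z : Circle} : z ∈ rightArc.carrier ↔ 0 < (z : ℂ).re := by
  rw [rightArc, mem_cap]; simp

lemma pt_mem_bigArc {t : ℝ} : pt t ∈ bigArc.carrier ↔ t ^ 2 < 3 := by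
  rw [mem_bigArc, re_pt, div_lt_div_iff₀ two_pos (by positivity)]
  constructor <;> intro h <;> linarith

lemma pt_mem_rightArc {t : ℝ} : pt t ∈ rightArc.carrier ↔ t ^ 2 < 1 := by
  rw [mem_rightArc, re_pt, lt_div_iff₀ (by positivity)]
  constructor <;> intro h <;> linarith

lemma exists_pt_of_mem_bigArc {z : Circle} (hz : z ∈ bigArc.carrier) :
    ∃ t : ℝ, t ^ 2 < 3 ∧ pt t = z := by
  have h1 : z ≠ -1 := by
    rintro rfl
    rw [mem_bigArc] at hz
    norm_num at hz
  refine ⟨tt z, ?_, pt_tt h1⟩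
  rwa [← pt_mem_bigArc, pt_tt h1]

lemma rightArc_subset_bigArc : rightArc.carrier ⊆ bigArc.carrier := fun z hz => by
  rw [mem_rightArc] at hz
  rw [mem_bigArc]
  linarith

lemma disjoint_bigArc_map_T {t : ℝ} (ht : 4 ≤ |t|) :
    Disjoint bigArc.carrier (bigArc.map (T t).1).carrier := by
  rw [Set.disjoint_left]
  rintro _ h1 ⟨z, hz, rfl⟩
  obtain ⟨s, hs, rfl⟩ := exists_pt_of_mem_bigArc hz
  rw [T_pt, pt_mem_bigArc] at h1
  have h2 : (4 : ℝ) ^ 2 ≤ |t| ^ 2 := pow_le_pow_left₀ (by norm_num) ht 2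
  rw [sq_abs] at h2
  nlinarith [sq_nonneg (2 * s + t)]

variable {H : Type*} [NormedAddCommGroup H] [InnerProductSpace ℂ H] [CompleteSpace H]

namespace MobiusCovariantNet

variable (N : MobiusCovariantNet H)

/-- The vacuum expectation of `x`. -/
noncomputable def vev (x : H →L[ℂ] H) : ℂ := inner ℂ N.Ω (x N.Ω)

/-- The two-point function `t ↦ ⟨Ω, x U(T t) y Ω⟩`. -/
noncomputable def twoPt (x y : H →L[ℂ] H) (t : ℝ) : ℂ :=
  inner ℂ (star x N.Ω) ((N.U (T t) : H →L[ℂ] H) (y N.Ω))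

/-- The vacuum expectation of the commutator of `x` with the translates of `y`. -/
noncomputable def commPt (x y : H →L[ℂ] H) (t : ℝ) : ℂ := N.twoPt x y t - N.twoPt y x (-t)

/-- The moments of `commPt`. -/
noncomputable def moment (x y : H →L[ℂ] H) (j : ℕ) : ℂ :=
  ∫ t in (-4 : ℝ)..4, N.commPt x y t * (t : ℂ) ^ j

lemma norm_apply_vacuum_le (x : H →L[ℂ] H) : ‖x N.Ω‖ ≤ ‖x‖ := by
  simpa [N.norm_vacuum] using x.le_opNorm N.Ω

lemma norm_star_apply_vacuum_le (x : H →L[ℂ] H) : ‖star x N.Ω‖ ≤ ‖x‖ := by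
  simpa using N.norm_apply_vacuum_le (star x)

lemma continuous_twoPt (x y : H →L[ℂ] H) : Continuous (N.twoPt x y) :=
  N.continuous_inner_U continuous_T _ _

lemma norm_twoPt_le (x y : H →L[ℂ] H) (t : ℝ) : ‖N.twoPt x y t‖ ≤ ‖x‖ * ‖y‖ :=
  (N.norm_inner_U_le _ _ _).trans (mul_le_mul (N.norm_star_apply_vacuum_le x)
    (N.norm_apply_vacuum_le y) (norm_nonneg _) (norm_nonneg _))

lemma continuous_commPt (x y : H →L[ℂ] H) : Continuous (N.commPt x y) :=
  (N.continuous_twoPt x y).sub ((N.continuous_twoPt y x).comp continuous_neg)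

lemma norm_commPt_le (x y : H →L[ℂ] H) (t : ℝ) : ‖N.commPt x y t‖ ≤ 2 * (‖x‖ * ‖y‖) := by
  refine (norm_sub_le _ _).trans ?_
  have h1 := N.norm_twoPt_le x y t
  have h2 := N.norm_twoPt_le y x (-t)
  linarith [mul_comm ‖x‖ ‖y‖]

lemma conj_twoPt_neg (x y : H →L[ℂ] H) (t : ℝ) :
    conj (N.twoPt y x (-t)) = N.twoPt (star x) (star y) t := by
  rw [twoPt, inner_conj_symm, T_neg, inner_U_inv, twoPt, star_star]

lemma twoPt_comm {x y : H →L[ℂ] H} (hx : x ∈ N.algebra bigArc) (hy : y ∈ N.algebra bigArc)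
    {t : ℝ} (ht : 4 ≤ |t|) : N.twoPt x y t = N.twoPt y x (-t) := by
  set u : H →L[ℂ] H := (N.U (T t) : H →L[ℂ] H) with hu
  have h1 : x * (u * y * star u) = (u * y * star u) * x :=
    (VonNeumannAlgebra.mem_commutant_iff.1
      (N.locality _ _ (disjoint_bigArc_map_T ht) hx) _ (N.conj_mem (g := T t) hy)).symm
  have h2 := congrArg (fun w : H →L[ℂ] H => inner ℂ N.Ω (w N.Ω)) h1
  have h3 : star u = (N.U (T (-t)) : H →L[ℂ] H) := by
    rw [hu, unitary_star_eq, T_neg, MonoidHom.map_inv]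
  have h4 : star u N.Ω = N.Ω := N.U_vacuum_inv _
  have h5 : inner ℂ N.Ω ((x * (u * y * star u)) N.Ω) = N.twoPt x y t := by
    change inner ℂ N.Ω (x (u (y (star u N.Ω)))) = _
    rw [h4, ← inner_star_apply]; rfl
  have h6 : inner ℂ N.Ω (((u * y * star u) * x) N.Ω) = N.twoPt y x (-t) := by
    change inner ℂ N.Ω (u (y (star u (x N.Ω)))) = _
    rw [← inner_star_apply, h4, ← inner_star_apply, h3]; rfl
  rw [← h5, ← h6]
  exact h2

/-- The two-point function as a Cauchy integral of the commutator function. -/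
lemma twoPt_sub_vev {x y : H →L[ℂ] H} (hx : x ∈ N.algebra bigArc) (hy : y ∈ N.algebra bigArc)
    {a : ℝ} (ha : 4 < a) :
    2 * Complex.I * Real.pi * (N.twoPt x y a - N.vev x * N.vev y)
      = ∫ t in (-4 : ℝ)..4, N.commPt x y t * ((t : ℂ) - a)⁻¹ := by
  have hpi : (2 * Complex.I * Real.pi : ℂ) ≠ 0 := by
    simp [Real.pi_ne_zero]
  have hconj : (fun t => conj (N.twoPt y x (-t))) = N.twoPt (star x) (star y) :=
    funext fun t => N.conj_twoPt_neg x y t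
  have hC : ∀ b : ℝ, 4 < b → IntervalIntegrable
      (fun t : ℝ => N.commPt x y t * ((t : ℂ) - b)⁻¹) volume (-4) 4 := fun b hb => by
    refine ContinuousOn.intervalIntegrable
      ((N.continuous_commPt x y).continuousOn.mul (ContinuousOn.inv₀ (by fun_prop) ?_))
    intro t ht h0
    rw [Set.uIcc_of_le (by norm_num)] at ht
    rw [sub_eq_zero, Complex.ofReal_inj] at h0
    linarith [ht.2]
  have hformula : ∀ b : ℝ, 4 < b → N.twoPt x y b = N.twoPt x y a
      - (2 * Complex.I * Real.pi)⁻¹ * ((∫ t in (-4 : ℝ)..4, N.commPt x y t * ((t : ℂ) - a)⁻¹)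
        - ∫ t in (-4 : ℝ)..4, N.commPt x y t * ((t : ℂ) - b)⁻¹) := fun b hb => by
    have h := IsHardy.cauchy_formula (f := N.twoPt x y) (g := fun t => N.twoPt y x (-t))
      (N.continuous_twoPt x y) ((N.continuous_twoPt y x).comp continuous_neg)
      (C := ‖x‖ * ‖y‖) (N.norm_twoPt_le x y)
      (fun t => (N.norm_twoPt_le y x (-t)).trans (mul_comm _ _).le)
      (N.isHardy_T _ _) (by rw [hconj]; exact N.isHardy_T _ _) (R := 4) (by norm_num)
      (fun t ht => N.twoPt_comm hx hy ht) (a₁ := b) (a₂ := a)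
      (by rwa [abs_of_pos (by linarith)]) (by rwa [abs_of_pos (by linarith)])
    rw [← intervalIntegral.integral_sub (hC a ha) (hC b hb)]
    have h' : (∫ t in (-4 : ℝ)..4, (N.commPt x y t * ((t : ℂ) - a)⁻¹
        - N.commPt x y t * ((t : ℂ) - b)⁻¹))
        = 2 * Complex.I * Real.pi * (N.twoPt x y a - N.twoPt x y b) := by
      rw [h]
      exact intervalIntegral.integral_congr fun t _ => (mul_sub _ _ _).symm
    rw [h', inv_mul_cancel_left₀ hpi]
    ring
  have hnat : Tendsto (fun n : ℕ => (n : ℝ)) atTop atTop := tendsto_natCast_atTop_atTop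
  have hzero : Tendsto (fun n : ℕ => ∫ t in (-4 : ℝ)..4, N.commPt x y t * ((t : ℂ) - (n : ℝ))⁻¹)
      atTop (𝓝 0) := by
    have h1 := tendsto_moment (d := fun _ => N.commPt x y) (d₀ := N.commPt x y)
      (fun _ => N.continuous_commPt x y) (fun _ => N.norm_commPt_le x y)
      (fun _ => tendsto_const_nhds) (m := 0) (fun _ j hj => absurd hj (Nat.not_lt_zero j)) hnat
    have h2 : Tendsto (fun n : ℕ => (((n : ℝ) : ℂ))⁻¹) atTop (𝓝 0) := by
      have := (Complex.continuous_ofReal.tendsto 0).comp (tendsto_inv_atTop_zero.comp hnat)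
      simpa [Function.comp_def] using this
    have h3 := h2.mul h1
    rw [zero_mul] at h3
    refine h3.congr' ?_
    filter_upwards [eventually_gt_atTop 0] with n hn
    have : ((n : ℝ) : ℂ) ≠ 0 := by exact_mod_cast hn.ne'
    rw [zero_add, pow_one, inv_mul_cancel_left₀ this]
  have hlim : Tendsto (fun n : ℕ => N.twoPt x y n) atTop (𝓝 (N.twoPt x y a
      - (2 * Complex.I * Real.pi)⁻¹ * ((∫ t in (-4 : ℝ)..4, N.commPt x y t * ((t : ℂ) - a)⁻¹)
        - 0))) := by
    refine (tendsto_const_nhds.sub (tendsto_const_nhds.mul (tendsto_const_nhds.sub hzero))).congr' ?_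
    filter_upwards [hnat.eventually_gt_atTop 4] with n hn
    rw [hformula n hn]
  have h := N.cluster hlim
  rw [inner_star_apply] at h
  change _ = N.vev x * N.vev y at h
  rw [← h, sub_zero, sub_sub_cancel, mul_inv_cancel_left₀ hpi]

lemma tendsto_twoPt {m : ℕ} (hm : ∀ j < m, ∀ x ∈ N.algebra bigArc, ∀ y ∈ N.algebra bigArc,
      N.moment x y j = 0)
    {x y : ℕ → H →L[ℂ] H} {x₀ y₀ : H →L[ℂ] H} {C : ℝ} (hxC : ∀ n, ‖x n‖ ≤ C)
    (hyC : ∀ n, ‖y n‖ ≤ C) (hx : ∀ n, x n ∈ N.algebra bigArc) (hy : ∀ n, y n ∈ N.algebra bigArc)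
    (hx₀ : Tendsto (fun n => x n N.Ω) atTop (𝓝 (x₀ N.Ω)))
    (hx₁ : Tendsto (fun n => star (x n) N.Ω) atTop (𝓝 (star x₀ N.Ω)))
    (hy₀ : Tendsto (fun n => y n N.Ω) atTop (𝓝 (y₀ N.Ω)))
    (hy₁ : Tendsto (fun n => star (y n) N.Ω) atTop (𝓝 (star y₀ N.Ω)))
    {a : ℕ → ℝ} (ha : Tendsto a atTop atTop) :
    Tendsto (fun n => (a n : ℂ) ^ (m + 1)
      * (N.twoPt (x n) (y n) (a n) - N.vev (x n) * N.vev (y n))) atTop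
      (𝓝 (-(2 * Complex.I * Real.pi)⁻¹ * N.moment x₀ y₀ m)) := by
  have hpi : (2 * Complex.I * Real.pi : ℂ) ≠ 0 := by
    simp [Real.pi_ne_zero]
  have hC : 0 ≤ C := (norm_nonneg _).trans (hxC 0)
  have h1 := tendsto_moment (d := fun n => N.commPt (x n) (y n)) (d₀ := N.commPt x₀ y₀)
    (fun _ => N.continuous_commPt _ _) (C := 2 * (C * C))
    (fun n t => (N.norm_commPt_le _ _ t).trans (by
      have := mul_le_mul (hxC n) (hyC n) (norm_nonneg _) hC
      linarith))
    (fun t => ((hx₁.inner (((N.U (T t) : H →L[ℂ] H).continuous.tendsto _).comp hy₀)).sub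
      (hy₁.inner (((N.U (T (-t)) : H →L[ℂ] H).continuous.tendsto _).comp hx₀))))
    (m := m) (fun n j hj => hm j hj _ (hx n) _ (hy n)) ha
  have h2 := h1.const_mul ((2 * Complex.I * Real.pi : ℂ)⁻¹)
  rw [mul_neg, ← neg_mul] at h2
  refine h2.congr' ?_
  filter_upwards [ha.eventually_gt_atTop 4] with n hn
  rw [← N.twoPt_sub_vev (hx n) (hy n) hn, mul_left_comm, inv_mul_cancel_left₀ hpi]

lemma exists_moment_ne_zero (hH : Module.finrank ℂ H ≠ 1) :
    ∃ m, ∃ x ∈ N.algebra bigArc, ∃ y ∈ N.algebra bigArc, N.moment x y m ≠ 0 := by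
  by_contra! h0
  have hpi : (2 * Complex.I * Real.pi : ℂ) ≠ 0 := by
    simp [Real.pi_ne_zero]
  have hΩ : N.Ω ≠ 0 := fun h => by
    have := N.norm_vacuum
    rw [h, norm_zero] at this
    exact zero_ne_one this
  have h1 : ∀ y ∈ N.algebra bigArc, (N.U (T 5) : H →L[ℂ] H) (y N.Ω) = N.vev y • N.Ω := fun y hy => by
    have hdense : Dense ((N.vac bigArc : Submodule ℂ H) : Set H) := by
      rw [Submodule.dense_iff_topologicalClosure_eq_top]
      exact N.reeh_schlieder bigArc
    refine hdense.eq_of_inner_right (𝕜 := ℂ) fun ξ hξ => ?_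
    obtain ⟨x, hx, rfl⟩ := N.mem_vac.1 hξ
    have hx' : star x ∈ N.algebra bigArc := star_mem hx
    have h2 := N.twoPt_sub_vev hx' hy (a := 5) (by norm_num)
    rw [integral_inv_sub_eq_zero (N.continuous_commPt _ _) (N.norm_commPt_le _ _)
      (fun j => h0 j _ hx' y hy) (by norm_num)] at h2
    have h3 := sub_eq_zero.1 ((mul_eq_zero.1 h2).resolve_left hpi)
    rw [twoPt, star_star] at h3
    rw [h3, inner_smul_right, vev, ← inner_star_apply, star_star, mul_comm]
  have h2 : N.vac bigArc ≤ Submodule.span ℂ {N.Ω} := fun ξ hξ => by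
    obtain ⟨y, hy, rfl⟩ := N.mem_vac.1 hξ
    have h3 := congrArg ((N.U (T 5)⁻¹ : H →L[ℂ] H)) (h1 y hy)
    rw [← U_mul_apply, inv_mul_cancel, U_one_apply, ContinuousLinearMap.map_smul,
      N.vacuum_invariant] at h3
    rw [h3]
    exact Submodule.smul_mem _ _ (Submodule.mem_span_singleton_self _)
  have h3 : Submodule.span ℂ {N.Ω} = ⊤ := by
    rw [eq_top_iff, ← N.reeh_schlieder bigArc]
    exact Submodule.topologicalClosure_minimal _ h2 (Submodule.closed_of_finiteDimensional _)
  refine hH ((finrank_eq_one_iff_of_nonzero N.Ω hΩ).2 h3)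

lemma twoPt_conj_D {s : ℝ} (hs : s ≠ 0) (x y : H →L[ℂ] H) (t : ℝ) :
    N.twoPt ((N.U (D s hs) : H →L[ℂ] H) * x * star (N.U (D s hs) : H →L[ℂ] H))
      ((N.U (D s hs) : H →L[ℂ] H) * y * star (N.U (D s hs) : H →L[ℂ] H)) (s ^ 2 * t)
      = N.twoPt x y t := by
  have h1 : ∀ w : H →L[ℂ] H, ((N.U (D s hs) : H →L[ℂ] H) * w * star (N.U (D s hs) : H →L[ℂ] H)) N.Ω
      = (N.U (D s hs) : H →L[ℂ] H) (w N.Ω) := fun w => by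
    change (N.U (D s hs) : H →L[ℂ] H) (w (star (N.U (D s hs) : H →L[ℂ] H) N.Ω)) = _
    rw [U_vacuum_inv]
  rw [twoPt, star_mul, star_mul, star_star, ← mul_assoc, h1, h1, ← U_mul_apply, ← D_mul_T,
    U_mul_apply, ← inner_U_inv, ← U_mul_apply, inv_mul_cancel, U_one_apply]
  rfl

lemma vev_conj_U (g : Mob) (x : H →L[ℂ] H) :
    N.vev ((N.U g : H →L[ℂ] H) * x * star (N.U g : H →L[ℂ] H)) = N.vev x := by
  change inner ℂ N.Ω ((N.U g : H →L[ℂ] H) (x (star (N.U g : H →L[ℂ] H) N.Ω))) = _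
  rw [U_vacuum_inv, ← inner_U_inv, N.vacuum_invariant]; rfl

/-- Two-point functions of a nontrivial net have a definite leading behaviour at infinity. -/
theorem exists_twoPt_asymptotics (hH : Module.finrank ℂ H ≠ 1) :
    ∃ m : ℕ, ∃ x₀ ∈ N.algebra rightArc, ∃ y₀ ∈ N.algebra rightArc, ∃ M : ℂ, M ≠ 0 ∧
      ∀ (x y : ℕ → H →L[ℂ] H) (C : ℝ), (∀ n, ‖x n‖ ≤ C) → (∀ n, ‖y n‖ ≤ C) →
      (∀ n, x n ∈ N.algebra bigArc) → (∀ n, y n ∈ N.algebra bigArc) →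
      Tendsto (fun n => x n N.Ω) atTop (𝓝 (x₀ N.Ω)) →
      Tendsto (fun n => star (x n) N.Ω) atTop (𝓝 (star x₀ N.Ω)) →
      Tendsto (fun n => y n N.Ω) atTop (𝓝 (y₀ N.Ω)) →
      Tendsto (fun n => star (y n) N.Ω) atTop (𝓝 (star y₀ N.Ω)) →
      ∀ a : ℕ → ℝ, Tendsto a atTop atTop →
      Tendsto (fun n => (a n : ℂ) ^ (m + 1)
        * (N.twoPt (x n) (y n) (a n) - N.vev (x n) * N.vev (y n))) atTop (𝓝 M) := by
  classical
  set m := Nat.find (N.exists_moment_ne_zero hH) with hmdef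
  obtain ⟨x, hx, y, hy, hxy⟩ := Nat.find_spec (N.exists_moment_ne_zero hH)
  rw [← hmdef] at hxy
  have hm : ∀ j < m, ∀ x ∈ N.algebra bigArc, ∀ y ∈ N.algebra bigArc, N.moment x y j = 0 :=
    fun j hj x hx y hy => by
      by_contra h
      exact Nat.find_min (N.exists_moment_ne_zero hH) hj ⟨x, hx, y, hy, h⟩
  have hpi : (2 * Complex.I * Real.pi : ℂ) ≠ 0 := by
    simp [Real.pi_ne_zero]
  have hs : (2⁻¹ : ℝ) ≠ 0 := by norm_num
  have hsub : (bigArc.map (D 2⁻¹ hs).1).carrier ⊆ rightArc.carrier := by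
    rintro _ ⟨z, hz, rfl⟩
    obtain ⟨t, ht, rfl⟩ := exists_pt_of_mem_bigArc hz
    rw [D_pt, pt_mem_rightArc]
    nlinarith
  set x₀ := (N.U (D 2⁻¹ hs) : H →L[ℂ] H) * x * star (N.U (D 2⁻¹ hs) : H →L[ℂ] H) with hx₀
  set y₀ := (N.U (D 2⁻¹ hs) : H →L[ℂ] H) * y * star (N.U (D 2⁻¹ hs) : H →L[ℂ] H) with hy₀
  have hx₀m : x₀ ∈ N.algebra rightArc := N.isotony _ _ hsub (N.conj_mem hx)
  have hy₀m : y₀ ∈ N.algebra rightArc := N.isotony _ _ hsub (N.conj_mem hy)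
  have hle := N.isotony _ _ rightArc_subset_bigArc
  refine ⟨m, x₀, hx₀m, y₀, hy₀m, -(2 * Complex.I * Real.pi)⁻¹ * N.moment x₀ y₀ m, ?_,
    fun x y C h1 h2 h3 h4 h5 h6 h7 h8 a ha => N.tendsto_twoPt hm h1 h2 h3 h4 h5 h6 h7 h8 ha⟩
  have hnat : Tendsto (fun n : ℕ => (n : ℝ)) atTop atTop := tendsto_natCast_atTop_atTop
  have l1 := N.tendsto_twoPt hm (x := fun _ => x) (y := fun _ => y) (C := max ‖x‖ ‖y‖)
    (fun _ => le_max_left _ _) (fun _ => le_max_right _ _) (fun _ => hx) (fun _ => hy)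
    tendsto_const_nhds tendsto_const_nhds tendsto_const_nhds tendsto_const_nhds
    (a := fun n => 4 * (n : ℝ)) (hnat.const_mul_atTop (by norm_num))
  have l2 := N.tendsto_twoPt hm (x := fun _ => x₀) (y := fun _ => y₀) (C := max ‖x₀‖ ‖y₀‖)
    (fun _ => le_max_left _ _) (fun _ => le_max_right _ _) (fun _ => hle hx₀m)
    (fun _ => hle hy₀m) tendsto_const_nhds tendsto_const_nhds tendsto_const_nhds
    tendsto_const_nhds hnat
  have h4 : ∀ n : ℕ, N.twoPt x₀ y₀ n = N.twoPt x y (4 * n) := fun n => by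
    rw [← N.twoPt_conj_D hs x y]
    congr 1
    ring
  have l3 := (l2.const_mul ((4 : ℂ) ^ (m + 1))).congr fun n => by
    rw [h4, hx₀, hy₀, vev_conj_U, vev_conj_U, ← mul_assoc, ← mul_pow]
  have h5 := tendsto_nhds_unique (l3.congr fun n => by push_cast; rfl) l1
  intro h6
  rw [h6, mul_zero] at h5
  exact hxy ((mul_eq_zero.1 h5.symm).resolve_left (neg_ne_zero.2 (inv_ne_zero hpi)))

end MobiusCovariantNet

end CircleNet

namespace CircleNet

open Filter Topology MeasureTheory

/-! ### Hadamard's lemma -/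

lemma hasDerivAt_integral_comp_mul {w g : ℝ → ℝ} (hw : Continuous w) (hg : ContDiff ℝ ∞ g) (s₀ : ℝ) :
    HasDerivAt (fun s => ∫ u in (0 : ℝ)..1, w u * g (u * s))
      (∫ u in (0 : ℝ)..1, (w u * u) * deriv g (u * s₀)) s₀ := by
  have hg' : Continuous (deriv g) := hg.continuous_deriv (by simp)
  have hgc := hg.continuous
  have hcont : Continuous fun p : ℝ × ℝ => (w p.1 * p.1) * deriv g (p.1 * p.2) := by fun_prop
  obtain ⟨C, hC⟩ := ((isCompact_Icc (a := (0 : ℝ)) (b := 1)).prod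
    (isCompact_closedBall s₀ 1)).exists_bound_of_continuousOn hcont.continuousOn
  refine (intervalIntegral.hasDerivAt_integral_of_dominated_loc_of_deriv_le
    (F := fun s u => w u * g (u * s)) (F' := fun s u => (w u * u) * deriv g (u * s))
    (bound := fun _ => C) (Metric.closedBall_mem_nhds s₀ one_pos) ?_ ?_ ?_ ?_ ?_ ?_).2
  · exact .of_forall fun s => Continuous.aestronglyMeasurable (by fun_prop)
  · exact Continuous.intervalIntegrable (by fun_prop) _ _
  · exact Continuous.aestronglyMeasurable (by fun_prop)
  · refine .of_forall fun u hu s hs => ?_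
    rw [Set.uIoc_of_le zero_le_one] at hu
    exact hC (u, s) ⟨⟨hu.1.le, hu.2⟩, hs⟩
  · exact intervalIntegrable_const
  · refine .of_forall fun u _ s _ => ?_
    have h1 : HasDerivAt g (deriv g (u * s)) (u * s) :=
      (hg.differentiable (by simp) _).hasDerivAt
    have h2 : HasDerivAt (fun s => u * s) u s := by simpa using (hasDerivAt_id s).const_mul u
    refine ((h1.comp s h2).const_mul (w u)).congr_deriv (by ring)

lemma contDiff_integral_comp_mul {g : ℝ → ℝ} (hg : ContDiff ℝ ∞ g) {w : ℝ → ℝ} (hw : Continuous w) :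
    ContDiff ℝ ∞ fun s => ∫ u in (0 : ℝ)..1, w u * g (u * s) := by
  refine contDiff_infty.2 fun n => ?_
  induction n generalizing g w with
  | zero =>
    have := hg.continuous
    exact contDiff_zero.2 (intervalIntegral.continuous_parametric_intervalIntegral_of_continuous'
      (by fun_prop) _ _)
  | succ n ih =>
    have hd := hasDerivAt_integral_comp_mul hw hg
    push_cast
    refine (contDiff_succ_iff_deriv (n := n)).2 ⟨fun s => (hd s).differentiableAt, by simp, ?_⟩
    rw [funext fun s => (hd s).deriv]
    exact ih (contDiff_infty_iff_deriv.1 hg).2 (by fun_prop)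

/-- Hadamard's lemma on the real line. -/
lemma exists_contDiff_mul {f : ℝ → ℝ} (hf : ContDiff ℝ ∞ f) (h0 : f 0 = 0) :
    ∃ q : ℝ → ℝ, ContDiff ℝ ∞ q ∧ q 0 = deriv f 0 ∧ ∀ s, f s = s * q s := by
  have hf' : ContDiff ℝ ∞ (deriv f) := (contDiff_infty_iff_deriv.1 hf).2
  have hf'c := hf'.continuous
  refine ⟨fun s => ∫ u in (0 : ℝ)..1, 1 * deriv f (u * s),
    contDiff_integral_comp_mul hf' continuous_const, by simp, fun s => ?_⟩
  have h1 := intervalIntegral.integral_eq_sub_of_hasDerivAt (a := (0 : ℝ)) (b := 1)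
    (f := fun u => f (u * s)) (f' := fun u => s * (1 * deriv f (u * s))) (fun u _ => by
      have h1 : HasDerivAt f (deriv f (u * s)) (u * s) :=
        (hf.differentiable (by simp) _).hasDerivAt
      have h2 : HasDerivAt (fun u => u * s) s u := by simpa using (hasDerivAt_id u).mul_const s
      exact (h1.comp u h2).congr_deriv (by ring))
    (Continuous.intervalIntegrable (by fun_prop) _ _)
  rw [intervalIntegral.integral_const_mul] at h1
  rw [h1]
  simp [h0]

/-! ### The coordinate, cut off near `-1` -/

/-- A smooth function which agrees with `1 / (1 + c)` for `0 ≤ c` and vanishes for `c ≤ -1/2`. -/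
noncomputable def cutInv (c : ℝ) : ℝ := Real.smoothTransition (2 * c + 1) / (1 + c)

lemma cutInv_of_nonneg {c : ℝ} (hc : 0 ≤ c) : cutInv c = 1 / (1 + c) := by
  rw [cutInv, Real.smoothTransition.one_of_one_le (by linarith)]

lemma cutInv_of_le {c : ℝ} (hc : c ≤ -1 / 2) : cutInv c = 0 := by
  rw [cutInv, Real.smoothTransition.zero_of_nonpos (by linarith), zero_div]

lemma contDiff_cutInv : ContDiff ℝ ∞ cutInv := by
  rw [contDiff_iff_contDiffAt]
  intro c
  rcases lt_or_ge c (-1 / 2) with hc | hc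
  · have : cutInv =ᶠ[𝓝 c] fun _ => 0 := by
      filter_upwards [gt_mem_nhds hc] with x hx using cutInv_of_le hx.le
    exact contDiffAt_const.congr_of_eventuallyEq this
  · exact ((Real.smoothTransition.contDiff.comp
      ((contDiff_const.mul contDiff_id).add contDiff_const)).contDiffAt).div
      (contDiff_const.add contDiff_id).contDiffAt (by change 1 + c ≠ 0; linarith)

/-- The coordinate `tt`, cut off near `-1`. -/
noncomputable def cutTt (z : Circle) : ℝ := (z : ℂ).im * cutInv (z : ℂ).re

lemma cutTt_of_re_nonneg {z : Circle} (hz : 0 ≤ (z : ℂ).re) : cutTt z = tt z := by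
  rw [cutTt, cutInv_of_nonneg hz, tt]; ring

lemma cutTt_of_re_le {z : Circle} (hz : (z : ℂ).re ≤ -1 / 2) : cutTt z = 0 := by
  rw [cutTt, cutInv_of_le hz, mul_zero]

lemma contDiff_cutTt_comp {f : ℝ → Circle} (hf : ContDiff ℝ ∞ fun t => (f t : ℂ)) :
    ContDiff ℝ ∞ fun t => cutTt (f t) := by
  have h1 : ContDiff ℝ ∞ fun t => (f t : ℂ).re := Complex.reCLM.contDiff.comp hf
  have h2 : ContDiff ℝ ∞ fun t => (f t : ℂ).im := Complex.imCLM.contDiff.comp hf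
  exact h2.mul (contDiff_cutInv.comp h1)

lemma contDiff_coe_exp : ContDiff ℝ ∞ fun θ : ℝ => (Circle.exp θ : ℂ) :=
  (contMDiff_circle_coe.comp contMDiff_circle_exp).contDiff

lemma contDiff_diffPlus_pt (k : DiffPlus) : ContDiff ℝ ∞ fun t => (k.1 (pt t) : ℂ) := by
  have h1 : ContMDiff 𝓘(ℝ, ℝ) 𝓘(ℝ, ℂ) ∞ fun θ : ℝ => (k.1 (Circle.exp θ) : ℂ) :=
    contMDiff_circle_coe.comp (k.2.1.comp contMDiff_circle_exp)
  exact h1.contDiff.comp (contDiff_const.mul Real.contDiff_arctan)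

lemma continuous_diffPlus_pt_re (k : DiffPlus) : Continuous fun t => (k.1 (pt t) : ℂ).re :=
  Complex.continuous_re.comp (contDiff_diffPlus_pt k).continuous

end CircleNet

namespace CircleNet

open Filter Topology MeasureTheory

/-! ### Deformations of the identity supported in an arc -/

/-- The joint lift of the deformation `t ↦ t q(ε t)`. -/
noncomputable def deformLift (q : ℝ → ℝ) (p : ℝ × ℝ) : ℝ :=
  p.2 + 2 * Real.arctan (cutTt (Circle.exp p.2) * q (p.1 * cutTt (Circle.exp p.2)))
    - 2 * Real.arctan (cutTt (Circle.exp p.2))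

lemma contDiff_deformLift {q : ℝ → ℝ} (hq : ContDiff ℝ ∞ q) : ContDiff ℝ ∞ (deformLift q) := by
  have h1 : ContDiff ℝ ∞ fun p : ℝ × ℝ => cutTt (Circle.exp p.2) :=
    (contDiff_cutTt_comp contDiff_coe_exp).comp contDiff_snd
  exact (contDiff_snd.add (contDiff_const.mul (Real.contDiff_arctan.comp
    (h1.mul (hq.comp (contDiff_fst.mul h1)))))).sub
    (contDiff_const.mul (Real.contDiff_arctan.comp h1))

lemma deformLift_add_two_pi (q : ℝ → ℝ) (ε θ : ℝ) :
    deformLift q (ε, θ + 2 * Real.pi) = deformLift q (ε, θ) + 2 * Real.pi := by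
  have : Circle.exp (θ + 2 * Real.pi) = Circle.exp θ := Circle.periodic_exp θ
  simp only [deformLift, this]
  ring

lemma deformLift_zero {q : ℝ → ℝ} (h0 : q 0 = 1) (θ : ℝ) : deformLift q (0, θ) = θ := by
  simp [deformLift, h0]

lemma contDiff_deformLift_right {q : ℝ → ℝ} (hq : ContDiff ℝ ∞ q) (ε : ℝ) :
    ContDiff ℝ ∞ fun θ => deformLift q (ε, θ) :=
  (contDiff_deformLift hq).comp (contDiff_const.prodMk contDiff_id)

lemma hasDerivAt_deformLift {q : ℝ → ℝ} (hq : ContDiff ℝ ∞ q) (ε θ : ℝ) :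
    HasDerivAt (fun θ => deformLift q (ε, θ)) (fderiv ℝ (deformLift q) (ε, θ) (0, 1)) θ :=
  (((contDiff_deformLift hq).differentiable (by simp) (ε, θ)).hasFDerivAt).comp_hasDerivAt θ
    ((hasDerivAt_const θ ε).prodMk (hasDerivAt_id θ))

lemma eventually_deriv_deformLift_pos {q : ℝ → ℝ} (hq : ContDiff ℝ ∞ q) (h0 : q 0 = 1) :
    ∀ᶠ ε in 𝓝 (0 : ℝ), ∀ θ, 0 < deriv (fun θ => deformLift q (ε, θ)) θ := by
  have hcont : Continuous fun p : ℝ × ℝ => fderiv ℝ (deformLift q) p (0, 1) :=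
    ((contDiff_deformLift hq).continuous_fderiv (by simp)).clm_apply continuous_const
  have h1 : ∀ θ, fderiv ℝ (deformLift q) (0, θ) (0, 1) = 1 := fun θ => by
    rw [← (hasDerivAt_deformLift hq 0 θ).deriv, funext (deformLift_zero h0)]
    exact deriv_id θ
  have h2 : ∀ᶠ ε in 𝓝 (0 : ℝ), ∀ θ ∈ Set.Icc 0 (2 * Real.pi),
      0 < fderiv ℝ (deformLift q) (ε, θ) (0, 1) := by
    refine isCompact_Icc.eventually_forall_of_forall_eventually fun θ _ => ?_
    refine hcont.continuousAt.eventually (lt_mem_nhds ?_)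
    exact one_pos.trans_eq (h1 θ).symm
  filter_upwards [h2] with ε hε θ
  have hper : Function.Periodic (deriv fun θ => deformLift q (ε, θ)) (2 * Real.pi) := fun θ => by
    rw [← deriv_comp_add_const]
    simp only [deformLift_add_two_pi, deriv_add_const]
  obtain ⟨y, hy, hθ⟩ := hper.exists_mem_Ico₀ Real.two_pi_pos θ
  rw [hθ, (hasDerivAt_deformLift hq ε y).deriv]
  exact hε y ⟨hy.1, hy.2.le⟩

open Classical in
/-- The deformation `t ↦ t q(ε t)` of the identity, cut off near `-1`. -/
noncomputable def deform (q : ℝ → ℝ) (hq : ContDiff ℝ ∞ q) (ε : ℝ) : DiffPlus :=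
  if h : ∀ θ, 0 < deriv (fun θ => deformLift q (ε, θ)) θ then
    diffOfLift (fun θ => deformLift q (ε, θ)) (contDiff_deformLift_right hq ε) h
      (deformLift_add_two_pi q ε)
  else 1

lemma eventually_deform_exp {q : ℝ → ℝ} (hq : ContDiff ℝ ∞ q) (h0 : q 0 = 1) :
    ∀ᶠ ε in 𝓝 (0 : ℝ), ∀ θ, (deform q hq ε).1 (Circle.exp θ) = Circle.exp (deformLift q (ε, θ)) := by
  filter_upwards [eventually_deriv_deformLift_pos hq h0] with ε hε θ
  rw [deform, dif_pos hε]
  exact diffOfLift_exp _ _ _ θ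

lemma tendsto_deform {q : ℝ → ℝ} (hq : ContDiff ℝ ∞ q) (h0 : q 0 = 1) :
    Tendsto (deform q hq) (𝓝 0) (𝓝 1) := by
  have h1 : deform q hq 0 = 1 := diffPlus_ext fun z => by
    obtain ⟨θ, rfl⟩ := exists_exp_eq z
    rw [(eventually_deform_exp hq h0).self_of_nhds θ, deformLift_zero h0]
    rfl
  rw [← h1]
  refine continuousAt_diffPlus (e := id) (G := fun p => (Circle.exp (deformLift q p) : ℂ))
    isOpen_univ ?_ continuousAt_id (Set.mem_univ _) ?_
  · exact (contDiff_coe_exp.comp (contDiff_deformLift hq)).contDiffOn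
  · filter_upwards [eventually_deform_exp hq h0] with ε hε θ
    exact congrArg _ (hε θ)

lemma eventually_map_deform {q : ℝ → ℝ} (hq : ContDiff ℝ ∞ q) (h0 : q 0 = 1) :
    ∀ᶠ ε in 𝓝 (0 : ℝ), bigArc.map (deform q hq ε) = bigArc := by
  filter_upwards [eventually_deform_exp hq h0] with ε hε
  have hfix : ∀ z ∉ bigArc.carrier, (deform q hq ε).1 z = z := fun z hz => by
    rw [mem_bigArc, not_lt] at hz
    obtain ⟨θ, rfl⟩ := exists_exp_eq z
    rw [hε, deformLift, cutTt_of_re_le hz]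
    simp
  apply interval_ext
  change (deform q hq ε).1 '' bigArc.carrier = bigArc.carrier
  have h1 : (deform q hq ε).1 '' bigArc.carrierᶜ = bigArc.carrierᶜ := by
    conv_rhs => rw [← Set.image_id bigArc.carrierᶜ]
    exact Set.image_congr hfix
  rw [Set.image_compl_eq (deform q hq ε).1.bijective] at h1
  exact compl_injective h1

lemma eventually_deform_pt {q : ℝ → ℝ} (hq : ContDiff ℝ ∞ q) (h0 : q 0 = 1) :
    ∀ᶠ ε in 𝓝 (0 : ℝ), ∀ t, t ^ 2 < 1 → (deform q hq ε).1 (pt t) = pt (t * q (ε * t)) := by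
  filter_upwards [eventually_deform_exp hq h0] with ε hε t ht
  have h1 : cutTt (Circle.exp (2 * Real.arctan t)) = t := by
    refine (cutTt_of_re_nonneg ?_).trans (tt_pt t)
    exact (mem_rightArc.1 (pt_mem_rightArc.2 ht)).le
  rw [pt, hε, deformLift, h1, pt]
  congr 1
  ring

/-- The rescalings of a diffeomorphism at a fixed point converge to a dilation. -/
theorem exists_rescaling {k : DiffPlus} (h0 : k.1 (pt 0) = pt 0) {r : ℝ} (hr : r ≠ 0)
    (hd : HasDerivAt (fun t => tt (k.1 (pt t))) (r ^ 2) 0) :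
    ∃ F : ℝ → DiffPlus, Tendsto F (𝓝 0) (𝓝 1) ∧ ∀ᶠ s in 𝓝 (0 : ℝ), bigArc.map (F s) = bigArc ∧
      ∀ hs : s ≠ 0, ∀ z ∈ rightArc.carrier,
        (D (r * s) (mul_ne_zero hr hs)).1.1 ((F s).1 z) = k.1 ((D s hs).1.1 z) := by
  have hre : ∀ᶠ t in 𝓝 (0 : ℝ), 0 < (k.1 (pt t) : ℂ).re := by
    refine (continuous_diffPlus_pt_re k).continuousAt.eventually (lt_mem_nhds ?_)
    change 0 < (k.1 (pt 0) : ℂ).re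
    rw [h0, pt_zero]
    simp
  have hcut : (fun t => cutTt (k.1 (pt t))) =ᶠ[𝓝 0] fun t => tt (k.1 (pt t)) := by
    filter_upwards [hre] with t ht using cutTt_of_re_nonneg ht.le
  have hf0 : cutTt (k.1 (pt 0)) = 0 := by
    exact hcut.self_of_nhds.trans ((congrArg tt h0).trans (tt_pt 0))
  obtain ⟨q, hq, hq0, hfq⟩ := exists_contDiff_mul (contDiff_cutTt_comp (contDiff_diffPlus_pt k)) hf0
  rw [hcut.deriv_eq, hd.deriv] at hq0
  have hr2 : r ^ 2 ≠ 0 := pow_ne_zero 2 hr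
  set Q : ℝ → ℝ := fun s => q s / r ^ 2 with hQ
  have hQd : ContDiff ℝ ∞ Q := hq.div_const _
  have hQ0 : Q 0 = 1 := by rw [hQ]; simp only [hq0]; exact div_self hr2
  have hsq : Tendsto (fun s : ℝ => s ^ 2) (𝓝 0) (𝓝 0) := by
    have := (continuous_pow 2 (M := ℝ)).tendsto 0
    simpa using this
  refine ⟨fun s => deform Q hQd (s ^ 2), (tendsto_deform hQd hQ0).comp hsq, ?_⟩
  obtain ⟨δ, hδ, hball⟩ := Metric.eventually_nhds_iff.1 hre
  filter_upwards [hsq.eventually (eventually_map_deform hQd hQ0),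
    hsq.eventually (eventually_deform_pt hQd hQ0), hsq.eventually (Metric.ball_mem_nhds 0 hδ)]
    with s h1 h2 h3
  refine ⟨h1, fun hs z hz => ?_⟩
  obtain ⟨t, -, rfl⟩ := exists_pt_of_mem_bigArc (rightArc_subset_bigArc hz)
  rw [pt_mem_rightArc] at hz
  rw [h2 t hz, D_pt, D_pt]
  have h4 : dist (s ^ 2 * t) 0 < δ := by
    rw [dist_zero_right] at h3
    rw [dist_zero_right, norm_mul]
    have : ‖t‖ ≤ 1 := by
      rw [Real.norm_eq_abs]; exact ((sq_lt_one_iff_abs_lt_one t).1 hz).le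
    nlinarith [norm_nonneg (s ^ 2)]
  have h5 := hball h4
  have h6 : k.1 (pt (s ^ 2 * t)) ≠ -1 := fun h => by
    rw [h] at h5
    simp at h5
    linarith
  rw [← pt_tt h6, ← cutTt_of_re_nonneg h5.le, hfq]
  congr 1
  rw [hQ]
  field_simp

end CircleNet

namespace CircleNet

open Filter Topology

/-! ### Local action of diffeomorphisms -/

/-- The left half-circle. -/
noncomputable def leftArc : Interval := cap (-1) 0 (by norm_num) (by norm_num)

lemma mem_leftArc {z : Circle} : z ∈ leftArc.carrier ↔ (z : ℂ).re < 0 := by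
  rw [leftArc, mem_cap]; simp

lemma rightArc_eq_interior : rightArc.carrier = interior leftArc.carrierᶜ := by
  apply subset_antisymm
  · refine interior_maximal (fun z hz h => ?_) rightArc.isOpen
    rw [mem_rightArc] at hz
    rw [mem_leftArc] at h
    exact lt_asymm hz h
  · intro z hz
    have h0 : 0 ≤ (z : ℂ).re := not_lt.1 fun h => interior_subset hz (mem_leftArc.2 h)
    rw [mem_rightArc]
    refine lt_of_le_of_ne h0 fun h1 => ?_
    have hc : Continuous fun t : ℝ => z * Circle.exp t := continuous_const.mul Circle.exp.continuous
    have h2 : ∀ᶠ t : ℝ in 𝓝 0, 0 ≤ -((z : ℂ).im * Real.sin t) := by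
      have : interior leftArc.carrierᶜ ∈ 𝓝 (z * Circle.exp 0) := by
        rw [Circle.exp_zero, mul_one]
        exact isOpen_interior.mem_nhds hz
      filter_upwards [hc.continuousAt.preimage_mem_nhds this] with t ht
      have h3 : 0 ≤ ((z * Circle.exp t : Circle) : ℂ).re :=
        not_lt.1 fun h => interior_subset ht (mem_leftArc.2 h)
      rw [Circle.coe_mul, Complex.mul_re, ← h1, Circle.coe_exp, Complex.exp_ofReal_mul_I_im,
        zero_mul, zero_sub] at h3
      exact h3
    have h3 : ∀ᶠ t : ℝ in 𝓝 0, 0 ≤ (z : ℂ).im * Real.sin t := by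
      have : Tendsto (fun t : ℝ => -t) (𝓝 0) (𝓝 0) := by
        have := (continuous_neg (G := ℝ)).tendsto 0
        rwa [neg_zero] at this
      filter_upwards [this.eventually h2] with t ht
      rw [Real.sin_neg] at ht
      linarith
    obtain ⟨δ, hδ, h4⟩ := Metric.eventually_nhds_iff.1 (h2.and h3)
    set t := min (δ / 2) 1 with ht
    have ht0 : 0 < t := lt_min (by linarith) one_pos
    have ht1 : t ≤ 1 := min_le_right _ _
    have ht2 : t < δ := (min_le_left _ _).trans_lt (by linarith)
    obtain ⟨h5, h6⟩ := h4 (y := t) (by rwa [dist_zero_right, Real.norm_of_nonneg ht0.le])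
    have h7 : 0 < Real.sin t := Real.sin_pos_of_pos_of_lt_pi ht0 (by linarith [Real.pi_gt_three])
    have h8 : (z : ℂ).im = 0 := by
      have : (z : ℂ).im * Real.sin t = 0 := by linarith
      exact (mul_eq_zero.1 this).resolve_right h7.ne'
    have h9 := circle_re_sq_add_im_sq z
    rw [← h1, h8] at h9
    norm_num at h9

variable {H : Type*} [NormedAddCommGroup H] [InnerProductSpace ℂ H] [CompleteSpace H]

/-- The conjugate `u x u*`. -/
noncomputable def Ad (u : UnitaryOp H) (x : H →L[ℂ] H) : H →L[ℂ] H :=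
  (u : H →L[ℂ] H) * x * star (u : H →L[ℂ] H)

lemma Ad_mul (u v : UnitaryOp H) (x : H →L[ℂ] H) : Ad (u * v) x = Ad u (Ad v x) := by
  simp only [Ad, Submonoid.coe_mul, star_mul, mul_assoc]

lemma Ad_apply (u : UnitaryOp H) (x : H →L[ℂ] H) (ξ : H) :
    Ad u x ξ = (u : H →L[ℂ] H) (x (((u⁻¹ : UnitaryOp H) : H →L[ℂ] H) ξ)) := by
  rw [Ad, unitary_star_eq]; rfl

lemma star_Ad (u : UnitaryOp H) (x : H →L[ℂ] H) : star (Ad u x) = Ad u (star x) := by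
  simp only [Ad, star_mul, star_star, mul_assoc]

lemma norm_Ad_le (u : UnitaryOp H) (x : H →L[ℂ] H) : ‖Ad u x‖ ≤ ‖x‖ := by
  refine ContinuousLinearMap.opNorm_le_bound _ (norm_nonneg _) fun ξ => ?_
  rw [Ad_apply, unitary_norm_apply]
  refine (x.le_opNorm _).trans_eq ?_
  rw [unitary_norm_apply]

lemma exists_toProj (p : ProjUnitary H) : ∃ u : UnitaryOp H, toProj H u = p :=
  QuotientGroup.mk'_surjective _ p

lemma exists_smul_of_toProj_eq {u v : UnitaryOp H} (h : toProj H u = toProj H v) :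
    ∃ c : Circle, (v : H →L[ℂ] H) = (c : ℂ) • (u : H →L[ℂ] H) := by
  obtain ⟨c, hc⟩ : u⁻¹ * v ∈ scalars H := QuotientGroup.eq.1 h
  refine ⟨c, ?_⟩
  have h1 : v = u * (u⁻¹ * v) := by rw [mul_inv_cancel_left]
  rw [h1, Submonoid.coe_mul, hc, mul_smul_comm, mul_one]

lemma continuous_inv_apply (η : H) : @Continuous _ _ (strongTopology H) _
    fun u : UnitaryOp H => ((u⁻¹ : UnitaryOp H) : H →L[ℂ] H) η := by
  let _ := strongTopology H
  refine continuous_iff_continuousAt.2 fun u₀ => ?_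
  rw [ContinuousAt, tendsto_iff_norm_sub_tendsto_zero]
  have h1 : Continuous fun u : UnitaryOp H =>
      (u : H →L[ℂ] H) (((u₀⁻¹ : UnitaryOp H) : H →L[ℂ] H) η) :=
    (continuous_apply _).comp continuous_induced_dom
  have h2 : Tendsto (fun u : UnitaryOp H =>
      ‖η - (u : H →L[ℂ] H) (((u₀⁻¹ : UnitaryOp H) : H →L[ℂ] H) η)‖) (𝓝 u₀)
      (𝓝 ‖η - (u₀ : H →L[ℂ] H) (((u₀⁻¹ : UnitaryOp H) : H →L[ℂ] H) η)‖) :=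
    ((continuous_const (y := η)).sub h1).norm.tendsto u₀
  rw [unitary_apply_inv_apply, sub_self, norm_zero] at h2
  refine h2.congr fun u => ?_
  rw [← unitary_norm_apply u (((u⁻¹ : UnitaryOp H) : H →L[ℂ] H) η - _), map_sub,
    unitary_apply_inv_apply]

/-- The size of the commutator of `x` with a projective unitary, on the vector `η`. -/
noncomputable def commNorm (x : H →L[ℂ] H) (η : H) (p : ProjUnitary H) : ℝ :=
  Quotient.liftOn' p (fun u : UnitaryOp H => ‖x (((u⁻¹ : UnitaryOp H) : H →L[ℂ] H) η)
    - ((u⁻¹ : UnitaryOp H) : H →L[ℂ] H) (x η)‖) fun u v h => by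
      obtain ⟨c, hc⟩ := exists_smul_of_toProj_eq (u := u) (v := v)
        (QuotientGroup.eq.2 (QuotientGroup.leftRel_apply.1 h))
      have h1 : ((v⁻¹ : UnitaryOp H) : H →L[ℂ] H)
          = conj (c : ℂ) • ((u⁻¹ : UnitaryOp H) : H →L[ℂ] H) := by
        rw [← unitary_star_eq, ← unitary_star_eq, hc, star_smul]; rfl
      simp only [h1, smul_apply, map_smul]
      rw [← smul_sub, norm_smul, RCLike.norm_conj, Circle.norm_coe, one_mul]

lemma commNorm_toProj (x : H →L[ℂ] H) (η : H) (u : UnitaryOp H) :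
    commNorm x η (toProj H u) = ‖Ad u x η - x η‖ := by
  rw [← unitary_norm_apply u⁻¹, map_sub, Ad_apply, unitary_inv_apply_apply]
  rfl

lemma continuous_commNorm (x : H →L[ℂ] H) (η : H) : Continuous (commNorm x η) := by
  refine continuous_coinduced_dom.2 ?_
  let _ := strongTopology H
  exact ((x.continuous.comp (continuous_inv_apply η)).sub (continuous_inv_apply (x η))).norm

namespace ConformalNet

variable (N : ConformalNet H)

lemma tendsto_Ad {F : ℕ → DiffPlus} {f : ℕ → UnitaryOp H} (hF : Tendsto F atTop (𝓝 1))
    (hf : ∀ n, toProj H (f n) = N.V (F n)) (x : H →L[ℂ] H) (η : H) :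
    Tendsto (fun n => Ad (f n) x η) atTop (𝓝 (x η)) := by
  rw [tendsto_iff_norm_sub_tendsto_zero]
  have h1 := ((continuous_commNorm x η).comp N.continuous_V).tendsto 1
  have h2 : commNorm x η (N.V 1) = 0 := by
    rw [_root_.map_one, ← _root_.map_one (toProj H), commNorm_toProj, Ad_apply, inv_one]
    exact norm_eq_zero.2 (sub_self _)
  rw [Function.comp_apply, h2] at h1
  refine (h1.comp hF).congr fun n => ?_
  rw [← commNorm_toProj, hf]; rfl

lemma Ad_eq_of_eqOn {γ δ : DiffPlus} (h : ∀ z ∈ rightArc.carrier, γ.1 z = δ.1 z)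
    {u v : UnitaryOp H} (hu : toProj H u = N.V γ) (hv : toProj H v = N.V δ)
    {x : H →L[ℂ] H} (hx : x ∈ N.algebra rightArc) : Ad u x = Ad v x := by
  have h1 : toProj H (v⁻¹ * u) = N.V (δ⁻¹ * γ) := by
    rw [_root_.map_mul, map_inv, hu, hv, _root_.map_mul, map_inv]
  have h2 : Ad (v⁻¹ * u) x = x := N.diff_locality (δ⁻¹ * γ) leftArc rightArc rightArc_eq_interior
    (fun z hz => by
      change δ.1.symm (γ.1 z) = z
      rw [h z hz, Equiv.symm_apply_apply]) _ h1 x hx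
  conv_rhs => rw [← h2, ← Ad_mul, mul_inv_cancel_left]

lemma Ad_mem {γ : DiffPlus} {u : UnitaryOp H} (hu : toProj H u = N.V γ) {I : Interval}
    {x : H →L[ℂ] H} (hx : x ∈ N.algebra I) : Ad u x ∈ N.algebra (I.map γ) :=
  (N.diff_covariance γ I u hu).subset (Set.mem_image_of_mem _ hx)

lemma norm_eq_one_of_apply_vacuum {u : UnitaryOp H} {c : ℂ} (h : (u : H →L[ℂ] H) N.Ω = c • N.Ω) :
    ‖c‖ = 1 := by
  have := unitary_norm_apply u N.Ω
  rwa [h, norm_smul, N.norm_vacuum, mul_one] at this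

lemma inv_apply_vacuum {u : UnitaryOp H} {c : ℂ} (h : (u : H →L[ℂ] H) N.Ω = c • N.Ω) :
    ((u⁻¹ : UnitaryOp H) : H →L[ℂ] H) N.Ω = c⁻¹ • N.Ω := by
  have hc : c ≠ 0 := fun h0 => by
    have := N.norm_eq_one_of_apply_vacuum h
    rw [h0, norm_zero] at this
    exact zero_ne_one this
  rw [eq_inv_smul_iff₀ hc, ← map_smul, ← h, unitary_inv_apply_apply]

lemma Ad_apply_vacuum {u : UnitaryOp H} {c : ℂ} (h : (u : H →L[ℂ] H) N.Ω = c • N.Ω)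
    (x : H →L[ℂ] H) : Ad u x N.Ω = c⁻¹ • (u : H →L[ℂ] H) (x N.Ω) := by
  rw [Ad_apply, N.inv_apply_vacuum h, map_smul, map_smul]

lemma vev_Ad {u : UnitaryOp H} {c : ℂ} (h : (u : H →L[ℂ] H) N.Ω = c • N.Ω) (x : H →L[ℂ] H) :
    N.vev (Ad u x) = N.vev x := by
  have hc := N.norm_eq_one_of_apply_vacuum h
  have h1 : conj (c⁻¹) * c⁻¹ = 1 := by
    rw [mul_comm, Complex.mul_conj, Complex.normSq_eq_norm_sq, norm_inv, hc]; simp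
  rw [MobiusCovariantNet.vev, N.Ad_apply_vacuum h, inner_smul_right, ← inner_unitary_inv,
    N.inv_apply_vacuum h, inner_smul_left, ← mul_assoc, mul_comm _ (conj _), h1, one_mul]
  rfl

lemma twoPt_Ad {u v : UnitaryOp H} {c : ℂ} (hu : (u : H →L[ℂ] H) N.Ω = c • N.Ω)
    (hv : (v : H →L[ℂ] H) N.Ω = c • N.Ω) {s t : ℝ} (h : u⁻¹ * N.U (T t) * v = N.U (T s))
    (x y : H →L[ℂ] H) : N.twoPt (Ad u x) (Ad v y) t = N.twoPt x y s := by
  have hc := N.norm_eq_one_of_apply_vacuum hu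
  have h1 : conj (c⁻¹) * c⁻¹ = 1 := by
    rw [mul_comm, Complex.mul_conj, Complex.normSq_eq_norm_sq, norm_inv, hc]; simp
  have h2 : inner ℂ ((u : H →L[ℂ] H) (star x N.Ω)) ((N.U (T t) : H →L[ℂ] H)
      ((v : H →L[ℂ] H) (y N.Ω))) = N.twoPt x y s := by
    have := inner_unitary_inv u⁻¹ (star x N.Ω) ((N.U (T t) : H →L[ℂ] H) ((v : H →L[ℂ] H) (y N.Ω)))
    rw [inv_inv] at this
    rw [this, ← unitary_mul_apply, ← unitary_mul_apply, h]; rfl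
  rw [MobiusCovariantNet.twoPt, star_Ad, N.Ad_apply_vacuum hu, N.Ad_apply_vacuum hv, map_smul,
    inner_smul_left, inner_smul_right, h2, ← mul_assoc, h1, one_mul]

/-- If `V(k)` fixes the vacuum up to a phase and `k` fixes the points with coordinates `0` and
`1`, with equal derivatives there, then these derivatives are equal to one. -/
theorem deriv_eq_one (hH : Module.finrank ℂ H ≠ 1) {k : DiffPlus} {u : UnitaryOp H}
    (hu : toProj H u = N.V k) {c : ℂ} (hc : (u : H →L[ℂ] H) N.Ω = c • N.Ω)
    (k0 : k.1 (pt 0) = pt 0) (k1 : k.1 (pt 1) = pt 1) {r : ℝ} (hr : 0 < r)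
    (d0 : HasDerivAt (fun t => tt (k.1 (pt t))) (r ^ 2) 0)
    (d1 : HasDerivAt (fun t => tt (k.1 (pt t))) (r ^ 2) 1) : r = 1 := by
  obtain ⟨m, x, hx, y, hy, M, hM, hasymp⟩ := N.exists_twoPt_asymptotics hH
  set k' : DiffPlus := (T 1).1⁻¹ * k * (T 1).1 with hk'
  set u' : UnitaryOp H := (N.U (T 1))⁻¹ * u * N.U (T 1) with hu'
  have hk'pt : ∀ t, k'.1 (pt t) = ((T 1)⁻¹).1.1 (k.1 (pt (t + 1))) := fun t => by
    rw [← T_pt 1 t]; rfl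
  have huk' : toProj H u' = N.V k' := by
    rw [hu', hk', _root_.map_mul, _root_.map_mul, map_inv, hu, _root_.map_mul, _root_.map_mul,
      map_inv, N.extends_U]
  have hc' : (u' : H →L[ℂ] H) N.Ω = c • N.Ω := by
    rw [hu', unitary_mul_apply, unitary_mul_apply, N.vacuum_invariant, hc, map_smul, ← map_inv,
      N.vacuum_invariant]
  have k0' : k'.1 (pt 0) = pt 0 := by
    rw [hk'pt, zero_add, k1, ← T_neg, T_pt]; congr 1; ring
  have d0' : HasDerivAt (fun t => tt (k'.1 (pt t))) (r ^ 2) 0 := by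
    have h1 : HasDerivAt (fun t => tt (k.1 (pt (t + 1))) - 1) (r ^ 2) 0 :=
      (HasDerivAt.comp_add_const (f := fun t => tt (k.1 (pt t))) 0 1
        (by rwa [zero_add])).sub_const 1
    refine h1.congr_of_eventuallyEq ?_
    have h2 : ∀ᶠ t in 𝓝 (0 : ℝ), k.1 (pt (t + 1)) ≠ -1 := by
      have h3 : Continuous fun t => k.1 (pt (t + 1)) :=
        (continuous_diffPlus k).comp (continuous_pt.comp (continuous_id.add continuous_const))
      refine h3.continuousAt.eventually_ne ?_
      rw [zero_add, k1]; exact pt_ne_neg_one 1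
    filter_upwards [h2] with t ht
    rw [hk'pt]
    conv_lhs => rw [← pt_tt ht, ← T_neg, T_pt, tt_pt]
    ring
  obtain ⟨F, hF1, hF⟩ := exists_rescaling k0 hr.ne' d0
  obtain ⟨G, hG1, hG⟩ := exists_rescaling k0' hr.ne' d0'
  obtain ⟨δ, hδ, hball⟩ := Metric.eventually_nhds_iff.1 (hF.and hG)
  set s : ℕ → ℝ := fun n => min δ 1 / 2 / (n + 1) with hs
  have hmin : 0 < min δ 1 / 2 := by have := lt_min hδ one_pos; positivity
  have hspos : ∀ n, 0 < s n := fun n => by positivity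
  have hs0 : Tendsto s atTop (𝓝 0) := by
    have := (tendsto_one_div_add_atTop_nhds_zero_nat (𝕜 := ℝ)).const_mul (min δ 1 / 2)
    rw [mul_zero] at this
    exact this.congr fun n => by rw [hs]; ring
  have hsδ : ∀ n, dist (s n) 0 < δ := fun n => by
    rw [dist_zero_right, Real.norm_of_nonneg (hspos n).le]
    have h1 : s n ≤ min δ 1 / 2 := div_le_self hmin.le (by linarith [Nat.cast_nonneg (α := ℝ) n])
    have h2 := min_le_left δ 1
    linarith
  have hrs : ∀ n, r * s n ≠ 0 := fun n => (mul_pos hr (hspos n)).ne'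
  set A : ℕ → Mob := fun n => D (s n) (hspos n).ne' with hA
  set B : ℕ → Mob := fun n => D (r * s n) (hrs n) with hB
  have key : ∀ {k : DiffPlus} {u : UnitaryOp H} {F : ℝ → DiffPlus}, toProj H u = N.V k →
      (u : H →L[ℂ] H) N.Ω = c • N.Ω → Tendsto F (𝓝 0) (𝓝 1) →
      (∀ n, bigArc.map (F (s n)) = bigArc ∧ ∀ hs : s n ≠ 0, ∀ z ∈ rightArc.carrier,
        (D (r * s n) (mul_ne_zero hr.ne' hs)).1.1 ((F (s n)).1 z) = k.1 ((D (s n) hs).1.1 z)) →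
      ∀ x ∈ N.algebra rightArc,
      (∀ n, (((N.U (B n))⁻¹ * u * N.U (A n) : UnitaryOp H) : H →L[ℂ] H) N.Ω = c • N.Ω) ∧
      (∀ n, Ad ((N.U (B n))⁻¹ * u * N.U (A n)) x ∈ N.algebra bigArc) ∧
      Tendsto (fun n => Ad ((N.U (B n))⁻¹ * u * N.U (A n)) x N.Ω) atTop (𝓝 (x N.Ω)) := by
    intro k u F hu hc hF hFk x hx
    choose f hf using fun n => exists_toProj (N.V (F (s n)))
    have h1 : ∀ n, ∀ x ∈ N.algebra rightArc,
        Ad ((N.U (B n))⁻¹ * u * N.U (A n)) x = Ad (f n) x := fun n x hx => by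
      refine N.Ad_eq_of_eqOn (γ := (B n).1⁻¹ * k * (A n).1) (fun z hz => ?_) ?_ (hf n) hx
      · change (B n).1.1.symm (k.1 ((A n).1.1 z)) = _
        rw [Equiv.symm_apply_eq]
        exact ((hFk n).2 (hspos n).ne' z hz).symm
      · rw [_root_.map_mul, _root_.map_mul, map_inv, hu, _root_.map_mul, _root_.map_mul,
          map_inv, N.extends_U, N.extends_U]
    refine ⟨fun n => ?_, fun n => ?_, ?_⟩
    · rw [unitary_mul_apply, unitary_mul_apply, N.vacuum_invariant, hc, map_smul, ← map_inv,
        N.vacuum_invariant]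
    · rw [h1 n x hx, ← (hFk n).1]
      exact N.Ad_mem (hf n) (N.isotony _ _ rightArc_subset_bigArc hx)
    · simp only [h1 _ x hx]
      exact N.tendsto_Ad (hF.comp hs0) hf x N.Ω
  have hx' : star x ∈ N.algebra rightArc := star_mem hx
  have hy' : star y ∈ N.algebra rightArc := star_mem hy
  obtain ⟨hX1, hX2, hX3⟩ := key hu hc hF1 (fun n => (hball (hsδ n)).1) x hx
  obtain ⟨-, -, hX4⟩ := key hu hc hF1 (fun n => (hball (hsδ n)).1) _ hx'
  obtain ⟨hY1, hY2, hY3⟩ := key huk' hc' hG1 (fun n => (hball (hsδ n)).2) y hy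
  obtain ⟨-, -, hY4⟩ := key huk' hc' hG1 (fun n => (hball (hsδ n)).2) _ hy'
  have ha : Tendsto (fun n => 1 / s n ^ 2) atTop atTop := by
    have h1 : Tendsto (fun n => s n ^ 2) atTop (𝓝[>] 0) := by
      refine tendsto_nhdsWithin_iff.2 ⟨?_, .of_forall fun n => pow_pos (hspos n) 2⟩
      simpa using hs0.pow 2
    exact h1.inv_tendsto_nhdsGT_zero.congr fun n => (one_div _).symm
  have hb : Tendsto (fun n => 1 / s n ^ 2 / r ^ 2) atTop atTop :=
    ha.atTop_div_const (by positivity)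
  have hle := N.isotony _ _ rightArc_subset_bigArc
  have l1 := hasymp (fun _ => x) (fun _ => y) (max ‖x‖ ‖y‖) (fun _ => le_max_left _ _)
    (fun _ => le_max_right _ _) (fun _ => hle hx) (fun _ => hle hy) tendsto_const_nhds
    tendsto_const_nhds tendsto_const_nhds tendsto_const_nhds _ ha
  have l2 := hasymp _ _ (max ‖x‖ ‖y‖) (fun n => (norm_Ad_le _ x).trans (le_max_left _ _))
    (fun n => (norm_Ad_le _ y).trans (le_max_right _ _)) hX2 hY2 hX3
    (by simpa only [star_Ad] using hX4) hY3 (by simpa only [star_Ad] using hY4) _ hb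
  have hTT : ∀ n, ((N.U (B n))⁻¹ * u * N.U (A n))⁻¹ * N.U (T (1 / s n ^ 2 / r ^ 2))
      * ((N.U (B n))⁻¹ * u' * N.U (A n)) = N.U (T (1 / s n ^ 2)) := fun n => by
    have e1 : B n * T (1 / s n ^ 2 / r ^ 2) = T 1 * B n := by
      rw [hB, D_mul_T]
      congr 2
      have := (hspos n).ne'
      field_simp
    have e2 : A n * T (1 / s n ^ 2) = T 1 * A n := by
      rw [hA, D_mul_T]
      congr 2
      have := (hspos n).ne'
      field_simp
    have e3 : N.U (B n) * N.U (T (1 / s n ^ 2 / r ^ 2)) * (N.U (B n))⁻¹ = N.U (T 1) := by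
      rw [← _root_.map_mul, e1, _root_.map_mul, mul_inv_cancel_right]
    have e4 : (N.U (A n))⁻¹ * N.U (T 1) * N.U (A n) = N.U (T (1 / s n ^ 2)) := by
      rw [mul_assoc, ← _root_.map_mul, ← e2, _root_.map_mul, inv_mul_cancel_left]
    rw [← e4, hu']
    calc _ = (N.U (A n))⁻¹ * u⁻¹ * (N.U (B n) * N.U (T (1 / s n ^ 2 / r ^ 2)) * (N.U (B n))⁻¹)
          * (N.U (T 1))⁻¹ * u * N.U (T 1) * N.U (A n) := by group
      _ = _ := by rw [e3]; group
  have l3 := (l2.const_mul (((r ^ 2 : ℝ) : ℂ) ^ (m + 1))).congr fun n => by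
    rw [N.twoPt_Ad (hX1 n) (hY1 n) (hTT n), N.vev_Ad (hX1 n), N.vev_Ad (hY1 n), ← mul_assoc,
      ← mul_pow, ← Complex.ofReal_mul, mul_div_cancel₀ _ (pow_ne_zero 2 hr.ne')]
  have h1 := tendsto_nhds_unique l3 l1
  have h2 : ((r ^ 2 : ℝ) : ℂ) ^ (m + 1) = 1 := mul_right_cancel₀ hM (by rw [h1, one_mul])
  have h3 : (r ^ 2) ^ (m + 1) = 1 := by exact_mod_cast h2
  have h4 : r ^ 2 = 1 := (pow_eq_one_iff_of_nonneg (by positivity) (Nat.succ_ne_zero m)).1 h3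
  exact (pow_eq_one_iff_of_nonneg hr.le two_ne_zero).1 h4

end ConformalNet

end CircleNet

namespace CircleNet

open Filter Topology

/-! ### Diffeomorphisms in the coordinate `t` -/

/-- A diffeomorphism in the coordinate `t`. -/
noncomputable def coord (k : DiffPlus) (t : ℝ) : ℝ := tt (k.1 (pt t))

lemma diffPlus_pt_ne {k : DiffPlus} (hk : k.1 (-1) = -1) (t : ℝ) : k.1 (pt t) ≠ -1 := fun h =>
  pt_ne_neg_one t (k.1.injective (h.trans hk.symm))

lemma pt_coord {k : DiffPlus} (hk : k.1 (-1) = -1) (t : ℝ) : pt (coord k t) = k.1 (pt t) :=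
  pt_tt (diffPlus_pt_ne hk t)

lemma contDiff_coord {k : DiffPlus} (hk : k.1 (-1) = -1) : ContDiff ℝ ∞ (coord k) := by
  have h := contDiff_diffPlus_pt k
  have h1 : ContDiff ℝ ∞ fun t => (k.1 (pt t) : ℂ).re := Complex.reCLM.contDiff.comp h
  have h2 : ContDiff ℝ ∞ fun t => (k.1 (pt t) : ℂ).im := Complex.imCLM.contDiff.comp h
  exact h2.div (contDiff_const.add h1) fun t => (one_add_re_pos (diffPlus_pt_ne hk t)).ne'

lemma hasDerivAt_coord {k : DiffPlus} (hk : k.1 (-1) = -1) (t : ℝ) :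
    HasDerivAt (coord k) (deriv (coord k) t) t :=
  ((contDiff_coord hk).differentiable (by simp) t).hasDerivAt

lemma deriv_coord_ne_zero {k : DiffPlus} (hk : k.1 (-1) = -1) (t : ℝ) :
    deriv (coord k) t ≠ 0 := by
  have hk' : (k⁻¹).1 (-1) = -1 := by
    change k.1.symm (-1) = -1
    rw [Equiv.symm_apply_eq, hk]
  have h1 : (fun s => coord k⁻¹ (coord k s)) = id := funext fun s => by
    rw [coord, pt_coord hk]
    change tt (k.1.symm (k.1 (pt s))) = s
    rw [Equiv.symm_apply_apply, tt_pt]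
  have h2 := (hasDerivAt_coord hk' (coord k t)).comp t (hasDerivAt_coord hk t)
  have h3 : HasDerivAt (fun s => coord k⁻¹ (coord k s)) 1 t := by
    rw [h1]; exact hasDerivAt_id t
  intro h0
  have := h2.unique h3
  rw [h0, mul_zero] at this
  exact zero_ne_one this

lemma eventually_tt_exp_lt {θ : ℝ} (hθ : Circle.exp θ ≠ -1) :
    ∀ᶠ x in 𝓝[>] θ, tt (Circle.exp θ) < tt (Circle.exp x) := by
  have hre : ∀ x : ℝ, (Circle.exp x : ℂ).re = Real.cos x := fun x => by
    rw [Circle.coe_exp, Complex.exp_ofReal_mul_I_re]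
  have him : ∀ x : ℝ, (Circle.exp x : ℂ).im = Real.sin x := fun x => by
    rw [Circle.coe_exp, Complex.exp_ofReal_mul_I_im]
  have h0 : 0 < 1 + Real.cos θ := hre θ ▸ one_add_re_pos hθ
  have h1 : HasDerivAt (fun x => tt (Circle.exp x)) (1 / (1 + Real.cos θ)) θ := by
    have h2 := (Real.hasDerivAt_sin θ).div ((Real.hasDerivAt_cos θ).const_add 1) h0.ne'
    have h3 : (fun x => tt (Circle.exp x)) = Real.sin / fun x => 1 + Real.cos x :=
      funext fun x => by
        rw [tt, hre, him]; rfl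
    rw [h3]
    refine h2.congr_deriv ?_
    rw [div_eq_div_iff (by positivity) h0.ne']
    have := Real.sin_sq_add_cos_sq θ
    linear_combination (1 + Real.cos θ) * this
  have h4 := (hasDerivAt_iff_tendsto_slope.1 h1).eventually (lt_mem_nhds (one_div_pos.2 h0))
  filter_upwards [h4.filter_mono (nhdsWithin_mono θ fun x (hx : θ < x) => hx.ne'),
    self_mem_nhdsWithin] with x hx (hx' : θ < x)
  rw [slope_def_field] at hx
  have := (div_pos_iff_of_pos_right (sub_pos.2 hx')).1 hx
  linarith

lemma deriv_coord_pos {k : DiffPlus} (hk : k.1 (-1) = -1) (t : ℝ) : 0 < deriv (coord k) t := by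
  refine lt_of_le_of_ne ?_ (deriv_coord_ne_zero hk t).symm
  obtain ⟨φ, hφ⟩ := k.2.2.2
  have hlim : Tendsto (fun s => φ (2 * Real.arctan s)) (𝓝[>] t) (𝓝[>] (φ (2 * Real.arctan t))) := by
    refine tendsto_nhdsWithin_iff.2 ⟨?_, ?_⟩
    · exact ((φ.continuous.comp (continuous_const.mul Real.continuous_arctan)).tendsto t).mono_left
        nhdsWithin_le_nhds
    · filter_upwards [self_mem_nhdsWithin] with s (hs : t < s)
      exact φ.strictMono (by linarith [Real.arctan_strictMono hs])
  have hne : Circle.exp (φ (2 * Real.arctan t)) ≠ -1 := by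
    rw [← hφ]; exact diffPlus_pt_ne hk t
  have h1 := (hasDerivAt_iff_tendsto_slope.1 (hasDerivAt_coord hk t)).mono_left
    (nhdsWithin_mono t (s := Set.Ioi t) fun x (hx : t < x) => hx.ne')
  refine ge_of_tendsto h1 ?_
  filter_upwards [hlim.eventually (eventually_tt_exp_lt hne), self_mem_nhdsWithin]
    with s hs (hs' : t < s)
  rw [← hφ, ← hφ] at hs
  rw [slope_def_field]
  exact div_nonneg (sub_nonneg.2 hs.le) (sub_pos.2 hs').le

/-- The only functions with positive derivative that preserve the infinitesimal cross-ratio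
`κ'(p) κ'(q) (q - p)² / (κ(q) - κ(p))²` on the whole line are affine. -/
lemma affine_of_deriv_mul_deriv {κ : ℝ → ℝ} (hpos : ∀ t, 0 < deriv κ t)
    (h : ∀ p q, p < q → deriv κ p * deriv κ q * (q - p) ^ 2 = (κ q - κ p) ^ 2) :
    ∃ a b : ℝ, 0 < a ∧ ∀ t, κ t = a * t + b := by
  have hmono : StrictMono κ := strictMono_of_deriv_pos hpos
  set g : ℝ → ℝ := fun t => (√(deriv κ t))⁻¹ with hg
  have hg0 : ∀ t, 0 < g t := fun t => inv_pos.2 (Real.sqrt_pos.2 (hpos t))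
  have hlt : ∀ p q, p < q → (κ q - κ p) * (g p * g q) = q - p := fun p q hpq => by
    have h1 : κ q - κ p = √(deriv κ p) * √(deriv κ q) * (q - p) := by
      refine (pow_left_inj₀ (sub_pos.2 (hmono hpq)).le
        (mul_nonneg (by positivity) (sub_pos.2 hpq).le) two_ne_zero).1 ?_
      rw [mul_pow, mul_pow, Real.sq_sqrt (hpos p).le, Real.sq_sqrt (hpos q).le, h p q hpq]
    have h2 := (Real.sqrt_pos.2 (hpos p)).ne'
    have h3 := (Real.sqrt_pos.2 (hpos q)).ne'
    rw [h1, hg]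
    field_simp
  have hall : ∀ p q, (κ q - κ p) * (g p * g q) = q - p := fun p q => by
    rcases lt_trichotomy p q with hpq | rfl | hpq
    · exact hlt p q hpq
    · simp
    · linear_combination -hlt q p hpq
  have haff : ∀ q, g q = g 0 + q * (g 1 - g 0) := fun q => by
    have h1 := hall 0 q
    have h2 := hall q 1
    have h3 := hall 0 1
    linear_combination -(g q) * h3 + g 1 * h1 + g 0 * h2
  have hconst : g 1 - g 0 = 0 := by
    by_contra hne
    have h1 := hg0 (-(g 0) / (g 1 - g 0))
    rw [haff, div_mul_cancel₀ _ hne] at h1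
    linarith
  have hg1 : ∀ t, g t = g 0 := fun t => by rw [haff, hconst]; ring
  have h0 := (hg0 0).ne'
  refine ⟨(g 0 ^ 2)⁻¹, κ 0, by have := hg0 0; positivity, fun t => ?_⟩
  have h1 := hall 0 t
  rw [hg1 t] at h1
  field_simp
  linear_combination h1

lemma J_neg_one {a b d : ℝ} (h : a * d - b * 0 = 1) : (J a b 0 d h).1.1 (-1) = -1 := by
  have ha : (a : ℂ) ≠ 0 := by
    rw [Complex.ofReal_ne_zero]
    rintro rfl
    simp at h
  refine Circle.ext ?_
  rw [J, mkMob_apply]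
  have h1 : ((-1 : Circle) : ℂ) = -1 := rfl
  rw [h1]
  have h2 : (⟨(a + d) / 2, (b - 0) / 2⟩ * -1 + ⟨(d - a) / 2, (b + 0) / 2⟩ : ℂ) = -a := by
    apply Complex.ext <;> simp; ring
  have h3 : (conj (⟨(d - a) / 2, (b + 0) / 2⟩ : ℂ) * -1 + conj (⟨(a + d) / 2, (b - 0) / 2⟩ : ℂ))
      = a := by
    apply Complex.ext <;> simp
    ring
  rw [h2, h3, neg_div, div_self ha]

/-- The affine map `t ↦ s ^ 2 * t + b`. -/
noncomputable def affineMap (s : ℝ) (hs : s ≠ 0) (b : ℝ) : Mob := T b * D s hs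

lemma affineMap_pt {s : ℝ} (hs : s ≠ 0) (b t : ℝ) :
    (affineMap s hs b).1.1 (pt t) = pt (s ^ 2 * t + b) := by
  change (T b).1.1 ((D s hs).1.1 (pt t)) = _
  rw [D_pt, T_pt]

lemma affineMap_neg_one {s : ℝ} (hs : s ≠ 0) (b : ℝ) : (affineMap s hs b).1.1 (-1) = -1 := by
  change (T b).1.1 ((D s hs).1.1 (-1)) = _
  rw [D, J_neg_one, T, J_neg_one]

lemma mem_mob_of_coord_affine {k : DiffPlus} (hk : k.1 (-1) = -1) {a b : ℝ} (ha : 0 < a)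
    (h : ∀ t, coord k t = a * t + b) : k ∈ Mob := by
  have hs : √a ≠ 0 := (Real.sqrt_pos.2 ha).ne'
  have h1 : k = (affineMap (√a) hs b).1 := diffPlus_ext fun z => by
    by_cases hz : z = -1
    · rw [hz, hk, affineMap_neg_one]
    · rw [← pt_tt hz, ← pt_coord hk, affineMap_pt, Real.sq_sqrt ha.le, h]
  rw [h1]
  exact (affineMap (√a) hs b).2

variable {H : Type*} [NormedAddCommGroup H] [InnerProductSpace ℂ H] [CompleteSpace H]

namespace ConformalNet

variable (N : ConformalNet H)

/-- The diffeomorphisms that fix the vacuum state. -/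
def vacuumStabilizer : Submonoid DiffPlus where
  carrier := {k | ∃ u : UnitaryOp H, toProj H u = N.V k ∧ ∃ c : ℂ, (u : H →L[ℂ] H) N.Ω = c • N.Ω}
  mul_mem' := by
    rintro k l ⟨u, hu, c, hc⟩ ⟨v, hv, d, hd⟩
    refine ⟨u * v, by rw [_root_.map_mul, _root_.map_mul, hu, hv], d * c, ?_⟩
    rw [unitary_mul_apply, hd, map_smul, hc, smul_smul]
  one_mem' := ⟨1, by rw [_root_.map_one, _root_.map_one], 1, (one_smul ℂ N.Ω).symm⟩

lemma mob_mem_vacuumStabilizer (g : Mob) : g.1 ∈ N.vacuumStabilizer :=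
  ⟨N.U g, (N.extends_U g).symm, 1, by rw [N.vacuum_invariant, one_smul]⟩

lemma deriv_mul_deriv_eq_one (hH : Module.finrank ℂ H ≠ 1) {k : DiffPlus}
    (hk : k ∈ N.vacuumStabilizer) (k0 : k.1 (pt 0) = pt 0) (k1 : k.1 (pt 1) = pt 1) {μ ν : ℝ}
    (hμ : 0 < μ) (hν : 0 < ν) (d0 : HasDerivAt (coord k) μ 0) (d1 : HasDerivAt (coord k) ν 1) :
    μ * ν = 1 := by
  obtain ⟨p, hp, hpμ⟩ : ∃ p : ℝ, 0 < p ∧ p ^ 4 = μ :=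
    ⟨√(√μ), by positivity, by
      rw [show 4 = 2 * 2 from rfl, pow_mul, Real.sq_sqrt (Real.sqrt_nonneg _), Real.sq_sqrt hμ.le]⟩
  obtain ⟨q, hq, hqν⟩ : ∃ q : ℝ, 0 < q ∧ q ^ 4 = ν :=
    ⟨√(√ν), by positivity, by
      rw [show 4 = 2 * 2 from rfl, pow_mul, Real.sq_sqrt (Real.sqrt_nonneg _), Real.sq_sqrt hν.le]⟩
  have hdet : q / p * (p / q) - 0 * (q / p - p / q) = 1 := by field_simp; ring
  set h : Mob := J (q / p) 0 (q / p - p / q) (p / q) hdet with hh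
  have hpt : ∀ t, (q / p - p / q) * t + p / q ≠ 0 →
      h.1.1 (pt t) = pt (q / p * t / ((q / p - p / q) * t + p / q)) := fun t ht => by
    rw [hh, J_pt hdet ht, add_zero]
  have hpq : p / q ≠ 0 := by positivity
  have hqp : q / p ≠ 0 := by positivity
  have hderiv : ∀ {t ρ : ℝ}, (q / p - p / q) * t + p / q ≠ 0 → k.1 (pt t) = pt t →
      HasDerivAt (coord k) ρ t → HasDerivAt (coord (h.1 * k))
        (ρ / ((q / p - p / q) * t + p / q) ^ 2) t := fun {t ρ} ht hfix hd => by
    have hκ : coord k t = t := by rw [coord, hfix, tt_pt]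
    have h1 := (hd.const_mul (q / p)).div ((hd.const_mul (q / p - p / q)).add_const (p / q))
      (by rwa [hκ])
    refine (h1.congr_deriv ?_).congr_of_eventuallyEq ?_
    · rw [hκ]
      congr 1
      linear_combination ρ * hdet
    · have h2 : ∀ᶠ s in 𝓝 t, k.1 (pt s) ≠ -1 := by
        have h3 : Continuous fun s => k.1 (pt s) := (continuous_diffPlus k).comp continuous_pt
        refine h3.continuousAt.eventually_ne ?_
        rw [hfix]; exact pt_ne_neg_one t
      have h4 : ∀ᶠ s in 𝓝 t, (q / p - p / q) * coord k s + p / q ≠ 0 :=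
        ((hd.const_mul (q / p - p / q)).add_const (p / q)).continuousAt.eventually_ne (by rwa [hκ])
      filter_upwards [h2, h4] with s hs hs'
      have h5 : k.1 (pt s) = pt (coord k s) := (pt_tt hs).symm
      change tt (h.1.1 (k.1 (pt s))) = _
      rw [h5, hpt _ hs', tt_pt]
      rfl
  obtain ⟨u, hu, c, hc⟩ := N.vacuumStabilizer.mul_mem (N.mob_mem_vacuumStabilizer h) hk
  have e0 : (q / p - p / q) * 0 + p / q = p / q := by ring
  have e1 : (q / p - p / q) * 1 + p / q = q / p := by ring
  have hr := N.deriv_eq_one hH hu hc (r := p * q)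
    (by
      change h.1.1 (k.1 (pt 0)) = _
      rw [k0, hpt 0 (by rwa [e0])]
      congr 1
      simp)
    (by
      change h.1.1 (k.1 (pt 1)) = _
      rw [k1, hpt 1 (by rwa [e1]), e1, mul_one, div_self hqp])
    (by positivity)
    ((hderiv (by rwa [e0]) k0 d0).congr_deriv (by rw [e0, ← hpμ]; field_simp))
    ((hderiv (by rwa [e1]) k1 d1).congr_deriv (by rw [e1, ← hqν]; field_simp))
  rw [← hpμ, ← hqν, ← mul_pow, hr, one_pow]

lemma deriv_coord_mul_deriv_coord (hH : Module.finrank ℂ H ≠ 1) {k : DiffPlus}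
    (hk : k ∈ N.vacuumStabilizer) (hk1 : k.1 (-1) = -1) {p q : ℝ} (hpq : p < q) :
    deriv (coord k) p * deriv (coord k) q * (q - p) ^ 2 = (coord k q - coord k p) ^ 2 := by
  have hκ : coord k p < coord k q := strictMono_of_deriv_pos (deriv_coord_pos hk1) hpq
  have h1 : 0 < q - p := sub_pos.2 hpq
  have h2 : 0 < coord k q - coord k p := sub_pos.2 hκ
  have hs1 : √(q - p) ≠ 0 := (Real.sqrt_pos.2 h1).ne'
  have hs2 : √(coord k q - coord k p) ≠ 0 := (Real.sqrt_pos.2 h2).ne'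
  set A := affineMap _ hs1 p
  set B := affineMap _ hs2 (coord k p)
  have hA : ∀ t, A.1.1 (pt t) = pt ((q - p) * t + p) := fun t => by
    rw [affineMap_pt, Real.sq_sqrt h1.le]
  have hB : ∀ t, (B⁻¹).1.1 (pt t) = pt ((t - coord k p) / (coord k q - coord k p)) := fun t => by
    change B.1.1.symm (pt t) = _
    rw [Equiv.symm_apply_eq, affineMap_pt, Real.sq_sqrt h2.le, mul_div_cancel₀ _ h2.ne',
      sub_add_cancel]
  have hpt : ∀ t, ((B⁻¹).1 * k * A.1).1 (pt t)
      = pt ((coord k ((q - p) * t + p) - coord k p) / (coord k q - coord k p)) := fun t => by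
    change (B⁻¹).1.1 (k.1 (A.1.1 (pt t))) = _
    rw [hA, ← pt_coord hk1, hB]
  have hcoord : coord ((B⁻¹).1 * k * A.1)
      = fun t => (coord k ((q - p) * t + p) - coord k p) / (coord k q - coord k p) :=
    funext fun t => by rw [coord, hpt, tt_pt]
  have hd : ∀ t, HasDerivAt (coord ((B⁻¹).1 * k * A.1))
      (deriv (coord k) ((q - p) * t + p) * (q - p) / (coord k q - coord k p)) t := fun t => by
    rw [hcoord]
    have h3 : HasDerivAt (fun t => (q - p) * t + p) (q - p) t := by
      simpa using ((hasDerivAt_id t).const_mul (q - p)).add_const p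
    exact (((hasDerivAt_coord hk1 _).comp t h3).sub_const _).div_const _
  have e0 : (q - p) * 0 + p = p := by ring
  have e1 : (q - p) * 1 + p = q := by ring
  have d0 := hd 0
  have d1 := hd 1
  rw [e0] at d0
  rw [e1] at d1
  have hprod := N.deriv_mul_deriv_eq_one hH
    (N.vacuumStabilizer.mul_mem (N.vacuumStabilizer.mul_mem (N.mob_mem_vacuumStabilizer B⁻¹) hk)
      (N.mob_mem_vacuumStabilizer A))
    (by rw [hpt, e0, sub_self, zero_div]) (by rw [hpt, e1, div_self h2.ne'])
    (by have := deriv_coord_pos hk1 p; positivity) (by have := deriv_coord_pos hk1 q; positivity)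
    d0 d1
  field_simp at hprod
  linarith

theorem mem_mob_of_mem_vacuumStabilizer (hH : Module.finrank ℂ H ≠ 1) {k : DiffPlus}
    (hk : k ∈ N.vacuumStabilizer) : k ∈ Mob := by
  obtain ⟨t, ht⟩ := exists_exp_eq (-1 * (k.1 (-1))⁻¹)
  have h1 : ((rot t).1 * k).1 (-1) = -1 := by
    change Circle.exp t * k.1 (-1) = -1
    rw [ht, inv_mul_cancel_right]
  have h2 := N.vacuumStabilizer.mul_mem (N.mob_mem_vacuumStabilizer (rot t)) hk
  obtain ⟨a, b, ha, hab⟩ := affine_of_deriv_mul_deriv (deriv_coord_pos h1)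
    fun p q hpq => N.deriv_coord_mul_deriv_coord hH h2 h1 hpq
  exact (Mob.mul_mem_cancel_left (rot t).2).1 (mem_mob_of_coord_affine h1 ha hab)

end ConformalNet

end CircleNet

theorem mainTheorem7 {H : Type*} [NormedAddCommGroup H] [InnerProductSpace ℂ H] [CompleteSpace H]
    (hH : Module.finrank ℂ H ≠ 1) (N : CircleNet.ConformalNet H) (γ : CircleNet.DiffPlus)
    (u : CircleNet.UnitaryOp H) (hu : CircleNet.toProj H u = N.V γ) :
    (u : H →L[ℂ] H) N.Ω ∈ Submodule.span ℂ {N.Ω} ↔ γ ∈ CircleNet.Mob := by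
  rw [Submodule.mem_span_singleton]
  constructor
  · rintro ⟨c, hc⟩
    exact N.mem_mob_of_mem_vacuumStabilizer hH ⟨u, hu, c, hc.symm⟩
  · intro hγ
    obtain ⟨c, hc⟩ := CircleNet.exists_smul_of_toProj_eq
      ((N.extends_U ⟨γ, hγ⟩).symm.trans hu.symm)
    exact ⟨c, by rw [hc, smul_apply, N.vacuum_invariant]⟩
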